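/- Let $d\in\mathbb N$, $\mathbb T^d=\mathbb R^d/\mathbb Z^d$ with its normalized Lebesgue measure, and let $a:\mathbb T^d\to\mathbb R^d$ be a $C^1$ vector field (that is, $1$-periodic in each coordinate) with $\operatorname{div} a=0$. Let $$K=\{g\in L^2(\mathbb T^d):\ a\cdot\nabla_v g=0\ \text{in } \mathcal D'(\mathbb T^d)\},$$ let $P$ be the orthogonal projection of $L^2(\mathbb T^d)$ onto $K$, let $Pa$ be the field obtained by applying $P$ to each component of $a$, and for $U^0\in L^2(\mathbb R^d\times\mathbb T^d)$ let $(PU^0)(x,\cdot)=P(U^0(x,\cdot))$ for a.e. $x$. Let $U^0\in L^2(\mathbb R^d\times\mathbb T^d)$ be a real function, defined everywhere, whose traces $x\mapsto U^0(x,x/\varepsilon)$ are measurable and satisfy, for some constant $C$, $$\int_{\mathbb R^d}|U^0(x,x/\varepsilon)|^2\,dx\le C\qquad\text{for all } 0<\varepsilon\le 1, \tag{$h_d$}$$ and which is the double-scale profile of these traces: $U^0(x,x/\varepsilon)\,\delta_p(v-x/\varepsilon)\rightharpoonup U^0$ weak-$\star$ in $L^2(\mathbb R^d;M(\mathbb T^d))$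 as $\varepsilon\to0^+$, that is, $$\int_{\mathbb R^d} U^0(x,x/\varepsilon)\,\theta(x,x/\varepsilon)\,dx\to\int_{\mathbb R^d}\int_{\mathbb T^d}U^0(x,v)\,\theta(x,v)\,dv\,dx\qquad\text{for all } \theta\in L^2(\mathbb R^d;C(\mathbb T^d)).$$ (All these conditions on $U^0$ hold whenever $U^0\in L^2(\mathbb R^d;C(\mathbb T^d))$; this is part of the claim.) Then there is an $f\in L^\infty([0,\infty),L^2(\mathbb R^d\times\mathbb T^d))$ with the following properties. 1. $f(t,x,\cdot)\in K$ for a.e. $(t,x)\in[0,\infty)\times\mathbb R^d$. 2. $f$ is a weak solution of $$\partial_t f+(Pa)(v)\cdot\nabla_x f=0,\qquad f(0,x,v)=PU^0(x,v),$$ tested against $C_c^\infty([0,\infty)\times\mathbb R^d\times\mathbb T^d)$, and it is the only one in $L^\infty([0,\infty),L^2(\mathbb R^d\times\mathbb T^d))$ up to equality a.e. 3. Let, for each $0<\varepsilon\le1$, $u_\varepsilon\in L^\infty([0,\infty),L^2(\mathbb R^d))$ be a weak solution of $$\partial_t u_\varepsilon+a\!\left(\tfrac x\varepsilon\right)\cdot\nabla_x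 u_\varepsilon=0,\qquad u_\varepsilon(0,x)=U^0\!\left(x,\tfrac x\varepsilon\right).$$ Then, as $\varepsilon\to0^+$, the whole family $f_\varepsilon=u_\varepsilon(t,x)\,\delta_p(v-x/\varepsilon)$ converges to $f$ weak-$\star$ in $L^\infty([0,\infty),L^2(\mathbb R^d;M(\mathbb T^d)))$, that is, $$\int_0^\infty\!\!\int_{\mathbb R^d}u_\varepsilon(t,x)\,\theta(t,x,x/\varepsilon)\,dx\,dt\to\int_0^\infty\!\!\int_{\mathbb R^d}\int_{\mathbb T^d}f\,\theta\,dv\,dx\,dt\qquad\text{for all }\theta\in L^1([0,\infty),L^2(\mathbb R^d;C(\mathbb T^d))),$$ and $u_\varepsilon\rightharpoonup u=\int_{\mathbb T^d}f\,dv$ weak-$\star$ in $L^\infty([0,\infty),L^2(\mathbb R^d))$. -/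

import Mathlib

open MeasureTheory Set Filter Topology
open scoped ENNReal NNReal ContDiff

noncomputable section

namespace Homog

/-- The Euclidean space `ℝ^d`. -/
abbrev E (d : ℕ) := EuclideanSpace ℝ (Fin d)

/-- The torus `𝕋^d = ℝ^d / ℤ^d`; its `volume` is the Haar probability measure. -/
abbrev T (d : ℕ) := UnitAddTorus (Fin d)

variable {d : ℕ}

/-- The quotient map `ℝ^d → 𝕋^d`. -/
def proj (y : E d) : T d := fun i => ((y i : ℝ) : UnitAddCircle)

/-- The class of `x / ε` in the torus. -/
def osc (ε : ℝ) (x : E d) : T d := proj (ε⁻¹ • x)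

/-- A function on the torus is `C^∞` when the corresponding periodic function is. -/
def SmoothTorus (ψ : T d → ℝ) : Prop := ContDiff ℝ ∞ (fun y : E d => ψ (proj y))

/-- `w · ∇ψ (v)`, the derivative at `v` of the function `ψ` on the torus in the direction `w`. -/
def torusDeriv (ψ : T d → ℝ) (v : T d) (w : E d) : ℝ :=
  fderiv ℝ (fun y : E d => ψ (v + proj y)) 0 w

/-- The divergence of a vector field on the torus. -/
def torusDiv (a : T d → E d) (v : T d) : ℝ :=
  ∑ i, torusDeriv (fun w => a w i) v (EuclideanSpace.single i 1)

/-! ### The kernel of `a · ∇_v` and the projection onto it -/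

theorem isOpenQuotientMap_proj : IsOpenQuotientMap (proj : E d → T d) := by
  have h : IsOpenQuotientMap
      (Pi.map (fun (_ : Fin d) (s : ℝ) => (s : UnitAddCircle))) :=
    IsOpenQuotientMap.piMap fun _ => QuotientAddGroup.isOpenQuotientMap_mk
  exact h.comp (EuclideanSpace.equiv (Fin d) ℝ).toHomeomorph.isOpenQuotientMap

theorem proj_add (x y : E d) : proj (x + y) = proj x + proj y := by
  ext i
  simp [proj]

theorem continuous_of_lift {X : Type*} [TopologicalSpace X] {g : T d → X}
    (hg : Continuous (fun y : E d => g (proj y))) : Continuous g :=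
  isOpenQuotientMap_proj.isQuotientMap.continuous_iff.2 hg

theorem torusDeriv_proj (ψ : T d → ℝ) (y w : E d) :
    torusDeriv ψ (proj y) w = fderiv ℝ (fun z : E d => ψ (proj z)) y w := by
  have h := fderiv_comp_add_left (𝕜 := ℝ) (f := fun z : E d => ψ (proj z)) (x := 0) y
  simp only [proj_add, add_zero] at h
  rw [torusDeriv, h]

theorem continuous_torusDeriv {a : T d → E d} (ha : ContDiff ℝ 1 (fun y : E d => a (proj y)))
    {ψ : T d → ℝ} (hψ : SmoothTorus ψ) : Continuous (fun v => torusDeriv ψ v (a v)) := by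
  apply continuous_of_lift
  simp only [torusDeriv_proj]
  exact (ContDiff.continuous_fderiv hψ (by simp)).clm_apply ha.continuous

theorem memLp_torusDeriv {a : T d → E d} (ha : ContDiff ℝ 1 (fun y : E d => a (proj y)))
    {ψ : T d → ℝ} (hψ : SmoothTorus ψ) :
    MemLp (fun v => torusDeriv ψ v (a v)) 2 (volume : Measure (T d)) :=
  (ContinuousMap.mk _ (continuous_torusDeriv ha hψ)).memLp volume ℝ

theorem integral_eq_inner {a : T d → E d} (ha : ContDiff ℝ 1 (fun y : E d => a (proj y)))
    {ψ : T d → ℝ} (hψ : SmoothTorus ψ) (g : Lp ℝ 2 (volume : Measure (T d))) :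
    ∫ v, g v * torusDeriv ψ v (a v) = inner ℝ ((memLp_torusDeriv ha hψ).toLp _) g := by
  rw [L2.inner_def]
  apply integral_congr_ae
  filter_upwards [(memLp_torusDeriv ha hψ).coeFn_toLp] with v hv
  simp [hv]

/-- `K = {g ∈ L²(𝕋^d) : a · ∇_v g = 0 in 𝒟'}`, for a divergence-free `C^1` field `a`: then
`⟨a · ∇_v g, ψ⟩ = - ∫ g div (ψ a) = - ∫ g (a · ∇_v ψ)`. -/
def kernelK (a : T d → E d) (ha : ContDiff ℝ 1 (fun y : E d => a (proj y))) :
    Submodule ℝ (Lp ℝ 2 (volume : Measure (T d))) where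
  carrier := {g | ∀ ψ : T d → ℝ, SmoothTorus ψ → ∫ v, g v * torusDeriv ψ v (a v) = 0}
  zero_mem' := fun ψ hψ => by rw [integral_eq_inner ha hψ, inner_zero_right]
  add_mem' := fun {f g} hf hg ψ hψ => by
    have h1 := hf ψ hψ
    have h2 := hg ψ hψ
    rw [integral_eq_inner ha hψ] at h1 h2 ⊢
    rw [inner_add_right, h1, h2, add_zero]
  smul_mem' := fun c f hf ψ hψ => by
    have h1 := hf ψ hψ
    rw [integral_eq_inner ha hψ] at h1 ⊢
    rw [inner_smul_right, h1, mul_zero]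

theorem isClosed_kernelK (a : T d → E d) (ha : ContDiff ℝ 1 (fun y : E d => a (proj y))) :
    IsClosed (kernelK a ha : Set (Lp ℝ 2 (volume : Measure (T d)))) := by
  have h : (kernelK a ha : Set (Lp ℝ 2 (volume : Measure (T d)))) =
      ⋂ (ψ : T d → ℝ) (hψ : SmoothTorus ψ),
        {g | inner ℝ ((memLp_torusDeriv ha hψ).toLp _) g = (0 : ℝ)} := by
    ext g
    simp only [mem_iInter, mem_ofPred_eq, SetLike.mem_coe]
    exact forall₂_congr fun ψ hψ => by rw [integral_eq_inner ha hψ]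
  rw [h]
  exact isClosed_iInter fun ψ => isClosed_iInter fun hψ =>
    isClosed_eq (continuous_const.inner continuous_id) continuous_const

instance (a : T d → E d) (ha : ContDiff ℝ 1 (fun y : E d => a (proj y))) :
    CompleteSpace (kernelK a ha) :=
  (isClosed_kernelK a ha).completeSpace_coe

/-- The orthogonal projection `P` of `L²(𝕋^d)` onto `K`. -/
def projK (a : T d → E d) (ha : ContDiff ℝ 1 (fun y : E d => a (proj y))) :
    Lp ℝ 2 (volume : Measure (T d)) →L[ℝ] Lp ℝ 2 (volume : Measure (T d)) :=
  (kernelK a ha).starProjection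

open Classical in
/-- `P g` for a square integrable function `g` on the torus (some representative of it). -/
def projFun (a : T d → E d) (ha : ContDiff ℝ 1 (fun y : E d => a (proj y)))
    (g : T d → ℝ) : T d → ℝ :=
  if h : MemLp g 2 volume then projK a ha (h.toLp g) else 0

/-- The vector field `P a`, projected component by component. -/
def projField (a : T d → E d) (ha : ContDiff ℝ 1 (fun y : E d => a (proj y))) (v : T d) : E d :=
  WithLp.toLp 2 fun i => projFun a ha (fun w => a w i) v

/-- `g ∈ K` for a function `g` on the torus. -/
def InK (a : T d → E d) (ha : ContDiff ℝ 1 (fun y : E d => a (proj y))) (g : T d → ℝ) : Prop :=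
  ∃ h : MemLp g 2 volume, h.toLp g ∈ kernelK a ha

/-! ### Function spaces in time -/

/-- Lebesgue measure on the time interval `[0, ∞)`. -/
def timeMeasure : Measure ℝ := volume.restrict (Ici 0)

/-- `f ∈ L^∞([0, ∞), L²(X))`. -/
def MemLinftyL2 {X : Type*} [MeasureSpace X] (f : ℝ → X → ℝ) : Prop :=
  AEStronglyMeasurable (Function.uncurry f) (timeMeasure.prod volume) ∧
    ∃ C : ℝ≥0, ∀ᵐ t ∂timeMeasure, eLpNorm (f t) 2 volume ≤ C

/-- `θ ∈ L¹([0, ∞), L²(ℝ^d, F))`. -/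
def MemL1L2 {F : Type*} [NormedAddCommGroup F] (θ : ℝ → E d → F) : Prop :=
  AEStronglyMeasurable (Function.uncurry θ) (timeMeasure.prod volume) ∧
    ∫⁻ t, eLpNorm (θ t) 2 volume ∂timeMeasure < ⊤

/-! ### The transport equation and the kinetic equation -/

/-- `u ∈ L^∞([0, ∞), L²(ℝ^d))` is a weak solution of `∂_t u + b · ∇_x u = 0`, `u(0) = u₀`,
where `b` is a divergence-free `C^1` field. Test functions need not vanish at `t = 0`. -/
def IsTransportSolution (b : E d → E d) (u₀ : E d → ℝ) (u : ℝ → E d → ℝ) : Prop :=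
  MemLinftyL2 u ∧
    ∀ φ : ℝ → E d → ℝ, ContDiff ℝ ∞ (Function.uncurry φ) →
      HasCompactSupport (Function.uncurry φ) →
      (∫ t in Ici (0 : ℝ), ∫ x, u t x * (deriv (fun s => φ s x) t + fderiv ℝ (φ t) x (b x)))
        + ∫ x, u₀ x * φ 0 x = 0

/-- `f ∈ L^∞([0, ∞), L²(ℝ^d × 𝕋^d))` is a weak solution of `∂_t f + b(v) · ∇_x f = 0`,
`f(0) = f₀`. Test functions are smooth and compactly supported on `ℝ × ℝ^d × 𝕋^d`. -/
def IsKineticSolution (b : T d → E d) (f₀ : E d → T d → ℝ) (f : ℝ → E d × T d → ℝ) : Prop :=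
  MemLinftyL2 f ∧
    ∀ φ : ℝ → E d → T d → ℝ,
      ContDiff ℝ ∞ (fun p : ℝ × E d × E d => φ p.1 p.2.1 (proj p.2.2)) →
      HasCompactSupport (fun p : ℝ × E d × T d => φ p.1 p.2.1 p.2.2) →
      (∫ t in Ici (0 : ℝ), ∫ x, ∫ v, f t (x, v) *
          (deriv (fun s => φ s x v) t + fderiv ℝ (fun y => φ t y v) x (b v)))
        + ∫ x, ∫ v, f₀ x v * φ 0 x v = 0

/-! ### Oscillating families -/

/-- The bound `∫ |U⁰(x, x/ε)|² dx ≤ C`, uniform in `0 < ε ≤ 1`. -/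
def BoundedData (U₀ : E d × T d → ℝ) : Prop :=
  ∃ C : ℝ≥0, ∀ ε ∈ Ioc (0 : ℝ) 1,
    AEStronglyMeasurable (fun x => U₀ (x, osc ε x)) volume ∧
      eLpNorm (fun x => U₀ (x, osc ε x)) 2 volume ≤ C

/-- `U⁰` is the profile of the oscillating data `U⁰(x, x/ε)`:
`U⁰(x, x/ε) δ_p(v - x/ε) ⇀ U⁰(x, v)` weak-⋆ in `L²(ℝ^d, M(𝕋^d))`. -/
def IsDataProfile (U₀ : E d × T d → ℝ) : Prop :=
  ∀ θ : E d → C(T d, ℝ), MemLp θ 2 volume →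
    Tendsto (fun ε : ℝ => ∫ x, U₀ (x, osc ε x) * θ x (osc ε x)) (𝓝[>] 0)
      (𝓝 (∫ x, ∫ v, U₀ (x, v) * θ x v))

/-- The action `⟨f_ε, θ⟩ = ∫∫ u_ε(t, x) θ(t, x, x/ε) dx dt` of
`f_ε(t, x, v) = u_ε(t, x) δ_p(v - x/ε)` on `θ ∈ L¹([0, ∞), L²(ℝ^d, C(𝕋^d)))`. -/
def doubleScaleKinetic (ε : ℝ) (u : ℝ → E d → ℝ) (θ : ℝ → E d → C(T d, ℝ)) : ℝ :=
  ∫ t in Ici (0 : ℝ), ∫ x, u t x * θ t x (osc ε x)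

/-- `u_ε δ_p(v - x/ε) ⇀ f` weak-⋆ in `L^∞([0, ∞), L²(ℝ^d, M(𝕋^d)))` as `ε → 0+`. -/
def DoubleScaleConverges (u : ℝ → ℝ → E d → ℝ) (f : ℝ → E d × T d → ℝ) : Prop :=
  ∀ θ : ℝ → E d → C(T d, ℝ), MemL1L2 θ →
    Tendsto (fun ε => doubleScaleKinetic ε (u ε) θ) (𝓝[>] 0)
      (𝓝 (∫ t in Ici (0 : ℝ), ∫ x, ∫ v, f t (x, v) * θ t x v))

/-- `u_ε ⇀ u` weak-⋆ in `L^∞([0, ∞), L²(ℝ^d))` as `ε → 0+`. -/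
def WeakStarConverges (u : ℝ → ℝ → E d → ℝ) (u' : ℝ → E d → ℝ) : Prop :=
  ∀ χ : ℝ → E d → ℝ, MemL1L2 χ →
    Tendsto (fun ε => ∫ t in Ici (0 : ℝ), ∫ x, u ε t x * χ t x) (𝓝[>] 0)
      (𝓝 (∫ t in Ici (0 : ℝ), ∫ x, u' t x * χ t x))

end Homog

end

noncomputable section

namespace Homog

variable {d : ℕ}

/-! ### The torus as a quotient of the Euclidean space -/

/-! The limit is identified without any compactness argument: a candidate `f` is written down, and
the defect between the pairing with `u_ε` and the pairing with `f` is shown to tend to zero along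
the whole family.

The structure of `K`. Mollification and a commutator estimate (`exists_smooth_approx_kernel`) give,
for every `g ∈ K`, smooth `ψ_n → g` in `L²` with `a · ∇ψ_n → 0` in `L²`. Hence `K` is stable under
smooth bounded functions with bounded derivative (`InK.comp`), then under indicators of superlevel
sets, and it consists of the square integrable functions that agree a.e. with one measurable for a
`σ`-algebra of invariant sets (`InK.exists_measurable`, `inK_of_measurable`). So `P` is a
conditional expectation. The field `Pa` has a bounded invariant representative `b`, and `PU⁰` is
represented by the conditional expectation `F` of `U⁰` on Borel sets times invariant sets. The
candidate is `f(t,x,v) = F(x - t b(v), v)`, that is `shear b F`. Its slices in `v` are built from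
invariant functions, so almost all of them lie in `K`; it solves the kinetic equation by integration
along straight lines.

A bound uniform in `ε`. The `u_ε` are arbitrary weak solutions in `L^∞(L²)`, with no bound assumed
uniform in `ε`. A divergence-free Lipschitz field is weakly skew-symmetric on `L²`
(`transport_skew`); applied to time mollifications of `u_ε`, this bounds the norm of `u_ε` by that
of its data (`transport_eLpNorm_le`), which is bounded in `ε` by hypothesis.

The limit equation. Testing with `φ(t,x) ψ(x/ε)` produces a term of order `1/ε` that contains `a ·
∇ψ`. After multiplication by `ε`, the pairing with `χ(t,x) (a · ∇ψ)(x/ε)` tends to zero, hence so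
does the pairing with `χ h` for every `h` orthogonal to `K`, since such `h` are limits of functions
`a · ∇ψ` (`OscSolution.tendsto_orthogonal`). If `ψ` is instead a bounded invariant function, the
singular term is absent (`OscSolution.weak_inK`), and `a` may be replaced by `b`, because `ψ (a_i -
b_i)` is orthogonal to `K`. These tests are discontinuous in `v`; they are admissible because
`h(x/ε)` is controlled in `L²` on balls by the `L²` norm of `h`, uniformly in `ε`
(`lintegral_ball_osc_le`).

The dual problem. The field `b` is only measurable in `v`, so the adjoint equation has no smooth
solution in general. In `tendsto_zero_of_transport`, `b` is replaced by finitely many constant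
directions on invariant pieces of the torus, and the adjoint equation is solved by line integrals
for each of them. With constant functionals this gives uniqueness (`ae_eq_zero_of_kinetic`); with
the defects of `u_ε` it gives convergence on `χ(t,x) ψ(v)` for invariant `ψ`. A continuous `ψ`
splits into its projection and a part orthogonal to `K`, on which both pairings are negligible.
Density and the uniform bounds then reach all test functions. -/

theorem continuous_proj : Continuous (proj : E d → T d) := isOpenQuotientMap_proj.continuous

theorem proj_surjective : Function.Surjective (proj : E d → T d) := isOpenQuotientMap_proj.surjective

@[simp] theorem proj_zero : proj (0 : E d) = 0 := by
  ext i; simp [proj]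

theorem proj_neg (y : E d) : proj (-y) = -proj y := by
  ext i; simp [proj]

theorem proj_sub (x y : E d) : proj (x - y) = proj x - proj y := by
  rw [sub_eq_add_neg, proj_add, proj_neg, sub_eq_add_neg]

theorem continuous_osc (ε : ℝ) : Continuous (osc ε : E d → T d) :=
  continuous_proj.comp (continuous_const_smul _)

theorem osc_add_smul {ε : ℝ} (hε : ε ≠ 0) (x z : E d) : osc ε (x + ε • z) = osc ε x + proj z := by
  rw [osc, smul_add, smul_smul, inv_mul_cancel₀ hε, one_smul, proj_add]; rfl

/-- The half-open unit cube. -/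
def unitCube (d : ℕ) : Set (E d) := {y | ∀ i, y i ∈ Ioc (0 : ℝ) 1}

theorem measurePreserving_proj :
    MeasurePreserving (proj : E d → T d) (volume.restrict (unitCube d)) volume := by
  have h1 := measurePreserving_pi (fun _ : Fin d => (volume : Measure ℝ).restrict (Ioc 0 1))
    (fun _ : Fin d => (volume : Measure UnitAddCircle))
    (fun i => by simpa using UnitAddCircle.measurePreserving_mk 0)
  rw [← Measure.restrict_pi_pi] at h1
  have h2 := (PiLp.volume_preserving_ofLp (Fin d)).restrict_preimage
    (s := univ.pi fun _ : Fin d => Ioc (0 : ℝ) 1)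
    (MeasurableSet.univ_pi fun _ => measurableSet_Ioc)
  have h3 : (WithLp.ofLp : E d → Fin d → ℝ) ⁻¹' (univ.pi fun _ : Fin d => Ioc (0 : ℝ) 1) =
      unitCube d := by
    ext y; simp [unitCube]
  rw [h3] at h2
  exact h1.comp h2

instance : IsProbabilityMeasure (volume : Measure (T d)) := by
  have : IsProbabilityMeasure (volume : Measure UnitAddCircle) := ⟨by simp⟩
  exact inferInstanceAs (IsProbabilityMeasure (Measure.pi fun _ : Fin d => (volume : Measure UnitAddCircle)))

instance : IsProbabilityMeasure ((volume : Measure (E d)).restrict (unitCube d)) :=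
  ⟨by rw [← preimage_univ (f := (proj : E d → T d)),
    measurePreserving_proj.measure_preimage MeasurableSet.univ.nullMeasurableSet, measure_univ]⟩

theorem norm_le_of_mem_unitCube {z : E d} (hz : z ∈ unitCube d) : ‖z‖ ≤ d + 1 := by
  rw [EuclideanSpace.norm_eq]
  have h : ∑ i, ‖z i‖ ^ 2 ≤ (d : ℝ) := by
    calc ∑ i, ‖z i‖ ^ 2 ≤ ∑ _i : Fin d, (1 : ℝ) := by
          refine Finset.sum_le_sum fun i _ => ?_
          rw [Real.norm_eq_abs, abs_of_pos (hz i).1]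
          exact pow_le_one₀ (hz i).1.le (hz i).2
      _ = d := by simp
  refine Real.sqrt_le_iff.2 ⟨by positivity, h.trans ?_⟩
  nlinarith [(Nat.cast_nonneg d : (0:ℝ) ≤ d)]

theorem measurableSet_unitCube : MeasurableSet (unitCube d) := by
  have h : unitCube d = ⋂ i, (fun y : E d => y i) ⁻¹' Ioc 0 1 := by
    ext y; simp [unitCube]
  rw [h]
  exact MeasurableSet.iInter fun i => measurableSet_Ioc.preimage (by fun_prop)

/-- Averaging a function on the torus over a translated unit cube. -/
theorem lintegral_unitCube (h : T d → ℝ≥0∞) (hh : Measurable h) (v : T d) :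
    ∫⁻ z in unitCube d, h (v + proj z) = ∫⁻ w, h w := by
  rw [measurePreserving_proj.lintegral_comp (f := fun w => h (v + w))
    (hh.comp (measurable_const_add v))]
  exact lintegral_add_left_eq_self h v

theorem integral_unitCube (h : T d → ℝ) (hh : AEStronglyMeasurable h volume) (v : T d) :
    ∫ z in unitCube d, h (v + proj z) = ∫ w, h w := by
  have h1 := integral_map (μ := volume.restrict (unitCube d)) (φ := (proj : E d → T d))
    measurePreserving_proj.measurable.aemeasurable (f := fun w => h (v + w))
    (by rw [measurePreserving_proj.map_eq]
        exact hh.comp_measurePreserving (measurePreserving_add_left volume v))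
  rw [measurePreserving_proj.map_eq] at h1
  rw [← h1]
  exact integral_add_left_eq_self h v

/-- An oscillating function is controlled, locally and uniformly in `ε`, by its mean. -/
theorem lintegral_ball_osc_le (R : ℝ) {ε : ℝ} (hε : ε ∈ Ioc (0 : ℝ) 1) (h : T d → ℝ≥0∞)
    (hh : Measurable h) :
    ∫⁻ x in Metric.closedBall (0 : E d) R, h (osc ε x) ≤
      volume (Metric.closedBall (0 : E d) (R + (d + 1))) * ∫⁻ v, h v := by
  set B := Metric.closedBall (0 : E d) R
  set B' := Metric.closedBall (0 : E d) (R + (d + 1))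
  have hosc : Measurable (osc ε : E d → T d) := (continuous_osc ε).measurable
  -- As `ε ≤ 1`, the shift by `ε z` moves points by at most `d + 1`, which explains the larger ball.
  -- It also adds `proj z` to the fast variable, so averaging over `z` replaces `h` by its mean at
  -- every `x`.
  have key : ∀ z ∈ unitCube d, ∫⁻ x in B, h (osc ε x) ≤ ∫⁻ x in B', h (osc ε x + proj z) := by
    intro z hz
    rw [← lintegral_indicator measurableSet_closedBall,
      ← lintegral_indicator measurableSet_closedBall,
      ← lintegral_add_right_eq_self _ (ε • z)]
    refine lintegral_mono fun x => ?_
    by_cases hx : x + ε • z ∈ B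
    · have hx' : x ∈ B' := by
        simp only [B, B', mem_closedBall_zero_iff] at hx ⊢
        have h1 : ‖ε • z‖ ≤ d + 1 := by
          rw [norm_smul, Real.norm_eq_abs, abs_of_pos hε.1]
          calc ε * ‖z‖ ≤ 1 * ‖z‖ := by gcongr; exact hε.2
            _ ≤ d + 1 := by rw [one_mul]; exact norm_le_of_mem_unitCube hz
        calc ‖x‖ = ‖(x + ε • z) - ε • z‖ := by simp
          _ ≤ ‖x + ε • z‖ + ‖ε • z‖ := norm_sub_le _ _
          _ ≤ R + (d + 1) := add_le_add hx h1
      rw [indicator_of_mem hx, indicator_of_mem hx', osc_add_smul hε.1.ne']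
    · rw [indicator_of_notMem hx]; exact zero_le
  calc ∫⁻ x in B, h (osc ε x) = ∫⁻ _z in unitCube d, ∫⁻ x in B, h (osc ε x) := by simp
    _ ≤ ∫⁻ z in unitCube d, ∫⁻ x in B', h (osc ε x + proj z) :=
        setLIntegral_mono' measurableSet_unitCube key
    _ = ∫⁻ x in B', ∫⁻ z in unitCube d, h (osc ε x + proj z) := by
        refine lintegral_lintegral_swap (Measurable.aemeasurable ?_)
        exact hh.comp ((hosc.comp measurable_snd).add
          (continuous_proj.measurable.comp measurable_fst))
    _ = volume B' * ∫⁻ v, h v := by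
        simp_rw [lintegral_unitCube h hh]
        rw [lintegral_const, mul_comm]; simp

/-! ### Continuity of translations -/

/-- Composition with measure-preserving continuous maps depends continuously on the map in `L^p`.
The parametrization `π` lets the same statement serve `ℝ^d` and, through `proj`, the torus. -/
theorem tendsto_eLpNorm_translate {G F : Type*} [AddCommGroup G] [TopologicalSpace G]
    [IsTopologicalAddGroup G] [LocallyCompactSpace G] [MeasurableSpace G] [BorelSpace G]
    (μ : Measure G) [μ.IsAddRightInvariant] [IsLocallyFiniteMeasure μ] [μ.InnerRegularCompactLTTop]
    [NormedAddCommGroup F] {p : ℝ≥0∞} [Fact (1 ≤ p)] (hp : p ≠ ⊤)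
    {π : E d → G} (hπ : Continuous π) (h0 : π 0 = 0) {g : G → F} (hg : MemLp g p μ) :
    Tendsto (fun h => eLpNorm (fun x => g (x - π h) - g x) p μ) (𝓝 0) (𝓝 0) := by
  let τ : E d → C(G, G) := fun h => ⟨fun x => x - π h, by fun_prop⟩
  have hτ : Continuous τ := by
    refine ContinuousMap.continuous_of_continuous_uncurry _ ?_
    exact continuous_snd.sub (hπ.comp continuous_fst)
  have hm : ∀ h, MeasurePreserving (τ h) μ μ := fun h => measurePreserving_sub_right μ (π h)
  have h1 := (tendsto_const_nhds (x := hg.toLp g) (f := 𝓝 (0 : E d))).compMeasurePreservingLp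
    (hτ.tendsto 0) hm (hm 0) hp
  rw [Lp.tendsto_Lp_iff_tendsto_eLpNorm'] at h1
  refine h1.congr fun h => eLpNorm_congr_ae ?_
  have h2 := (hg.comp_measurePreserving (hm h)).coeFn_toLp
  have h3 := (hg.comp_measurePreserving (hm 0)).coeFn_toLp
  filter_upwards [h2, h3] with x hx hx'
  simp only [Lp.toLp_compMeasurePreserving, Pi.sub_apply, hx, hx']
  simp [τ, h0]

/-! ### Double-scale limits of oscillating families -/

theorem aestronglyMeasurable_eval {α : Type*} [MeasurableSpace α] {μ : Measure α}
    {h : α → C(T d, ℝ)} (hh : AEStronglyMeasurable h μ) {φ : α → T d}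
    (hφ : AEStronglyMeasurable φ μ) :
    AEStronglyMeasurable (fun x => h x (φ x)) μ :=
  (ContinuousEval.continuous_eval (F := C(T d, ℝ))).comp_aestronglyMeasurable (hh.prodMk hφ)

theorem norm_eval_le (h : C(T d, ℝ)) (v : T d) : ‖h v‖ ≤ ‖h‖ := h.norm_coe_le_norm v

/-- The substitution `x ↦ x + ε z` leaves the integral unchanged and shifts the fast variable by
`z`. The resulting change of the slow variable costs little in `L¹(ℝ^d, C(𝕋^d))`, uniformly for `z`
in the unit cube, and the average over `z` of what remains is exactly the limit. -/
theorem tendsto_integral_osc {h : E d → C(T d, ℝ)} (hh : Integrable h) :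
    Tendsto (fun ε : ℝ => ∫ x, h x (osc ε x)) (𝓝[>] 0) (𝓝 (∫ x, ∫ v, h x v)) := by
  rw [Metric.tendsto_nhds]
  intro η hη
  have htr := tendsto_eLpNorm_translate (volume : Measure (E d)) (p := 1) (by simp)
    (π := fun y : E d => -y) continuous_neg (by simp) (memLp_one_iff_integrable.2 hh)
  have hev : ∀ᶠ y : E d in 𝓝 0,
      eLpNorm (fun x => h (x - -y) - h x) 1 volume < ENNReal.ofReal (η / 2) :=
    htr.eventually_lt_const (by simpa using hη)
  obtain ⟨r, hr, hball⟩ := Metric.eventually_nhds_iff.1 hev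
  have hr' : 0 < r / (d + 1) := by positivity
  filter_upwards [Ioo_mem_nhdsGT hr'] with ε hε
  have hmeas : ∀ z : E d, AEStronglyMeasurable (fun x => h x (osc ε x + proj z)) volume := fun z =>
    aestronglyMeasurable_eval hh.1
      (((continuous_osc ε).add continuous_const).aestronglyMeasurable)
  have hint : ∀ z : E d, Integrable (fun x => h x (osc ε x + proj z)) := fun z =>
    hh.norm.mono' (hmeas z) (ae_of_all _ fun x => norm_eval_le _ _)
  have hshift : ∀ z : E d, ∫ x, h x (osc ε x) = ∫ x, h (x + ε • z) (osc ε x + proj z) := by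
    intro z
    rw [← integral_add_right_eq_self _ (ε • z)]
    simp_rw [osc_add_smul hε.1.ne']
  have hclose : ∀ z ∈ unitCube d,
      ‖(∫ x, h x (osc ε x)) - ∫ x, h x (osc ε x + proj z)‖ ≤ η / 2 := by
    intro z hz
    have hint2 : Integrable (fun x => h (x + ε • z) (osc ε x + proj z)) := by
      have := (hint 0).comp_add_right (ε • z)
      simpa [osc_add_smul hε.1.ne'] using this
    rw [hshift z, ← integral_sub hint2 (hint z)]
    have hz' : dist (ε • z) 0 < r := by
      rw [dist_zero_right, norm_smul, Real.norm_eq_abs, abs_of_pos hε.1]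
      calc ε * ‖z‖ ≤ ε * (d + 1) := by gcongr; exacts [hε.1.le, norm_le_of_mem_unitCube hz]
        _ < r := by rw [← lt_div_iff₀ (by positivity)]; exact hε.2
    have h2 := hball hz'
    have h3 : Integrable (fun x => h (x - -(ε • z)) - h x) := by
      simp only [sub_neg_eq_add]
      exact (hh.comp_add_right (ε • z)).sub hh
    rw [eLpNorm_one_eq_lintegral_enorm, ← ofReal_integral_norm_eq_lintegral_enorm h3,
      ENNReal.ofReal_lt_ofReal_iff (by positivity)] at h2
    refine (norm_integral_le_of_norm_le h3.norm (ae_of_all _ fun x => ?_)).trans h2.le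
    simpa using norm_eval_le (h (x - -(ε • z)) - h x) (osc ε x + proj z)
  have hprod : Integrable (Function.uncurry fun (z x : E d) => h x (osc ε x + proj z))
      ((volume.restrict (unitCube d)).prod volume) := by
    have h1 : Integrable (fun p : E d × E d => h p.2)
        (((volume : Measure (E d)).restrict (unitCube d)).prod volume) := hh.comp_snd _
    refine h1.norm.mono' ?_ (ae_of_all _ fun p => norm_eval_le _ _)
    exact aestronglyMeasurable_eval h1.1
      ((((continuous_osc ε).comp continuous_snd).add
        (continuous_proj.comp continuous_fst)).aestronglyMeasurable)
  have hswap : ∫ z in unitCube d, ∫ x, h x (osc ε x + proj z) = ∫ x, ∫ v, h x v := by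
    rw [integral_integral_swap hprod]
    refine integral_congr_ae (ae_of_all _ fun x => ?_)
    exact integral_unitCube (fun v => h x v) (h x).continuous.aestronglyMeasurable _
  have hfin : (∫ x, h x (osc ε x)) - ∫ x, ∫ v, h x v =
      ∫ z in unitCube d, ((∫ x, h x (osc ε x)) - ∫ x, h x (osc ε x + proj z)) := by
    have h6 : Integrable (fun z => ∫ x, h x (osc ε x + proj z))
        (volume.restrict (unitCube d)) := hprod.integral_prod_left
    rw [integral_sub (integrable_const _) h6, ← hswap]
    simp
  rw [dist_eq_norm, hfin]
  have h4 := norm_setIntegral_le_of_norm_le_const (μ := volume) (s := unitCube d) (C := η / 2)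
    (by rw [← Measure.restrict_apply_univ, measure_univ]; simp) hclose
  have h5 : (volume : Measure (E d)).real (unitCube d) = 1 := by
    rw [measureReal_def, ← Measure.restrict_apply_univ, measure_univ, ENNReal.toReal_one]
  rw [h5, mul_one] at h4
  linarith

theorem memLp_uncurry_of_memLp {V : E d → C(T d, ℝ)} (hV : MemLp V 2 volume) :
    MemLp (fun p : E d × T d => V p.1 p.2) 2 volume := by
  have h1 : MemLp (fun p : E d × T d => V p.1) 2 (volume.prod volume) := hV.comp_fst _
  exact h1.norm.of_le (aestronglyMeasurable_eval h1.1 continuous_snd.aestronglyMeasurable)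
    (ae_of_all _ fun p => by simpa using norm_eval_le _ _)

theorem boundedData_of_memLp {V : E d → C(T d, ℝ)} (hV : MemLp V 2 volume) :
    BoundedData (fun p : E d × T d => V p.1 p.2) := by
  refine ⟨(eLpNorm V 2 volume).toNNReal, fun ε _ =>
    ⟨aestronglyMeasurable_eval hV.1 (continuous_osc ε).aestronglyMeasurable, ?_⟩⟩
  rw [ENNReal.coe_toNNReal hV.2.ne]
  exact eLpNorm_mono fun x => norm_eval_le _ _

theorem isDataProfile_of_memLp {V : E d → C(T d, ℝ)} (hV : MemLp V 2 volume) :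
    IsDataProfile (fun p : E d × T d => V p.1 p.2) := by
  intro θ hθ
  exact tendsto_integral_osc (h := fun x => V x * θ x) (hV.integrable_mul hθ)

/-! ### Calculus on the torus -/

theorem contDiff_coord {a : T d → E d} {n : WithTop ℕ∞}
    (ha : ContDiff ℝ n (fun y : E d => a (proj y))) (i : Fin d) :
    ContDiff ℝ n (fun y : E d => a (proj y) i) :=
  (EuclideanSpace.proj (𝕜 := ℝ) i).contDiff.comp ha

theorem continuous_torusDeriv_const {H : T d → ℝ} (hH : ContDiff ℝ 1 (fun y : E d => H (proj y)))
    (w : E d) : Continuous (fun v => torusDeriv H v w) := by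
  apply continuous_of_lift
  simp only [torusDeriv_proj]
  exact (hH.continuous_fderiv one_ne_zero).clm_apply continuous_const

theorem exists_bound_of_continuous {F : Type*} [SeminormedAddCommGroup F] {H : T d → F}
    (hH : Continuous H) : ∃ C : ℝ, 0 ≤ C ∧ ∀ v, ‖H v‖ ≤ C := by
  obtain ⟨C, hC⟩ := isCompact_univ.exists_bound_of_continuousOn hH.continuousOn
  exact ⟨C, (norm_nonneg _).trans (hC 0 (mem_univ _)), fun v => hC v (mem_univ v)⟩

/-- By translation invariance `s ↦ ∫ H(v + s w) dv` is constant; its derivative at `0` is this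
integral. -/
theorem integral_torusDeriv_const {H : T d → ℝ} (hH : ContDiff ℝ 1 (fun y : E d => H (proj y)))
    (w : E d) : ∫ v, torusDeriv H v w = 0 := by
  have hc := continuous_torusDeriv_const hH w
  have hHc : Continuous H := continuous_of_lift hH.continuous
  obtain ⟨C, -, hC⟩ := exists_bound_of_continuous hc
  have hder : ∀ (v : T d) (s : ℝ), HasDerivAt (fun s : ℝ => H (v + proj (s • w)))
      (torusDeriv H (v + proj (s • w)) w) s := by
    intro v s
    obtain ⟨y, rfl⟩ := proj_surjective v
    simp only [← proj_add, torusDeriv_proj]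
    have h1 : HasDerivAt (fun s : ℝ => y + s • w) w s := by
      simpa using ((hasDerivAt_id s).smul_const w).const_add y
    exact ((hH.differentiable one_ne_zero).differentiableAt.hasFDerivAt.comp_hasDerivAt s h1)
  have hcs : ∀ s : ℝ, Continuous fun v : T d => v + proj (s • w) := fun s => by fun_prop
  have h := (hasDerivAt_integral_of_dominated_loc_of_deriv_le (μ := (volume : Measure (T d)))
    (F := fun (s : ℝ) v => H (v + proj (s • w))) (x₀ := 0) (s := univ) (bound := fun _ => C)
    (F' := fun s v => torusDeriv H (v + proj (s • w)) w) univ_mem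
    (Eventually.of_forall fun s => (hHc.comp (hcs s)).aestronglyMeasurable)
    ((hHc.comp (hcs 0)).integrable_of_hasCompactSupport (HasCompactSupport.of_compactSpace _))
    (hc.comp (hcs 0)).aestronglyMeasurable
    (ae_of_all _ fun v s _ => hC _) (integrable_const _)
    (ae_of_all _ fun v s _ => hder v s)).2
  have hconst : (fun s : ℝ => ∫ v, H (v + proj (s • w))) = fun _ => ∫ v, H v := by
    ext s; exact integral_add_right_eq_self H _
  rw [hconst] at h
  have := h.unique (hasDerivAt_const 0 _)
  simpa using this

theorem torusDeriv_eq_sum (H : T d → ℝ) (v : T d) (w : E d) :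
    torusDeriv H v w = ∑ i, w i * torusDeriv H v (EuclideanSpace.single i 1) := by
  have hw : w = ∑ i, w i • (EuclideanSpace.single i (1 : ℝ) : E d) := by
    ext j; simp [Finset.sum_apply, Pi.single_apply]
  conv_lhs => rw [hw]
  simp [torusDeriv, map_sum]

theorem torusDeriv_mul {F G : T d → ℝ} (hF : ContDiff ℝ 1 (fun y : E d => F (proj y)))
    (hG : ContDiff ℝ 1 (fun y : E d => G (proj y))) (v : T d) (w : E d) :
    torusDeriv (fun v => F v * G v) v w = F v * torusDeriv G v w + G v * torusDeriv F v w := by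
  obtain ⟨y, rfl⟩ := proj_surjective v
  simp only [torusDeriv_proj]
  rw [fderiv_fun_mul (hF.differentiable one_ne_zero).differentiableAt
    (hG.differentiable one_ne_zero).differentiableAt]
  simp

theorem torusDeriv_comp {β : ℝ → ℝ} (hβ : ContDiff ℝ 1 β) {F : T d → ℝ}
    (hF : ContDiff ℝ 1 (fun y : E d => F (proj y))) (v : T d) (w : E d) :
    torusDeriv (fun v => β (F v)) v w = deriv β (F v) * torusDeriv F v w := by
  obtain ⟨y, rfl⟩ := proj_surjective v
  simp only [torusDeriv_proj]
  have h1 := (hβ.differentiable one_ne_zero (F (proj y))).hasDerivAt.comp_hasFDerivAt y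
    (f := fun y => F (proj y)) (hF.differentiable one_ne_zero).differentiableAt.hasFDerivAt
  have h2 := h1.fderiv
  simp only [Function.comp_def] at h2
  rw [h2]
  simp

theorem SmoothTorus.contDiff_one {ψ : T d → ℝ} (h : SmoothTorus ψ) :
    ContDiff ℝ 1 (fun y : E d => ψ (proj y)) := ContDiff.of_le h (by simp)

theorem SmoothTorus.continuous {ψ : T d → ℝ} (h : SmoothTorus ψ) : Continuous ψ :=
  continuous_of_lift (ContDiff.continuous h)

/-- Integration by parts for a divergence-free field. -/
theorem integral_torusDeriv_field {a : T d → E d}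
    (ha : ContDiff ℝ 1 (fun y : E d => a (proj y))) (hdiv : ∀ v, torusDiv a v = 0)
    {F : T d → ℝ} (hF : ContDiff ℝ 1 (fun y : E d => F (proj y))) :
    ∫ v, torusDeriv F v (a v) = 0 := by
  have hai := contDiff_coord ha
  -- Since `div a = 0`, the derivative of `F` along `a` is `div (F a)`, a sum of derivatives in
  -- constant directions.
  have key : ∀ v, torusDeriv F v (a v) =
      ∑ i, torusDeriv (fun w => F w * a w i) v (EuclideanSpace.single i 1) := by
    intro v
    have hm := fun i => torusDeriv_mul (G := fun w => a w i) hF (hai i) v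
      (EuclideanSpace.single i 1)
    have h0 := hdiv v
    rw [torusDiv] at h0
    rw [Finset.sum_congr rfl fun i _ => hm i, Finset.sum_add_distrib, ← Finset.mul_sum, h0, mul_zero, zero_add, torusDeriv_eq_sum]
  simp_rw [key]
  rw [integral_finsetSum]
  · exact Finset.sum_eq_zero fun i _ => integral_torusDeriv_const (hF.mul (hai i)) _
  · intro i _
    exact (continuous_torusDeriv_const (hF.mul (hai i)) _).integrable_of_hasCompactSupport
      (HasCompactSupport.of_compactSpace _)

/-! ### Density of the smooth functions -/

theorem smoothTorus_const (c : ℝ) : SmoothTorus (fun _ : T d => c) := contDiff_const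

theorem SmoothTorus.add {φ ψ : T d → ℝ} (h : SmoothTorus φ) (h' : SmoothTorus ψ) :
    SmoothTorus (fun v => φ v + ψ v) := ContDiff.add h h'

theorem SmoothTorus.mul {φ ψ : T d → ℝ} (h : SmoothTorus φ) (h' : SmoothTorus ψ) :
    SmoothTorus (fun v => φ v * ψ v) := ContDiff.mul h h'

theorem SmoothTorus.comp {β : ℝ → ℝ} (hβ : ContDiff ℝ ∞ β) {ψ : T d → ℝ} (h : SmoothTorus ψ) :
    SmoothTorus (fun v => β (ψ v)) := ContDiff.comp hβ h

/-- The algebra of smooth functions on the torus. -/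
def smoothSubalgebra (d : ℕ) : Subalgebra ℝ C(T d, ℝ) where
  carrier := {ψ | SmoothTorus ψ}
  mul_mem' := fun h h' => h.mul h'
  add_mem' := fun h h' => h.add h'
  algebraMap_mem' := fun c => smoothTorus_const c

theorem toCircle_coe (s : ℝ) :
    (AddCircle.toCircle (s : UnitAddCircle) : ℂ) =
      Real.cos (2 * Real.pi * s) + Real.sin (2 * Real.pi * s) * Complex.I := by
  rw [AddCircle.toCircle_apply_mk, Circle.coe_exp, Complex.exp_mul_I]
  simp

/-- The functions `cos (2π v_i)` and `sin (2π v_i)` are smooth and together determine `v_i`. -/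
theorem smoothSubalgebra_separatesPoints : (smoothSubalgebra d).SeparatesPoints := by
  intro v w hvw
  obtain ⟨i, hi⟩ := Function.ne_iff.1 hvw
  by_contra! hcon
  have hc : Continuous fun v : T d => (AddCircle.toCircle (v i) : ℂ) :=
    continuous_subtype_val.comp (AddCircle.continuous_toCircle.comp (continuous_apply i))
  have h1 := hcon _ ⟨⟨_, Complex.continuous_re.comp hc⟩, by
    change ContDiff ℝ ∞ fun y : E d => (AddCircle.toCircle ((y i : ℝ) : UnitAddCircle) : ℂ).re
    simp only [toCircle_coe]
    simp only [Complex.add_re, Complex.ofReal_re, Complex.re_ofReal_mul, Complex.I_re, mul_zero,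
      add_zero]
    exact Real.contDiff_cos.comp (contDiff_const.mul (EuclideanSpace.proj (𝕜 := ℝ) i).contDiff),
    rfl⟩
  have h2 := hcon _ ⟨⟨_, Complex.continuous_im.comp hc⟩, by
    change ContDiff ℝ ∞ fun y : E d => (AddCircle.toCircle ((y i : ℝ) : UnitAddCircle) : ℂ).im
    simp only [toCircle_coe]
    simp only [Complex.add_im, Complex.ofReal_im, Complex.im_ofReal_mul, Complex.I_im, mul_one,
      zero_add]
    exact Real.contDiff_sin.comp (contDiff_const.mul (EuclideanSpace.proj (𝕜 := ℝ) i).contDiff),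
    rfl⟩
  exact hi (AddCircle.injective_toCircle one_ne_zero (Subtype.ext (Complex.ext h1 h2)))

/-- Stone–Weierstrass for the algebra of smooth functions. -/
theorem exists_smooth_near (h : C(T d, ℝ)) {η : ℝ} (hη : 0 < η) :
    ∃ ψ : T d → ℝ, SmoothTorus ψ ∧ ∀ v, ‖h v - ψ v‖ ≤ η := by
  have h1 : h ∈ (smoothSubalgebra d).topologicalClosure := by
    rw [ContinuousMap.subalgebra_topologicalClosure_eq_top_of_separatesPoints _
      smoothSubalgebra_separatesPoints]
    trivial
  obtain ⟨ψ, hψ, hd⟩ := Metric.mem_closure_iff.1 h1 η hη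
  refine ⟨ψ, hψ, fun v => ?_⟩
  rw [← dist_eq_norm]
  exact (ContinuousMap.dist_apply_le_dist v).trans hd.le

theorem memLp_of_continuous {h : T d → ℝ} (hh : Continuous h) (p : ℝ≥0∞) : MemLp h p volume := by
  obtain ⟨C, -, hC⟩ := exists_bound_of_continuous hh
  exact MemLp.of_bound hh.aestronglyMeasurable C (ae_of_all _ hC)

theorem exists_smooth_eLpNorm_sub_le {g : T d → ℝ} (hg : MemLp g 2 volume) {η : ℝ≥0∞}
    (hη : η ≠ 0) : ∃ ψ : T d → ℝ, SmoothTorus ψ ∧ eLpNorm (g - ψ) 2 volume ≤ η := by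
  obtain ⟨η', hη0, hη'⟩ := ENNReal.lt_iff_exists_nnreal_btwn.1 (pos_iff_ne_zero.2 hη)
  have hη0' : 0 < (η' : ℝ) := by exact_mod_cast hη0
  obtain ⟨h₀, hh₀, -⟩ := hg.exists_boundedContinuous_eLpNorm_sub_le (by simp)
    (ε := ENNReal.ofReal (η' / 2)) (by simpa using hη0)
  obtain ⟨h, hc, hh⟩ : ∃ h : T d → ℝ, Continuous h ∧
      eLpNorm (g - h) 2 volume ≤ ENNReal.ofReal (η' / 2) := ⟨h₀, h₀.continuous, hh₀⟩
  obtain ⟨ψ, hψ, hψ'⟩ := exists_smooth_near ⟨h, hc⟩ (η := η' / 2) (by positivity)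
  refine ⟨ψ, hψ, ?_⟩
  have hhm : MemLp h 2 volume := memLp_of_continuous hc 2
  have hψm : MemLp ψ 2 volume := memLp_of_continuous hψ.continuous 2
  have h2 : eLpNorm (h - ψ) 2 volume ≤ ENNReal.ofReal (η' / 2) := by
    refine (eLpNorm_le_of_ae_bound (C := η' / 2) (ae_of_all _ hψ')).trans ?_
    simp
  calc eLpNorm (g - ψ) 2 volume = eLpNorm ((g - h) + (h - ψ)) 2 volume := by simp
    _ ≤ eLpNorm (g - h) 2 volume + eLpNorm (h - ψ) 2 volume :=
        eLpNorm_add_le (hg.1.sub hhm.1) (hhm.1.sub hψm.1) (by simp)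
    _ ≤ ENNReal.ofReal (η' / 2) + ENNReal.ofReal (η' / 2) := add_le_add hh h2
    _ = η' := by rw [← ENNReal.ofReal_add (by positivity) (by positivity)]; simp
    _ ≤ η := hη'.le

theorem ae_eq_zero_of_integral_smooth {g : T d → ℝ} (hg : MemLp g 2 volume)
    (h : ∀ ψ : T d → ℝ, SmoothTorus ψ → ∫ v, g v * ψ v = 0) : g =ᵐ[volume] 0 := by
  have h0 : hg.toLp g = 0 := by
    have hd : Dense {f : Lp ℝ 2 (volume : Measure (T d)) |
        ∃ (ψ : T d → ℝ) (hψ : SmoothTorus ψ), f = (memLp_of_continuous hψ.continuous 2).toLp ψ} := by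
      intro f
      rw [Metric.mem_closure_iff]
      intro η hη
      obtain ⟨ψ, hψ, hψ'⟩ := exists_smooth_eLpNorm_sub_le (Lp.memLp f)
        (η := ENNReal.ofReal (η / 2)) (by simpa using hη)
      refine ⟨_, ⟨ψ, hψ, rfl⟩, ?_⟩
      rw [Lp.dist_def]
      have h1 : eLpNorm (⇑f - ⇑((memLp_of_continuous hψ.continuous 2).toLp ψ)) 2 volume =
          eLpNorm (⇑f - ψ) 2 volume :=
        eLpNorm_congr_ae ((ae_eq_refl _).sub (MemLp.coeFn_toLp _))
      rw [h1]
      refine lt_of_le_of_lt (ENNReal.toReal_mono (by simp) hψ') ?_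
      rw [ENNReal.toReal_ofReal (by positivity)]
      linarith
    refine hd.eq_zero_of_inner_left (𝕜 := ℝ) fun f hf => ?_
    obtain ⟨ψ, hψ, rfl⟩ := hf
    rw [L2.inner_def, ← h ψ hψ]
    refine integral_congr_ae ?_
    filter_upwards [hg.coeFn_toLp, (memLp_of_continuous hψ.continuous 2).coeFn_toLp] with v h1 h2
    simp [h1, h2, mul_comm]
  have := hg.coeFn_toLp
  rw [h0] at this
  exact this.symm.trans (Lp.coeFn_zero _ _ _)

/-! ### Bounded Lipschitz divergence-free fields -/

/-- A bounded, Lipschitz, divergence-free `C^1` field on the Euclidean space. -/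
structure DivFreeField (b : E d → E d) : Prop where
  contDiff : ContDiff ℝ 1 b
  bounded : ∃ M : ℝ, ∀ x, ‖b x‖ ≤ M
  lipschitz : ∃ L : ℝ≥0, LipschitzWith L b
  div_eq_zero : ∀ x, ∑ i, fderiv ℝ b x (EuclideanSpace.single i 1) i = 0

theorem fderiv_coord {b : E d → E d} {x : E d} (hb : DifferentiableAt ℝ b x) (i : Fin d)
    (w : E d) : fderiv ℝ (fun y => b y i) x w = fderiv ℝ b x w i := by
  have := ((EuclideanSpace.proj (𝕜 := ℝ) i).hasFDerivAt.comp x hb.hasFDerivAt).fderiv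
  simp only [Function.comp_def] at this
  exact DFunLike.congr_fun this w

/-- The derivative of a periodic function is periodic, hence a continuous function on the compact
torus. -/
theorem exists_bound_fderiv_lift {a : T d → E d} (ha : ContDiff ℝ 1 (fun y : E d => a (proj y))) :
    ∃ L : ℝ≥0, ∀ y : E d, ‖fderiv ℝ (fun z : E d => a (proj z)) y‖₊ ≤ L := by
  have hD : ∀ y : E d, fderiv ℝ (fun z : E d => a (proj y + proj z)) 0 =
      fderiv ℝ (fun z : E d => a (proj z)) y := by
    intro y
    have h := fderiv_comp_add_left (𝕜 := ℝ) (f := fun z : E d => a (proj z)) (x := 0) y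
    simpa only [proj_add, add_zero] using h
  have hc : Continuous fun v : T d => fderiv ℝ (fun z : E d => a (v + proj z)) 0 := by
    apply continuous_of_lift
    simp only [hD]
    exact ha.continuous_fderiv one_ne_zero
  obtain ⟨C, hC0, hC⟩ := exists_bound_of_continuous hc
  refine ⟨⟨C, hC0⟩, fun y => ?_⟩
  rw [← hD y]
  exact hC (proj y)

/-- The Lipschitz constant obtained grows like `1/ε`. This is harmless: it is used only at fixed
`ε`, and it does not enter the energy bound. -/
theorem divFreeField_osc {a : T d → E d} (ha : ContDiff ℝ 1 (fun y : E d => a (proj y)))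
    (hdiv : ∀ v, torusDiv a v = 0) (ε : ℝ) : DivFreeField (fun x => a (osc ε x)) := by
  have h1 : ContDiff ℝ 1 (fun x : E d => a (osc ε x)) :=
    ha.comp (contDiff_const_smul ε⁻¹)
  have hfd : ∀ x w : E d, fderiv ℝ (fun x => a (osc ε x)) x w =
      ε⁻¹ • fderiv ℝ (fun z : E d => a (proj z)) (ε⁻¹ • x) w := by
    intro x w
    have := (((ha.differentiable one_ne_zero) (ε⁻¹ • x)).hasFDerivAt.comp x
      ((hasFDerivAt_id x).const_smul ε⁻¹)).fderiv
    simp only [Function.comp_def] at this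
    refine (DFunLike.congr_fun this w).trans ?_
    simp
  refine ⟨h1, ?_, ?_, ?_⟩
  · obtain ⟨C, -, hC⟩ := exists_bound_of_continuous (continuous_of_lift ha.continuous)
    exact ⟨C, fun x => hC _⟩
  · obtain ⟨L, hL⟩ := exists_bound_fderiv_lift ha
    refine ⟨L * ‖ε⁻¹‖₊, ?_⟩
    exact (lipschitzWith_of_nnnorm_fderiv_le (ha.differentiable one_ne_zero) hL).comp
      (lipschitzWith_smul ε⁻¹)
  · intro x
    have h0 := hdiv (proj (ε⁻¹ • x))
    rw [torusDiv] at h0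
    simp only [torusDeriv_proj] at h0
    simp only [fderiv_coord (ha.differentiable one_ne_zero).differentiableAt] at h0
    simp only [hfd, PiLp.smul_apply, smul_eq_mul, ← Finset.mul_sum, h0, mul_zero]

theorem DivFreeField.continuous {b : E d → E d} (hb : DivFreeField b) : Continuous b :=
  hb.contDiff.continuous

theorem clm_apply_eq_sum (D : E d →L[ℝ] ℝ) (w : E d) :
    D w = ∑ i, w i * D (EuclideanSpace.single i 1) := by
  have hw : w = ∑ i, w i • (EuclideanSpace.single i (1 : ℝ) : E d) := by
    ext j; simp [Finset.sum_apply, Pi.single_apply]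
  conv_lhs => rw [hw]
  simp [map_sum]

theorem DivFreeField.integral_fderiv_eq_zero {b : E d → E d} (hb : DivFreeField b)
    {ρ : E d → ℝ} (hρ : ContDiff ℝ 1 ρ) (hρc : HasCompactSupport ρ) :
    ∫ h, fderiv ℝ ρ h (b h) = 0 := by
  have hbi : ∀ i, ContDiff ℝ 1 fun y => b y i := fun i =>
    (EuclideanSpace.proj (𝕜 := ℝ) i).contDiff.comp hb.contDiff
  have hdρ : Continuous (fderiv ℝ ρ) := hρ.continuous_fderiv one_ne_zero
  have i1 : ∀ i, Integrable fun h => b h i * fderiv ℝ ρ h (EuclideanSpace.single i 1) := fun i => by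
    refine (((hbi i).continuous.mul (hdρ.clm_apply continuous_const))).integrable_of_hasCompactSupport
      ?_
    exact (hρc.fderiv_apply ℝ _).mul_left
  have i2 : ∀ i, Integrable fun h =>
      fderiv ℝ (fun y => b y i) h (EuclideanSpace.single i 1) * ρ h := fun i => by
    refine ((((hbi i).continuous_fderiv one_ne_zero).clm_apply
      continuous_const).mul hρ.continuous).integrable_of_hasCompactSupport hρc.mul_left
  have i3 : ∀ i, Integrable fun h => b h i * ρ h := fun i =>
    ((hbi i).continuous.mul hρ.continuous).integrable_of_hasCompactSupport hρc.mul_left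
  simp_rw [fun h => clm_apply_eq_sum (fderiv ℝ ρ h) (b h)]
  rw [integral_finsetSum _ fun i _ => i1 i]
  simp_rw [fun i => integral_mul_fderiv_eq_neg_fderiv_mul_of_integrable (i2 i) (i1 i) (i3 i)
    (fun x _ => ((hbi i).differentiable one_ne_zero).differentiableAt)
    (fun x _ => (hρ.differentiable one_ne_zero).differentiableAt)]
  rw [Finset.sum_neg_distrib, ← integral_finsetSum _ fun i _ => i2 i, neg_eq_zero]
  refine integral_eq_zero_of_ae (ae_of_all _ fun h => ?_)
  simp only [fderiv_coord (hb.contDiff.differentiable one_ne_zero).differentiableAt,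
    ← Finset.sum_mul, hb.div_eq_zero, zero_mul, Pi.zero_apply]

/-- The reflected field is the one that appears when a mollification is expanded around `x`; its
zero divergence allows a constant to be subtracted in the commutator. -/
theorem DivFreeField.comp_sub {b : E d → E d} (hb : DivFreeField b) (x : E d) :
    DivFreeField (fun h => b (x - h)) := by
  have hfd : ∀ y w : E d, fderiv ℝ (fun h => b (x - h)) y w = -fderiv ℝ b (x - y) w := by
    intro y w
    have := ((hb.contDiff.differentiable one_ne_zero (x - y)).hasFDerivAt.comp y
      ((hasFDerivAt_id y).const_sub x)).fderiv
    simp only [Function.comp_def] at this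
    refine (DFunLike.congr_fun this w).trans ?_
    simp
  obtain ⟨M, hM⟩ := hb.bounded
  obtain ⟨L, hL⟩ := hb.lipschitz
  refine ⟨hb.contDiff.comp (contDiff_const.sub contDiff_id), ⟨M, fun y => hM _⟩,
    ⟨L, fun y z => ?_⟩, fun y => ?_⟩
  · simpa using hL (x - y) (x - z)
  · simp only [hfd, PiLp.neg_apply, Finset.sum_neg_distrib, hb.div_eq_zero, neg_zero]

/-! ### Mollification and the commutator estimate -/

theorem eLpNorm_two_sq {α F : Type*} [MeasurableSpace α] {μ : Measure α} [NormedAddCommGroup F]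
    (f : α → F) : eLpNorm f 2 μ ^ 2 = ∫⁻ x, ‖f x‖ₑ ^ 2 ∂μ := by
  rw [eLpNorm_eq_lintegral_rpow_enorm_toReal (by simp) (by simp)]
  simp only [ENNReal.toReal_ofNat, ENNReal.rpow_ofNat, one_div]
  rw [← ENNReal.rpow_natCast, ← ENNReal.rpow_mul]
  simp

theorem sq_lintegral_le {α : Type*} [MeasurableSpace α] {ν : Measure α} {f : α → ℝ≥0∞}
    (hf : AEMeasurable f ν) : (∫⁻ x, f x ∂ν) ^ 2 ≤ ν univ * ∫⁻ x, f x ^ 2 ∂ν := by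
  have h := ENNReal.lintegral_mul_le_Lp_mul_Lq ν (p := 2) (q := 2)
    (Real.HolderConjugate.two_two) hf (aemeasurable_const (b := (1 : ℝ≥0∞)))
  simp only [Pi.mul_apply, mul_one, ENNReal.one_rpow, lintegral_const, one_mul] at h
  calc (∫⁻ x, f x ∂ν) ^ 2
      ≤ ((∫⁻ a, f a ^ (2 : ℝ) ∂ν) ^ (1 / 2 : ℝ) * ν univ ^ (1 / 2 : ℝ)) ^ 2 := by gcongr
    _ = ν univ * ∫⁻ x, f x ^ 2 ∂ν := by
      rw [mul_pow, ← ENNReal.rpow_natCast, ← ENNReal.rpow_natCast, ← ENNReal.rpow_mul,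
        ← ENNReal.rpow_mul]
      simp [mul_comm]

/-- An average of the differences `g (x - π h) - g x` is as small in `L²` as these are. -/
theorem eLpNorm_le_of_le_lintegral_translate {G : Type*} [AddCommGroup G] [MeasurableSpace G]
    [MeasurableSub₂ G] {μ : Measure G} [SFinite μ] {ν : Measure (E d)} [SFinite ν] {π : E d → G}
    (hπ : Measurable π) {g : G → ℝ} (hg : Measurable g) {N : G → ℝ}
    (hN : ∀ᵐ x ∂μ, ‖N x‖ₑ ≤ ∫⁻ h, ‖g (x - π h) - g x‖ₑ ∂ν) {η : ℝ≥0∞}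
    (hη : ∀ᵐ h ∂ν, eLpNorm (fun x => g (x - π h) - g x) 2 μ ≤ η) :
    eLpNorm N 2 μ ≤ ν univ * η := by
  have hm : Measurable fun p : G × E d => ‖g (p.1 - π p.2) - g p.1‖ₑ :=
    ((hg.comp (measurable_fst.sub (hπ.comp measurable_snd))).sub (hg.comp measurable_fst)).enorm
  -- Cauchy–Schwarz in `h` yields one factor `ν univ`, and integrating the bound on the translates,
  -- after Tonelli, yields the other.
  have h2 : eLpNorm N 2 μ ^ 2 ≤ (ν univ * η) ^ 2 := by
    calc eLpNorm N 2 μ ^ 2 = ∫⁻ x, ‖N x‖ₑ ^ 2 ∂μ := eLpNorm_two_sq N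
      _ ≤ ∫⁻ x, ν univ * ∫⁻ h, ‖g (x - π h) - g x‖ₑ ^ 2 ∂ν ∂μ := by
        refine lintegral_mono_ae ?_
        filter_upwards [hN] with x hx
        refine le_trans (by gcongr) (sq_lintegral_le ?_)
        exact (hm.comp measurable_prodMk_left).aemeasurable
      _ = ν univ * ∫⁻ x, ∫⁻ h, ‖g (x - π h) - g x‖ₑ ^ 2 ∂ν ∂μ :=
        lintegral_const_mul _ (hm.pow_const 2).lintegral_prod_right'
      _ = ν univ * ∫⁻ h, eLpNorm (fun x => g (x - π h) - g x) 2 μ ^ 2 ∂ν := by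
        rw [lintegral_lintegral_swap (hm.pow_const 2).aemeasurable]
        simp_rw [eLpNorm_two_sq]
      _ ≤ ν univ * ∫⁻ _h, η ^ 2 ∂ν := by
        gcongr 1
        refine lintegral_mono_ae ?_
        filter_upwards [hη] with h hh
        gcongr
      _ = (ν univ * η) ^ 2 := by rw [lintegral_const]; ring
  exact (ENNReal.pow_le_pow_left_iff two_ne_zero).1 h2

/-- The convolution of `g` with the kernel `ρ`. -/
def mollify (ρ g : E d → ℝ) (y : E d) : ℝ := ∫ h, ρ h * g (y - h)

theorem integrable_mul_translate {c : E d → ℝ} (hc : Continuous c) (hcc : HasCompactSupport c)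
    {g : E d → ℝ} (hg : LocallyIntegrable g) (y : E d) :
    Integrable (fun h => c h * g (y - h)) :=
  hcc.convolutionExists_left (ContinuousLinearMap.mul ℝ ℝ) hc hg y

theorem mollify_eq_convolution (ρ g : E d → ℝ) :
    mollify ρ g = convolution ρ g (ContinuousLinearMap.mul ℝ ℝ) volume := rfl

theorem contDiff_mollify {ρ : E d → ℝ} (hρ : ContDiff ℝ ∞ ρ) (hρc : HasCompactSupport ρ)
    {g : E d → ℝ} (hg : LocallyIntegrable g) : ContDiff ℝ ∞ (mollify ρ g) :=
  hρc.contDiff_convolution_left (ContinuousLinearMap.mul ℝ ℝ) hρ hg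

theorem continuous_fderiv_apply {ρ : E d → ℝ} (hρ : ContDiff ℝ ∞ ρ) {b : E d → E d}
    (hb : Continuous b) : Continuous fun h => fderiv ℝ ρ h (b h) :=
  (hρ.continuous_fderiv (by simp)).clm_apply hb

theorem hasCompactSupport_fderiv_apply {ρ : E d → ℝ} (hρc : HasCompactSupport ρ)
    (b : E d → E d) : HasCompactSupport fun h => fderiv ℝ ρ h (b h) := by
  refine (hρc.fderiv ℝ).mono fun h hh => ?_
  rw [Function.mem_support] at hh ⊢
  intro h0
  exact hh (by rw [h0]; simp)

theorem fderiv_mollify {ρ : E d → ℝ} (hρ : ContDiff ℝ ∞ ρ) (hρc : HasCompactSupport ρ)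
    {g : E d → ℝ} (hg : LocallyIntegrable g) (y w : E d) :
    fderiv ℝ (mollify ρ g) y w = ∫ h, fderiv ℝ ρ h w * g (y - h) := by
  have h1 := hρc.hasFDerivAt_convolution_left (ContinuousLinearMap.mul ℝ ℝ)
    (hρ.of_le (by simp)) hg y
  rw [mollify_eq_convolution, h1.fderiv, convolution_def, ContinuousLinearMap.integral_apply]
  · rfl
  · exact (hρc.fderiv ℝ).convolutionExists_left _ (hρ.continuous_fderiv (by simp)) hg y

theorem divFreeField_const (w : E d) : DivFreeField (fun _ : E d => w) :=
  ⟨contDiff_const, ⟨‖w‖, fun _ => le_rfl⟩, ⟨0, LipschitzWith.const w⟩, fun x => by simp⟩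

/-- The commutator of mollification and of the derivative along a divergence-free field. -/
theorem enorm_commutator_le {b : E d → E d} (hb : DivFreeField b) {L : ℝ≥0}
    (hL : LipschitzWith L b) {ρ : E d → ℝ} (hρ : ContDiff ℝ ∞ ρ) (hρc : HasCompactSupport ρ)
    {g : E d → ℝ} (hg : LocallyIntegrable g) (y : E d) :
    ‖fderiv ℝ (mollify ρ g) y (b y) - ∫ h, fderiv ℝ ρ h (b (y - h)) * g (y - h)‖ₑ ≤
      ∫⁻ h, L * ‖h‖ₑ * ‖fderiv ℝ ρ h‖ₑ * ‖g (y - h) - g y‖ₑ := by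
  have hb' := hb.comp_sub y
  have c1 : Continuous fun h => fderiv ℝ ρ h (b y) := continuous_fderiv_apply hρ continuous_const
  have c2 : Continuous fun h => fderiv ℝ ρ h (b (y - h)) :=
    continuous_fderiv_apply hρ hb'.continuous
  have s1 := hasCompactSupport_fderiv_apply hρc (fun _ => b y)
  have s2 := hasCompactSupport_fderiv_apply hρc (fun h => b (y - h))
  have i1 := integrable_mul_translate c1 s1 hg y
  have i2 := integrable_mul_translate c2 s2 hg y
  have i3 := (c1.integrable_of_hasCompactSupport (μ := volume) s1).mul_const (g y)
  have i4 := (c2.integrable_of_hasCompactSupport (μ := volume) s2).mul_const (g y)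
  have z1 : ∫ h, fderiv ℝ ρ h (b y) * g y = 0 := by
    rw [integral_mul_const, (divFreeField_const (b y)).integral_fderiv_eq_zero
      (hρ.of_le (by simp)) hρc, zero_mul]
  have z2 : ∫ h, fderiv ℝ ρ h (b (y - h)) * g y = 0 := by
    rw [integral_mul_const, hb'.integral_fderiv_eq_zero (hρ.of_le (by simp)) hρc, zero_mul]
  -- Both kernels `∇ρ(h) · b(y)` and `∇ρ(h) · b(y - h)` have integral zero, so `g(y)` can be
  -- subtracted in each. What remains carries `b(y) - b(y - h)`, of size `L |h|`, which compensates
  -- the singularity of `∇ρ`.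
  have key : fderiv ℝ (mollify ρ g) y (b y) - ∫ h, fderiv ℝ ρ h (b (y - h)) * g (y - h) =
      ∫ h, fderiv ℝ ρ h (b y - b (y - h)) * (g (y - h) - g y) := by
    rw [fderiv_mollify hρ hρc hg, ← sub_zero (∫ h, fderiv ℝ ρ h (b y) * g (y - h)), ← z1,
      ← sub_zero (∫ h, fderiv ℝ ρ h (b (y - h)) * g (y - h)), ← z2, ← integral_sub i1 i3,
      ← integral_sub i2 i4, ← integral_sub]
    · refine integral_congr_ae (ae_of_all _ fun h => ?_)
      simp only [map_sub]
      ring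
    · exact i1.sub i3
    · exact i2.sub i4
  rw [key]
  refine (enorm_integral_le_lintegral_enorm _).trans (lintegral_mono fun h => ?_)
  rw [enorm_mul]
  gcongr
  calc ‖fderiv ℝ ρ h (b y - b (y - h))‖ₑ ≤ ‖fderiv ℝ ρ h‖ₑ * ‖b y - b (y - h)‖ₑ :=
        ContinuousLinearMap.le_opENorm _ _
    _ ≤ ‖fderiv ℝ ρ h‖ₑ * (L * ‖h‖ₑ) := by
        gcongr
        have := hL.edist_le_mul y (y - h)
        simpa [edist_eq_enorm_sub] using this
    _ = L * ‖h‖ₑ * ‖fderiv ℝ ρ h‖ₑ := mul_comm _ _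

theorem enorm_mollify_sub_le {ρ : E d → ℝ} (hρ : Continuous ρ) (hρc : HasCompactSupport ρ)
    (hρ1 : ∫ h, ρ h = 1) {g : E d → ℝ} (hg : LocallyIntegrable g) (y : E d) :
    ‖mollify ρ g y - g y‖ₑ ≤ ∫⁻ h, ‖ρ h‖ₑ * ‖g (y - h) - g y‖ₑ := by
  have i1 := integrable_mul_translate hρ hρc hg y
  have i3 := (hρ.integrable_of_hasCompactSupport (μ := volume) hρc).mul_const (g y)
  have key : mollify ρ g y - g y = ∫ h, ρ h * (g (y - h) - g y) := by
    have h1 : ∫ h, ρ h * g y = g y := by rw [integral_mul_const, hρ1, one_mul]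
    calc mollify ρ g y - g y = (∫ h, ρ h * g (y - h)) - ∫ h, ρ h * g y := by rw [h1, mollify]
      _ = ∫ h, ρ h * (g (y - h) - g y) := ?_
    rw [← integral_sub i1 i3]
    exact integral_congr_ae (ae_of_all _ fun h => by simp only; ring)
  rw [key]
  refine (enorm_integral_le_lintegral_enorm _).trans (lintegral_mono fun h => ?_)
  rw [enorm_mul]

/-! ### A family of mollifiers -/

/-- A smooth even bump of integral one. -/
def baseMollifier (d : ℕ) : E d → ℝ :=
  (⟨1 / 2, 1, by norm_num, by norm_num⟩ : ContDiffBump (0 : E d)).normed volume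

theorem baseMollifier_contDiff : ContDiff ℝ ∞ (baseMollifier d) := ContDiffBump.contDiff_normed _

theorem baseMollifier_hasCompactSupport : HasCompactSupport (baseMollifier d) :=
  ContDiffBump.hasCompactSupport_normed _

/-- The mollifier at scale `δ`. -/
def mollifier (δ : ℝ) (h : E d) : ℝ := (δ ^ d)⁻¹ * baseMollifier d (δ⁻¹ • h)

theorem mollifier_contDiff (δ : ℝ) : ContDiff ℝ ∞ (mollifier δ : E d → ℝ) :=
  contDiff_const.mul (baseMollifier_contDiff.comp (contDiff_const_smul δ⁻¹))

theorem mollifier_hasCompactSupport {δ : ℝ} (hδ : 0 < δ) :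
    HasCompactSupport (mollifier δ : E d → ℝ) :=
  (baseMollifier_hasCompactSupport.comp_smul (inv_ne_zero hδ.ne')).mul_left

theorem mollifier_neg (δ : ℝ) (h : E d) : mollifier δ (-h) = mollifier δ h := by
  simp only [mollifier, smul_neg, baseMollifier, ContDiffBump.normed_neg]

theorem mollifier_nonneg {δ : ℝ} (hδ : 0 < δ) (h : E d) : 0 ≤ mollifier δ h :=
  mul_nonneg (by positivity) (ContDiffBump.nonneg_normed _ _)

theorem mollifier_eq_zero {δ : ℝ} (hδ : 0 < δ) {h : E d} (hh : δ ≤ ‖h‖) : mollifier δ h = 0 := by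
  have h1 : δ⁻¹ • h ∉ Function.support (baseMollifier d) := by
    rw [baseMollifier, ContDiffBump.support_normed_eq, mem_ball_zero_iff, norm_smul, not_lt,
      norm_inv, Real.norm_eq_abs, abs_of_pos hδ, ← div_eq_inv_mul, le_div_iff₀ hδ]
    simpa using hh
  rw [mollifier, Function.notMem_support.1 h1, mul_zero]

theorem integral_mollifier {δ : ℝ} (hδ : 0 < δ) : ∫ h : E d, mollifier δ h = 1 := by
  simp only [mollifier]
  rw [integral_const_mul, Measure.integral_comp_inv_smul_of_nonneg _ _ hδ.le,
    finrank_euclideanSpace_fin, baseMollifier, ContDiffBump.integral_normed, smul_eq_mul, mul_one]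
  exact inv_mul_cancel₀ (by positivity)

theorem lintegral_enorm_mollifier {δ : ℝ} (hδ : 0 < δ) : ∫⁻ h : E d, ‖mollifier δ h‖ₑ = 1 := by
  rw [← ofReal_integral_norm_eq_lintegral_enorm ((mollifier_contDiff δ).continuous.integrable_of_hasCompactSupport
    (mollifier_hasCompactSupport hδ))]
  simp_rw [Real.norm_of_nonneg (mollifier_nonneg hδ _)]
  rw [integral_mollifier hδ, ENNReal.ofReal_one]

theorem fderiv_mollifier (δ : ℝ) (h : E d) :
    fderiv ℝ (mollifier δ) h = ((δ ^ d)⁻¹ * δ⁻¹) • fderiv ℝ (baseMollifier d) (δ⁻¹ • h) := by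
  have h1 := (((baseMollifier_contDiff.differentiable (by simp)) (δ⁻¹ • h)).hasFDerivAt.comp h
      ((hasFDerivAt_id h).const_smul δ⁻¹)).const_mul ((δ ^ d)⁻¹)
  refine h1.fderiv.trans ?_
  ext w
  simp
  ring

theorem fderiv_mollifier_eq_zero {δ : ℝ} (hδ : 0 < δ) {h : E d} (hh : δ < ‖h‖) :
    fderiv ℝ (mollifier δ) h = 0 := by
  have h1 : (mollifier δ : E d → ℝ) =ᶠ[𝓝 h] fun _ => 0 := by
    filter_upwards [(isOpen_lt continuous_const continuous_norm).mem_nhds hh] with y hy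
    exact mollifier_eq_zero hδ (le_of_lt hy)
  rw [h1.fderiv_eq]
  simp

/-- The scale-invariant size of the gradient of the mollifiers. -/
def mollifierConst (d : ℕ) : ℝ≥0∞ := ∫⁻ h : E d, ‖h‖ₑ * ‖fderiv ℝ (baseMollifier d) h‖ₑ

theorem mollifierConst_ne_top : mollifierConst d ≠ ⊤ := by
  have h1 : Integrable fun h : E d => ‖h‖ * ‖fderiv ℝ (baseMollifier d) h‖ := by
    refine (continuous_norm.mul
      (baseMollifier_contDiff.continuous_fderiv (by simp)).norm).integrable_of_hasCompactSupport ?_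
    exact (baseMollifier_hasCompactSupport.fderiv ℝ).norm.mul_left
  have := h1.2.ne
  simpa [mollifierConst, enorm_mul] using this

/-- Scaling: the gradient contributes `δ^(-d-1)`, the weight `‖h‖` contributes `δ`, and the change
of variables `δ^d`. The mass of the commutator kernel therefore stays bounded as `δ → 0`. -/
theorem lintegral_mollifier_fderiv {δ : ℝ} (hδ : 0 < δ) :
    ∫⁻ h : E d, ‖h‖ₑ * ‖fderiv ℝ (mollifier δ) h‖ₑ = mollifierConst d := by
  have hm : Measurable fun h : E d => ‖h‖ₑ * ‖fderiv ℝ (baseMollifier d) h‖ₑ :=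
    (continuous_enorm.measurable).mul
      (baseMollifier_contDiff.continuous_fderiv (by simp)).enorm.measurable
  have h1 : ∀ h : E d, ‖h‖ₑ * ‖fderiv ℝ (mollifier δ) h‖ₑ = ENNReal.ofReal (δ ^ d)⁻¹ *
      (‖δ⁻¹ • h‖ₑ * ‖fderiv ℝ (baseMollifier d) (δ⁻¹ • h)‖ₑ) := by
    intro h
    rw [fderiv_mollifier, enorm_smul, enorm_smul, Real.enorm_of_nonneg (by positivity),
      Real.enorm_of_nonneg (by positivity), ENNReal.ofReal_mul (by positivity)]
    ring
  simp_rw [h1]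
  have h2 : Measurable fun h : E d => ‖δ⁻¹ • h‖ₑ * ‖fderiv ℝ (baseMollifier d) (δ⁻¹ • h)‖ₑ :=
    hm.comp (measurable_const_smul δ⁻¹)
  rw [lintegral_const_mul _ h2, ← lintegral_map (f := fun h : E d => ‖h‖ₑ * ‖fderiv ℝ (baseMollifier d) h‖ₑ) hm
      (measurable_const_smul δ⁻¹), Measure.map_addHaar_smul _ (inv_ne_zero hδ.ne'),
    lintegral_smul_measure, finrank_euclideanSpace_fin, smul_eq_mul, ← mul_assoc,
    ← ENNReal.ofReal_mul (by positivity), inv_pow, inv_inv, abs_of_pos (by positivity),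
    inv_mul_cancel₀ (by positivity), ENNReal.ofReal_one, one_mul, mollifierConst]

/-! ### Smooth approximation in the graph of a divergence-free field -/

/-- Smallness comes from the continuity of translations, not from the kernels: their masses need
only stay bounded, provided their supports shrink to the origin. This covers both mollification and
the commutator, on `ℝ^d` as well as on the torus. -/
theorem tendsto_eLpNorm_of_le_translate {G : Type*} [AddCommGroup G] [TopologicalSpace G]
    [IsTopologicalAddGroup G] [LocallyCompactSpace G] [MeasurableSpace G] [BorelSpace G]
    [SecondCountableTopology G] (μ : Measure G) [SFinite μ] [μ.IsAddRightInvariant]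
    [IsLocallyFiniteMeasure μ] [μ.InnerRegularCompactLTTop] {π : E d → G} (hπ : Continuous π)
    (h0 : π 0 = 0) {g : G → ℝ} (hg : MemLp g 2 μ) (hgm : Measurable g) {k : ℝ → E d → ℝ≥0∞}
    (hkm : ∀ δ, Measurable (k δ)) {C : ℝ≥0∞} (hC : C ≠ ⊤) (hk : ∀ δ > 0, ∫⁻ h, k δ h ≤ C)
    (hsupp : ∀ δ > 0, ∀ h, δ < ‖h‖ → k δ h = 0) {N : ℝ → G → ℝ}
    (hN : ∀ δ > 0, ∀ x, ‖N δ x‖ₑ ≤ ∫⁻ h, k δ h * ‖g (x - π h) - g x‖ₑ) :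
    Tendsto (fun δ => eLpNorm (N δ) 2 μ) (𝓝[>] 0) (𝓝 0) := by
  rw [ENNReal.tendsto_nhds_zero]
  intro η hη
  have htr := tendsto_eLpNorm_translate μ (p := 2) (by simp) hπ h0 hg
  obtain ⟨η', hη'0, hη'⟩ : ∃ η' : ℝ≥0∞, 0 < η' ∧ C * η' ≤ η := by
    rcases eq_or_ne η ⊤ with rfl | hηt
    · exact ⟨1, one_pos, le_top⟩
    · refine ⟨η / (C + 1), ENNReal.div_pos hη.ne' (by simp [hC]), ?_⟩
      calc C * (η / (C + 1)) ≤ (C + 1) * (η / (C + 1)) := by gcongr; exact le_self_add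
        _ ≤ η := ENNReal.mul_div_le
  obtain ⟨r, hr, hball⟩ := Metric.eventually_nhds_iff.1 (htr.eventually_le_const hη'0)
  filter_upwards [Ioo_mem_nhdsGT hr] with δ hδ
  have hle := eLpNorm_le_of_le_lintegral_translate (μ := μ)
    (ν := (volume : Measure (E d)).withDensity (k δ)) hπ.measurable hgm (N := N δ) (η := η')
    (ae_of_all _ fun x => by
      rw [lintegral_withDensity_eq_lintegral_mul _ (hkm δ)]
      · exact hN δ hδ.1 x
      · exact ((hgm.comp (measurable_const.sub hπ.measurable)).sub measurable_const).enorm)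
    (by
      rw [ae_withDensity_iff (hkm δ)]
      refine ae_of_all _ fun h hh => hball ?_
      rw [dist_zero_right]
      by_contra hcon
      exact hh (hsupp δ hδ.1 h (lt_of_lt_of_le hδ.2 (not_lt.1 hcon))))
  rw [withDensity_apply _ MeasurableSet.univ, setLIntegral_univ] at hle
  calc eLpNorm (N δ) 2 μ ≤ _ := hle
    _ ≤ C * η' := by gcongr; exact hk δ hδ.1
    _ ≤ η := hη'

theorem measurable_enorm_mollifier (δ : ℝ) : Measurable fun h : E d => ‖mollifier δ h‖ₑ :=
  (mollifier_contDiff δ).continuous.enorm.measurable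

theorem measurable_commutatorKernel (L : ℝ≥0) (δ : ℝ) :
    Measurable fun h : E d => L * ‖h‖ₑ * ‖fderiv ℝ (mollifier δ) h‖ₑ :=
  (measurable_const.mul continuous_enorm.measurable).mul
    ((mollifier_contDiff δ).continuous_fderiv (by simp)).enorm.measurable

theorem lintegral_commutatorKernel (L : ℝ≥0) {δ : ℝ} (hδ : 0 < δ) :
    ∫⁻ h : E d, L * ‖h‖ₑ * ‖fderiv ℝ (mollifier δ) h‖ₑ = L * mollifierConst d := by
  simp_rw [mul_assoc]
  rw [lintegral_const_mul' _ _ ENNReal.coe_ne_top, lintegral_mollifier_fderiv hδ]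

theorem tendsto_mollify {g : E d → ℝ} (hg : MemLp g 2 volume) (hgm : Measurable g) :
    Tendsto (fun δ : ℝ => eLpNorm (fun x => mollify (mollifier δ) g x - g x) 2 volume)
      (𝓝[>] 0) (𝓝 0) :=
  tendsto_eLpNorm_of_le_translate volume (π := id) continuous_id rfl hg hgm
    measurable_enorm_mollifier ENNReal.one_ne_top (fun _ hδ => (lintegral_enorm_mollifier hδ).le)
    (fun δ hδ h hh => by rw [mollifier_eq_zero hδ hh.le, enorm_zero])
    (fun δ hδ x => enorm_mollify_sub_le (mollifier_contDiff δ).continuous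
      (mollifier_hasCompactSupport hδ) (integral_mollifier hδ)
      (hg.locallyIntegrable (by simp)) x)

/-- The DiPerna–Lions commutator lemma. The kernel `L ‖h‖ ‖∇ρ_δ(h)‖` has mass independent of `δ` and
acts on the differences `g(x - h) - g(x)`, so the commutator does not merely stay bounded but
vanishes. -/
theorem tendsto_commutator {b : E d → E d} (hb : DivFreeField b) {g : E d → ℝ}
    (hg : MemLp g 2 volume) (hgm : Measurable g) :
    Tendsto (fun δ : ℝ => eLpNorm (fun x => fderiv ℝ (mollify (mollifier δ) g) x (b x) -
      ∫ h, fderiv ℝ (mollifier δ) h (b (x - h)) * g (x - h)) 2 volume) (𝓝[>] 0) (𝓝 0) := by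
  obtain ⟨L, hL⟩ := hb.lipschitz
  exact tendsto_eLpNorm_of_le_translate volume (π := id) continuous_id rfl hg hgm
    (measurable_commutatorKernel L) (ENNReal.mul_ne_top ENNReal.coe_ne_top mollifierConst_ne_top)
    (fun _ hδ => (lintegral_commutatorKernel L hδ).le)
    (fun δ hδ h hh => by
        rw [← ofReal_norm (fderiv ℝ (mollifier δ) h), fderiv_mollifier_eq_zero hδ hh, norm_zero,
          ENNReal.ofReal_zero, mul_zero])
    (fun δ hδ x => enorm_commutator_le hb hL (mollifier_contDiff δ)
      (mollifier_hasCompactSupport hδ) (hg.locallyIntegrable (by simp)) x)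

/-! ### Mollification on the torus and approximation of elements of `K` -/

/-- Mollification on the torus. -/
def torusMollify (ρ : E d → ℝ) (g : T d → ℝ) (v : T d) : ℝ := ∫ h, ρ h * g (v - proj h)

theorem torusMollify_proj (ρ : E d → ℝ) (g : T d → ℝ) (y : E d) :
    torusMollify ρ g (proj y) = mollify ρ (fun y => g (proj y)) y := by
  simp only [torusMollify, mollify, proj_sub]

theorem osc_one : (osc 1 : E d → T d) = proj := by
  ext y; simp [osc]

instance : (volume : Measure (T d)).IsAddHaarMeasure :=
  inferInstanceAs (Measure.pi fun _ : Fin d => (volume : Measure UnitAddCircle)).IsAddHaarMeasure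

instance : (volume : Measure (T d)).IsNegInvariant :=
  Measure.IsAddHaarMeasure.isNegInvariant_of_regular volume

theorem lintegral_closedBall_translate_le (g : T d → ℝ≥0∞) (hg : Measurable g) (R : ℝ) (v : T d) :
    ∫⁻ h in Metric.closedBall (0 : E d) R, g (v - proj h) ≤
      volume (Metric.closedBall (0 : E d) (R + (d + 1))) * ∫⁻ v, g v := by
  have := lintegral_ball_osc_le (d := d) R (ε := 1) (by simp) (fun w => g (v - w))
    (hg.comp (measurable_const.sub measurable_id))
  rw [osc_one] at this
  refine this.trans_eq ?_
  rw [lintegral_sub_left_eq_self]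

theorem locallyIntegrable_comp_proj {g : T d → ℝ} (hg : Integrable g) (hgm : Measurable g) :
    LocallyIntegrable (fun y : E d => g (proj y)) := by
  refine (locallyIntegrable_iff).2 fun k hk => ?_
  obtain ⟨R, hR⟩ := hk.isBounded.subset_closedBall (0 : E d)
  refine IntegrableOn.mono_set ⟨(hgm.comp continuous_proj.measurable).aestronglyMeasurable, ?_⟩ hR
  have h1 := lintegral_ball_osc_le (d := d) R (ε := 1) (by simp) (fun w => ‖g w‖ₑ) hgm.enorm
  rw [osc_one] at h1
  exact h1.trans_lt (ENNReal.mul_lt_top (measure_closedBall_lt_top) hg.2)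

theorem smoothTorus_torusMollify {ρ : E d → ℝ} (hρ : ContDiff ℝ ∞ ρ) (hρc : HasCompactSupport ρ)
    {g : T d → ℝ} (hg : Integrable g) (hgm : Measurable g) : SmoothTorus (torusMollify ρ g) := by
  unfold SmoothTorus
  simp only [torusMollify_proj]
  exact contDiff_mollify hρ hρc (locallyIntegrable_comp_proj hg hgm)

theorem torusDeriv_torusMollify {ρ : E d → ℝ} (hρ : ContDiff ℝ ∞ ρ) (hρc : HasCompactSupport ρ)
    {g : T d → ℝ} (hg : Integrable g) (hgm : Measurable g) (v : T d) (w : E d) :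
    torusDeriv (torusMollify ρ g) v w = ∫ h, fderiv ℝ ρ h w * g (v - proj h) := by
  obtain ⟨y, rfl⟩ := proj_surjective v
  rw [torusDeriv_proj]
  simp only [torusMollify_proj]
  rw [fderiv_mollify hρ hρc (locallyIntegrable_comp_proj hg hgm)]
  simp only [proj_sub]

theorem fderiv_mollifier_neg (δ : ℝ) (h : E d) :
    fderiv ℝ (mollifier δ) (-h) = -fderiv ℝ (mollifier δ) h := by
  have h1 := ((((mollifier_contDiff δ).differentiable (by simp)) (-h)).hasFDerivAt.comp h
      (hasFDerivAt_id h).fun_neg).fderiv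
  have h2 : (mollifier δ ∘ Neg.neg : E d → ℝ) = mollifier δ := by
    ext y; exact mollifier_neg δ y
  rw [h2] at h1
  rw [h1]
  ext w
  simp

/-- The mollified transport derivative of `g` vanishes when `g` is in the kernel. -/
theorem torus_mollified_transport_eq_zero {a : T d → E d}
    (ha : ContDiff ℝ 1 (fun y : E d => a (proj y))) {g : T d → ℝ} (hg : MemLp g 2 volume)
    (hgm : Measurable g)
    (hK : ∀ ψ : T d → ℝ, SmoothTorus ψ → ∫ v, g v * torusDeriv ψ v (a v) = 0) {δ : ℝ} (hδ : 0 < δ) :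
    ∀ᵐ v, ∫ h, fderiv ℝ (mollifier δ) h (a (v - proj h)) * g (v - proj h) = 0 := by
  have hac : Continuous a := continuous_of_lift ha.continuous
  obtain ⟨A, hA0, hA⟩ := exists_bound_of_continuous hac
  have hgi : Integrable g := hg.integrable (by simp)
  set D : E d → (E d →L[ℝ] ℝ) := fderiv ℝ (mollifier δ) with hD
  have hDc : Continuous D := (mollifier_contDiff δ).continuous_fderiv (by simp)
  have hDs : HasCompactSupport D := (mollifier_hasCompactSupport hδ).fderiv ℝ
  have hDi : Integrable fun h => ‖D h‖ := (hDc.norm.integrable_of_hasCompactSupport hDs.norm)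
  obtain ⟨B, hB⟩ := hDs.exists_bound_of_continuous hDc
  have hB0 : 0 ≤ B := (norm_nonneg _).trans (hB 0)
  have hm : Measurable fun p : T d × E d =>
      D p.2 (a (p.1 - proj p.2)) * g (p.1 - proj p.2) := by
    have hc : Continuous fun p : T d × E d => p.1 - proj p.2 :=
      continuous_fst.sub (continuous_proj.comp continuous_snd)
    exact ((hDc.comp continuous_snd).clm_apply (hac.comp hc)).measurable.mul
      (hgm.comp hc.measurable)
  have hbound : ∀ (h : E d) (v : T d), ‖D h (a v) * g v‖ ≤ A * ‖D h‖ * ‖g v‖ := by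
    intro h v
    rw [norm_mul]
    gcongr
    exact ((D h).le_opNorm _).trans (by rw [mul_comm]; gcongr; exact hA v)
  set J : T d → ℝ := fun v => ∫ h, D h (a (v - proj h)) * g (v - proj h) with hJ
  have hJm : AEStronglyMeasurable J volume :=
    hm.stronglyMeasurable.integral_prod_right.aestronglyMeasurable
  -- `J` is even bounded: the kernel is bounded and vanishes outside the ball of radius `δ`, over
  -- which the integral of `|g(v - proj h)|` is controlled by the `L¹` norm of `g`.
  have hJ2 : MemLp J 2 volume := by
    refine MemLp.of_enorm_bound hJm
      (C := ENNReal.ofReal (A * B) * (volume (Metric.closedBall (0 : E d) (δ + (d + 1))) *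
        ∫⁻ v, ‖g v‖ₑ)) (ENNReal.mul_ne_top (by simp)
        (ENNReal.mul_ne_top measure_closedBall_lt_top.ne hgi.2.ne)) (ae_of_all _ fun v => ?_)
    calc ‖J v‖ₑ ≤ ∫⁻ h, ‖D h (a (v - proj h)) * g (v - proj h)‖ₑ :=
          enorm_integral_le_lintegral_enorm _
      _ ≤ ∫⁻ h, (Metric.closedBall (0 : E d) δ).indicator
            (fun h => ENNReal.ofReal (A * B) * ‖g (v - proj h)‖ₑ) h := by
          refine lintegral_mono fun h => ?_
          by_cases hh : h ∈ Metric.closedBall (0 : E d) δ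
          · rw [indicator_of_mem hh, enorm_mul]
            gcongr
            rw [← ofReal_norm]
            refine ENNReal.ofReal_le_ofReal (((D h).le_opNorm _).trans ?_)
            rw [mul_comm]
            exact mul_le_mul (hA _) (hB h) (norm_nonneg _) hA0
          · have : D h = 0 := fderiv_mollifier_eq_zero hδ (by simpa using hh)
            simp [this]
      _ = ENNReal.ofReal (A * B) * ∫⁻ h in Metric.closedBall (0 : E d) δ, ‖g (v - proj h)‖ₑ := by
          rw [lintegral_indicator measurableSet_closedBall, lintegral_const_mul' _ _ (by simp)]
      _ ≤ _ := by
          gcongr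
          exact lintegral_closedBall_translate_le (fun v => ‖g v‖ₑ) hgm.enorm δ v
  refine ae_eq_zero_of_integral_smooth hJ2 fun ψ hψ => ?_
  obtain ⟨Q, hQ0, hQ⟩ := exists_bound_of_continuous hψ.continuous
  have hψm := hψ.continuous.measurable
  have hprod1 : Integrable (fun p : T d × E d =>
      D p.2 (a (p.1 - proj p.2)) * g (p.1 - proj p.2) * ψ p.1) (volume.prod volume) := by
    have hmm : AEStronglyMeasurable (fun p : T d × E d =>
        D p.2 (a (p.1 - proj p.2)) * g (p.1 - proj p.2) * ψ p.1) (volume.prod volume) :=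
      (hm.mul (hψm.comp measurable_fst)).aestronglyMeasurable
    rw [integrable_prod_iff' hmm]
    have hi : ∀ h : E d, Integrable (fun v => A * ‖D h‖ * ‖g (v - proj h)‖ * Q) := fun h =>
      (((hgi.comp_sub_right (proj h)).norm).const_mul _).mul_const _
    have hle : ∀ (h : E d) (v : T d), ‖D h (a (v - proj h)) * g (v - proj h) * ψ v‖ ≤
        A * ‖D h‖ * ‖g (v - proj h)‖ * Q := fun h v => by
      rw [norm_mul]
      exact mul_le_mul (hbound h _) (hQ v) (norm_nonneg _) (by positivity)
    refine ⟨ae_of_all _ fun h => (hi h).mono'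
      ((hm.mul (hψm.comp measurable_fst)).comp measurable_prodMk_right).aestronglyMeasurable
      (ae_of_all _ (hle h)), ?_⟩
    refine (((hDi.const_mul A).mul_const (∫ v, ‖g v‖)).mul_const Q).mono'
      hmm.prod_swap.norm.integral_prod_right' (ae_of_all _ fun h => ?_)
    rw [Real.norm_of_nonneg (integral_nonneg fun _ => norm_nonneg _)]
    calc _ ≤ ∫ v, A * ‖D h‖ * ‖g (v - proj h)‖ * Q := by
          refine integral_mono_of_nonneg (ae_of_all _ fun _ => norm_nonneg _) (hi h)
            (ae_of_all _ (hle h))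
      _ = A * ‖D h‖ * (∫ v, ‖g v‖) * Q := by
          rw [integral_mul_const, integral_const_mul,
            integral_sub_right_eq_self (fun v => ‖g v‖)]
  have hprod2 : Integrable (fun p : T d × E d => D p.2 (a p.1) * g p.1 * ψ (p.1 + proj p.2))
      (volume.prod volume) := by
    have h1 : Integrable (fun p : T d × E d => ‖g p.1‖ * (A * ‖D p.2‖ * Q))
      (volume.prod volume) := hgi.norm.mul_prod ((hDi.const_mul A).mul_const Q)
    refine h1.mono' ?_ (ae_of_all _ fun p => ?_)
    · have hc : Continuous fun p : T d × E d => p.1 + proj p.2 :=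
        continuous_fst.add (continuous_proj.comp continuous_snd)
      exact (((((hDc.comp continuous_snd).clm_apply (hac.comp continuous_fst)).measurable).mul
        (hgm.comp measurable_fst)).mul (hψm.comp hc.measurable)).aestronglyMeasurable
    · rw [norm_mul]
      refine (mul_le_mul (hbound p.2 p.1) (hQ _) (norm_nonneg _) (by positivity)).trans_eq ?_
      ring
  have hψi : Integrable ψ := (memLp_of_continuous hψ.continuous 1).integrable le_rfl
  -- Fubini and the translation `v ↦ v + proj h` move the mollification from `g` onto `ψ`. The
  -- mollifier is even, so its gradient is odd, and the reflection `h ↦ -h` exhibits minus the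
  -- derivative along `a` of the mollified `ψ`, a smooth function against which `g ∈ K` gives zero.
  calc ∫ v, J v * ψ v = ∫ v, ∫ h, D h (a (v - proj h)) * g (v - proj h) * ψ v := by
        simp_rw [hJ, ← integral_mul_const]
    _ = ∫ h, ∫ v, D h (a (v - proj h)) * g (v - proj h) * ψ v := integral_integral_swap hprod1
    _ = ∫ h, ∫ v, D h (a v) * g v * ψ (v + proj h) := by
        refine integral_congr_ae (ae_of_all _ fun h => ?_)
        have := integral_sub_right_eq_self (μ := (volume : Measure (T d)))
          (fun v => D h (a v) * g v * ψ (v + proj h)) (proj h)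
        simpa using this
    _ = ∫ v, ∫ h, D h (a v) * g v * ψ (v + proj h) := (integral_integral_swap hprod2).symm
    _ = ∫ v, -(g v * torusDeriv (torusMollify (mollifier δ) ψ) v (a v)) := by
        refine integral_congr_ae (ae_of_all _ fun v => ?_)
        simp only
        rw [torusDeriv_torusMollify (mollifier_contDiff δ) (mollifier_hasCompactSupport hδ) hψi hψm,
          ← integral_neg_eq_self, ← integral_const_mul, ← integral_neg]
        refine integral_congr_ae (ae_of_all _ fun h => ?_)
        simp only [hD, proj_neg, fderiv_mollifier_neg, sub_eq_add_neg]
        simp only [neg_apply]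
        ring
    _ = 0 := by
        rw [integral_neg, hK _ (smoothTorus_torusMollify (mollifier_contDiff δ)
          (mollifier_hasCompactSupport hδ) hψi hψm), neg_zero]

/-- Elements of the kernel are limits of smooth functions with vanishing transport derivative. -/
theorem exists_smooth_approx_kernel {a : T d → E d}
    (ha : ContDiff ℝ 1 (fun y : E d => a (proj y))) (hdiv : ∀ v, torusDiv a v = 0)
    {g : T d → ℝ} (hg : MemLp g 2 volume) (hgm : Measurable g)
    (hK : ∀ ψ : T d → ℝ, SmoothTorus ψ → ∫ v, g v * torusDeriv ψ v (a v) = 0) :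
    ∃ ψ : ℕ → T d → ℝ, (∀ n, SmoothTorus (ψ n)) ∧
      Tendsto (fun n => eLpNorm (fun v => ψ n v - g v) 2 volume) atTop (𝓝 0) ∧
      Tendsto (fun n => eLpNorm (fun v => torusDeriv (ψ n) v (a v)) 2 volume) atTop (𝓝 0) := by
  have hgi : Integrable g := hg.integrable (by simp)
  have hloc := locallyIntegrable_comp_proj hgi hgm
  have hb : DivFreeField (fun y : E d => a (proj y)) := by
    simpa only [osc_one] using divFreeField_osc ha hdiv 1
  obtain ⟨L, hL⟩ := hb.lipschitz
  have t1 : Tendsto (fun δ : ℝ => eLpNorm (fun v => torusMollify (mollifier δ) g v - g v) 2 volume)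
      (𝓝[>] 0) (𝓝 0) :=
    tendsto_eLpNorm_of_le_translate volume continuous_proj proj_zero hg hgm
      measurable_enorm_mollifier ENNReal.one_ne_top (fun _ hδ => (lintegral_enorm_mollifier hδ).le)
      (fun δ hδ h hh => by rw [mollifier_eq_zero hδ hh.le, enorm_zero])
      (fun δ hδ v => by
        obtain ⟨y, rfl⟩ := proj_surjective v
        rw [torusMollify_proj]
        simp only [← proj_sub]
        exact enorm_mollify_sub_le (mollifier_contDiff δ).continuous
          (mollifier_hasCompactSupport hδ) (integral_mollifier hδ) hloc y)
  have t2 : Tendsto (fun δ : ℝ => eLpNorm (fun v =>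
      torusDeriv (torusMollify (mollifier δ) g) v (a v) -
        ∫ h, fderiv ℝ (mollifier δ) h (a (v - proj h)) * g (v - proj h)) 2 volume)
      (𝓝[>] 0) (𝓝 0) :=
    tendsto_eLpNorm_of_le_translate volume continuous_proj proj_zero hg hgm
      (measurable_commutatorKernel L)
      (ENNReal.mul_ne_top ENNReal.coe_ne_top mollifierConst_ne_top)
      (fun _ hδ => (lintegral_commutatorKernel L hδ).le)
      (fun δ hδ h hh => by
        rw [← ofReal_norm (fderiv ℝ (mollifier δ) h), fderiv_mollifier_eq_zero hδ hh, norm_zero,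
          ENNReal.ofReal_zero, mul_zero])
      (fun δ hδ v => by
        obtain ⟨y, rfl⟩ := proj_surjective v
        rw [torusDeriv_proj]
        simp only [torusMollify_proj, ← proj_sub]
        exact enorm_commutator_le hb hL (mollifier_contDiff δ) (mollifier_hasCompactSupport hδ)
          hloc y)
  have hseq : Tendsto (fun n : ℕ => (1 : ℝ) / (n + 1)) atTop (𝓝[>] 0) :=
    tendsto_nhdsWithin_iff.2 ⟨tendsto_one_div_add_atTop_nhds_zero_nat,
      Eventually.of_forall fun n => by simp only [mem_Ioi]; positivity⟩
  have hpos : ∀ n : ℕ, (0 : ℝ) < 1 / (n + 1) := fun n => by positivity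
  refine ⟨fun n => torusMollify (mollifier (1 / (n + 1))) g, fun n =>
    smoothTorus_torusMollify (mollifier_contDiff _) (mollifier_hasCompactSupport (hpos n)) hgi hgm,
    t1.comp hseq, (t2.comp hseq).congr fun n => eLpNorm_congr_ae ?_⟩
  -- The term subtracted in the commutator vanishes because `g ∈ K`, so the commutator is the
  -- derivative of the mollified function itself.
  filter_upwards [torus_mollified_transport_eq_zero ha hg hgm hK (hpos n)] with v hv
  rw [hv, sub_zero]

/-! ### Limits in `L²` -/

theorem lintegral_enorm_mul_le {α : Type*} [MeasurableSpace α] {μ : Measure α} {u f : α → ℝ}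
    (hu : AEStronglyMeasurable u μ) (hf : AEStronglyMeasurable f μ) :
    ∫⁻ x, ‖u x * f x‖ₑ ∂μ ≤ eLpNorm u 2 μ * eLpNorm f 2 μ := by
  have h := eLpNorm_smul_le_mul_eLpNorm (p := 2) (q := 2) (r := 1) hf hu
  rw [eLpNorm_one_eq_lintegral_enorm] at h
  exact h

theorem enorm_integral_mul_le {α : Type*} [MeasurableSpace α] {μ : Measure α} {u f : α → ℝ}
    (hu : AEStronglyMeasurable u μ) (hf : AEStronglyMeasurable f μ) :
    ‖∫ x, u x * f x ∂μ‖ₑ ≤ eLpNorm u 2 μ * eLpNorm f 2 μ :=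
  (enorm_integral_le_lintegral_enorm _).trans (lintegral_enorm_mul_le hu hf)

theorem tendsto_of_enorm_sub_tendsto {ι : Type*} {l : Filter ι} {x : ι → ℝ} {y : ℝ}
    (h : Tendsto (fun i => ‖x i - y‖ₑ) l (𝓝 0)) : Tendsto x l (𝓝 y) := by
  rw [tendsto_iff_edist_tendsto_0]
  simpa only [edist_eq_enorm_sub] using h

theorem tendsto_zero_of_le_const_mul {ι : Type*} {l : Filter ι} {x y : ι → ℝ≥0∞} {C : ℝ≥0∞}
    (hC : C ≠ ⊤) (hx : Tendsto x l (𝓝 0)) (h : ∀ᶠ i in l, y i ≤ C * x i) : Tendsto y l (𝓝 0) := by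
  have := ENNReal.Tendsto.const_mul hx (Or.inr hC)
  rw [mul_zero] at this
  exact tendsto_of_tendsto_of_tendsto_of_le_of_le' tendsto_const_nhds this
    (Eventually.of_forall fun _ => zero_le) h

theorem tendsto_integral_mul {α ι : Type*} [MeasurableSpace α] {μ : Measure α} {l : Filter ι}
    {u f : α → ℝ} {F : ι → α → ℝ} (hu : MemLp u 2 μ) (hf : MemLp f 2 μ)
    (hF : ∀ᶠ i in l, AEStronglyMeasurable (F i) μ)
    (h : Tendsto (fun i => eLpNorm (fun x => F i x - f x) 2 μ) l (𝓝 0)) :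
    Tendsto (fun i => ∫ x, u x * F i x ∂μ) l (𝓝 (∫ x, u x * f x ∂μ)) := by
  refine tendsto_of_enorm_sub_tendsto ?_
  refine tendsto_zero_of_le_const_mul hu.2.ne h ?_
  have hlt : ∀ᶠ i in l, eLpNorm (fun x => F i x - f x) 2 μ < ⊤ :=
    h.eventually_lt_const ENNReal.zero_lt_top
  filter_upwards [hF, hlt] with i hi hi'
  have hFi : MemLp (F i) 2 μ := by
    have : MemLp (fun x => (F i x - f x) + f x) 2 μ := MemLp.add ⟨hi.sub hf.1, hi'⟩ hf
    simpa using this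
  have h1 : Integrable (fun x => u x * F i x) μ := hu.integrable_mul hFi
  have h2 : Integrable (fun x => u x * f x) μ := hu.integrable_mul hf
  rw [← integral_sub h1 h2]
  simp_rw [← mul_sub]
  exact enorm_integral_mul_le hu.1 (hi.sub hf.1)

theorem tendsto_eLpNorm_of_dominated {α ι : Type*} [MeasurableSpace α] {μ : Measure α}
    {l : Filter ι} [l.IsCountablyGenerated] {F : ι → α → ℝ} {G : α → ℝ} (hG : MemLp G 2 μ)
    (hF : ∀ᶠ i in l, AEStronglyMeasurable (F i) μ) (hle : ∀ᶠ i in l, ∀ᵐ x ∂μ, ‖F i x‖ ≤ ‖G x‖)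
    (hlim : ∀ᵐ x ∂μ, Tendsto (fun i => F i x) l (𝓝 0)) :
    Tendsto (fun i => eLpNorm (F i) 2 μ) l (𝓝 0) := by
  have h : Tendsto (fun i => ∫⁻ x, ‖F i x‖ₑ ^ 2 ∂μ) l (𝓝 (∫⁻ _x, 0 ∂μ)) := by
    refine tendsto_lintegral_filter_of_dominated_convergence' (fun x => ‖G x‖ₑ ^ 2)
      (hF.mono fun i hi => hi.enorm.pow_const 2) ?_ ?_ ?_
    · filter_upwards [hle] with i hi
      filter_upwards [hi] with x hx
      gcongr
      exact enorm_le_iff_norm_le.2 hx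
    · rw [← eLpNorm_two_sq]
      exact ENNReal.pow_ne_top hG.2.ne
    · filter_upwards [hlim] with x hx
      have h1 : Tendsto (fun i => ‖F i x‖ₑ) l (𝓝 0) := by
        have := (continuous_enorm.tendsto (0 : ℝ)).comp hx
        rwa [enorm_zero] at this
      simpa using! ((ENNReal.continuous_pow 2).tendsto 0).comp h1
  simp only [← eLpNorm_two_sq, lintegral_zero] at h
  have h2 := (ENNReal.continuous_rpow_const (y := (1 / 2 : ℝ))).tendsto 0 |>.comp h
  rw [ENNReal.zero_rpow_of_pos (by norm_num)] at h2
  refine h2.congr fun i => ?_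
  rw [Function.comp_apply, ← ENNReal.rpow_natCast, ← ENNReal.rpow_mul]
  simp

/-! ### Skew-symmetry of the transport operator -/

/-- A cutoff function equal to one on the unit ball. -/
def cutoff (d : ℕ) : ContDiffBump (0 : E d) := ⟨1, 2, by norm_num, by norm_num⟩

/-- Testing `b · ∇u = w` with `y ↦ ρ(x - y)` identifies the second term of the commutator as the
mollification of `w`. -/
theorem mollified_transport_eq {b : E d → E d} {u w : E d → ℝ}
    (h : ∀ φ : E d → ℝ, ContDiff ℝ ∞ φ → HasCompactSupport φ →
      ∫ x, u x * fderiv ℝ φ x (b x) = -∫ x, w x * φ x)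
    {ρ : E d → ℝ} (hρ : ContDiff ℝ ∞ ρ) (hρc : HasCompactSupport ρ) (x : E d) :
    ∫ h, fderiv ℝ ρ h (b (x - h)) * u (x - h) = mollify ρ w x := by
  have hfd : ∀ y v, fderiv ℝ (fun y => ρ (x - y)) y v = -fderiv ℝ ρ (x - y) v := by
    intro y v
    have := ((hρ.differentiable (by simp) (x - y)).hasFDerivAt.comp y
      ((hasFDerivAt_id y).const_sub x)).fderiv
    simp only [Function.comp_def] at this
    refine (DFunLike.congr_fun this v).trans ?_
    simp
  have h1 := h (fun y => ρ (x - y)) (hρ.comp (contDiff_const.sub contDiff_id))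
    (hρc.comp_homeomorph (Homeomorph.subLeft x))
  simp only [hfd, mul_neg, integral_neg, neg_inj] at h1
  rw [mollify, ← integral_sub_left_eq_self _ volume x,
    ← integral_sub_left_eq_self (fun h => ρ h * w (x - h)) volume x]
  simpa [mul_comm] using h1

/-- The hypothesis says that `b · ∇u = w` weakly. With `φ_δ` a mollified and truncated `u`, one has
`φ_δ → u` and `b · ∇φ_δ → w` in `L²`. Hence `∫ u (b · ∇φ_δ) = -∫ w φ_δ` passes to the limit as `∫ u
w = -∫ w u`. -/
theorem transport_skew_of_measurable {b : E d → E d} (hb : DivFreeField b) {u w : E d → ℝ}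
    (hu : MemLp u 2 volume) (hum : Measurable u) (hw : MemLp w 2 volume) (hwm : Measurable w)
    (h : ∀ φ : E d → ℝ, ContDiff ℝ ∞ φ → HasCompactSupport φ →
      ∫ x, u x * fderiv ℝ φ x (b x) = -∫ x, w x * φ x) :
    ∫ x, u x * w x = 0 := by
  obtain ⟨M, hM⟩ := hb.bounded
  have hM0 : 0 ≤ M := (norm_nonneg _).trans (hM 0)
  set χ : E d → ℝ := fun x => cutoff d x with hχdef
  have hχs : ContDiff ℝ ∞ χ := (cutoff d).contDiff
  have hχc : HasCompactSupport χ := (cutoff d).hasCompactSupport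
  have hχ1 : ∀ x, ‖χ x‖ ≤ 1 := fun x => by
    rw [Real.norm_of_nonneg (cutoff d).nonneg]; exact (cutoff d).le_one
  obtain ⟨B, hB⟩ := (hχc.fderiv ℝ).exists_bound_of_continuous (hχs.continuous_fderiv (by simp))
  have hB0 : 0 ≤ B := (norm_nonneg _).trans (hB 0)
  set Mu : ℝ → E d → ℝ := fun δ => mollify (mollifier δ) u with hMu
  set Mw : ℝ → E d → ℝ := fun δ => mollify (mollifier δ) w with hMw
  have hMus : ∀ δ > 0, ContDiff ℝ ∞ (Mu δ) := fun δ hδ =>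
    contDiff_mollify (mollifier_contDiff δ) (mollifier_hasCompactSupport hδ)
      (hu.locallyIntegrable (by simp))
  have hMws : ∀ δ > 0, ContDiff ℝ ∞ (Mw δ) := fun δ hδ =>
    contDiff_mollify (mollifier_contDiff δ) (mollifier_hasCompactSupport hδ)
      (hw.locallyIntegrable (by simp))
  have tu : Tendsto (fun δ => eLpNorm (fun x => Mu δ x - u x) 2 volume) (𝓝[>] 0) (𝓝 0) :=
    tendsto_mollify hu hum
  have tw : Tendsto (fun δ => eLpNorm (fun x => Mw δ x - w x) 2 volume) (𝓝[>] 0) (𝓝 0) :=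
    tendsto_mollify hw hwm
  have tc : Tendsto (fun δ => eLpNorm (fun x => fderiv ℝ (Mu δ) x (b x) - Mw δ x) 2 volume)
      (𝓝[>] 0) (𝓝 0) := by
    refine (tendsto_commutator hb hu hum).congr' ?_
    filter_upwards [self_mem_nhdsWithin] with δ hδ
    refine eLpNorm_congr_ae (ae_of_all _ fun x => ?_)
    simp only [hMu, hMw]
    rw [mollified_transport_eq h (mollifier_contDiff δ) (mollifier_hasCompactSupport hδ)]
  have hχδ : ∀ δ : ℝ, ContDiff ℝ ∞ fun x : E d => χ (δ • x) := fun δ =>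
    hχs.comp (contDiff_const_smul δ)
  have hlim : ∀ x : E d, Tendsto (fun δ : ℝ => χ (δ • x) - 1) (𝓝[>] 0) (𝓝 0) := by
    intro x
    have h1 : Tendsto (fun δ : ℝ => χ (δ • x) - 1) (𝓝 0) (𝓝 (χ ((0 : ℝ) • x) - 1)) :=
      (((hχs.continuous.comp (continuous_id.smul continuous_const)).sub
        continuous_const).tendsto (0 : ℝ))
    have h2 : χ ((0 : ℝ) • x) - 1 = 0 := by
      rw [zero_smul, sub_eq_zero]
      exact (cutoff d).one_of_mem_closedBall (by simp [cutoff])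
    rw [h2] at h1
    exact h1.mono_left nhdsWithin_le_nhds
  have tcut : ∀ g : E d → ℝ, MemLp g 2 volume →
      Tendsto (fun δ : ℝ => eLpNorm (fun x => (χ (δ • x) - 1) * g x) 2 volume) (𝓝[>] 0) (𝓝 0) := by
    intro g hg
    refine tendsto_eLpNorm_of_dominated (hg.const_mul 2) (Eventually.of_forall fun δ =>
      (((hχδ δ).continuous.sub continuous_const).aestronglyMeasurable).mul hg.1)
      (Eventually.of_forall fun δ => ae_of_all _ fun x => ?_) (ae_of_all _ fun x => ?_)
    · rw [norm_mul, norm_mul]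
      gcongr
      calc ‖χ (δ • x) - 1‖ ≤ ‖χ (δ • x)‖ + ‖(1 : ℝ)‖ := norm_sub_le _ _
        _ ≤ ‖(2 : ℝ)‖ := by rw [norm_one, Real.norm_two]; linarith [hχ1 (δ • x)]
    · simpa using (hlim x).mul_const (g x)
  -- A single parameter serves twice: `δ` is the mollification scale and `1/δ` the truncation
  -- radius.
  set φ : ℝ → E d → ℝ := fun δ x => χ (δ • x) * Mu δ x with hφ
  have hφs : ∀ δ > 0, ContDiff ℝ ∞ (φ δ) := fun δ hδ => (hχδ δ).mul (hMus δ hδ)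
  have hφc : ∀ δ > 0, HasCompactSupport (φ δ) := fun δ hδ =>
    (hχc.comp_smul (ne_of_gt hδ)).mul_right
  have hfd : ∀ δ > 0, ∀ x v, fderiv ℝ (φ δ) x v =
      χ (δ • x) * fderiv ℝ (Mu δ) x v + Mu δ x * (δ * fderiv ℝ χ (δ • x) v) := by
    intro δ hδ x v
    have h1 : HasFDerivAt (fun x : E d => χ (δ • x))
        ((fderiv ℝ χ (δ • x)).comp (δ • ContinuousLinearMap.id ℝ (E d))) x :=
      (hχs.differentiable (by simp) (δ • x)).hasFDerivAt.comp x
        ((hasFDerivAt_id x).const_smul δ)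
    have h2 := h1.mul ((hMus δ hδ).differentiable (by simp) x).hasFDerivAt
    refine (DFunLike.congr_fun h2.fderiv v).trans ?_
    simp
  have t1 : Tendsto (fun δ => eLpNorm (fun x => φ δ x - u x) 2 volume) (𝓝[>] 0) (𝓝 0) := by
    have hsum := tu.add (tcut u hu)
    rw [add_zero] at hsum
    refine tendsto_of_tendsto_of_tendsto_of_le_of_le' tendsto_const_nhds hsum
      (Eventually.of_forall fun _ => zero_le) ?_
    filter_upwards [self_mem_nhdsWithin] with δ hδ
    have e1 : (fun x => φ δ x - u x) =
        (fun x => χ (δ • x) * (Mu δ x - u x)) + fun x => (χ (δ • x) - 1) * u x := by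
      ext x; simp only [hφ, Pi.add_apply]; ring
    rw [e1]
    have m1 : AEStronglyMeasurable (fun x => Mu δ x - u x) volume :=
      (hMus δ hδ).continuous.aestronglyMeasurable.sub hu.1
    refine (eLpNorm_add_le (f := fun x => χ (δ • x) * (Mu δ x - u x))
      (g := fun x => (χ (δ • x) - 1) * u x)
      ((hχδ δ).continuous.aestronglyMeasurable.mul m1)
      ((((hχδ δ).continuous.sub continuous_const).aestronglyMeasurable).mul hu.1)
      (by simp)).trans (add_le_add ?_ le_rfl)
    refine eLpNorm_mono fun x => ?_
    rw [norm_mul]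
    exact mul_le_of_le_one_left (norm_nonneg _) (hχ1 _)
  have t2 : Tendsto (fun δ => eLpNorm (fun x => fderiv ℝ (φ δ) x (b x) - w x) 2 volume)
      (𝓝[>] 0) (𝓝 0) := by
    have tδ : Tendsto (fun δ : ℝ => ENNReal.ofReal (δ * (B * M)) *
        (eLpNorm (fun x => Mu δ x - u x) 2 volume + eLpNorm u 2 volume)) (𝓝[>] 0) (𝓝 0) := by
      have h1 : Tendsto (fun δ : ℝ => ENNReal.ofReal (δ * (B * M))) (𝓝[>] 0) (𝓝 0) := by
        have : Tendsto (fun δ : ℝ => ENNReal.ofReal (δ * (B * M))) (𝓝 0)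
            (𝓝 (ENNReal.ofReal (0 * (B * M)))) :=
          (ENNReal.continuous_ofReal.comp (continuous_id.mul continuous_const)).tendsto 0
        rw [zero_mul, ENNReal.ofReal_zero] at this
        exact this.mono_left nhdsWithin_le_nhds
      have h2 := tu.add_const (eLpNorm u 2 volume)
      rw [zero_add] at h2
      have := ENNReal.Tendsto.mul h1 (Or.inr hu.2.ne) h2 (Or.inr ENNReal.zero_ne_top)
      rwa [zero_mul] at this
    have hsum := ((tc.add tw).add (tcut w hw)).add tδ
    simp only [add_zero] at hsum
    refine tendsto_of_tendsto_of_tendsto_of_le_of_le' tendsto_const_nhds hsum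
      (Eventually.of_forall fun _ => zero_le) ?_
    filter_upwards [self_mem_nhdsWithin] with δ hδ
    have hδ' : (0 : ℝ) < δ := hδ
    -- The four errors: the commutator, the mollification of `w`, the truncation of `w`, and the
    -- gradient of the cutoff, which carries a factor `δ` because the cutoff is dilated by `1/δ`.
    set f1 : E d → ℝ := fun x => χ (δ • x) * (fderiv ℝ (Mu δ) x (b x) - Mw δ x)
    set f2 : E d → ℝ := fun x => χ (δ • x) * (Mw δ x - w x)
    set f3 : E d → ℝ := fun x => (χ (δ • x) - 1) * w x
    set f4 : E d → ℝ := fun x => Mu δ x * (δ * fderiv ℝ χ (δ • x) (b x))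
    have e1 : (fun x => fderiv ℝ (φ δ) x (b x) - w x) = f1 + f2 + f3 + f4 := by
      ext x; simp only [hfd δ hδ, Pi.add_apply, f1, f2, f3, f4]; ring
    have cχ := (hχδ δ).continuous
    have m1 : AEStronglyMeasurable f1 volume :=
      (cχ.mul (((((hMus δ hδ).continuous_fderiv (by simp)).clm_apply hb.continuous)).sub
        (hMws δ hδ).continuous)).aestronglyMeasurable
    have m2 : AEStronglyMeasurable f2 volume :=
      cχ.aestronglyMeasurable.mul ((hMws δ hδ).continuous.aestronglyMeasurable.sub hw.1)
    have m3 : AEStronglyMeasurable f3 volume :=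
      ((cχ.sub continuous_const).aestronglyMeasurable).mul hw.1
    have m4 : AEStronglyMeasurable f4 volume :=
      ((hMus δ hδ).continuous.mul (continuous_const.mul
        (((hχs.continuous_fderiv (by simp)).comp (continuous_const_smul δ)).clm_apply
          hb.continuous))).aestronglyMeasurable
    rw [e1]
    refine (eLpNorm_add_le ((m1.add m2).add m3) m4 (by simp)).trans (add_le_add
      ((eLpNorm_add_le (m1.add m2) m3 (by simp)).trans (add_le_add
      ((eLpNorm_add_le m1 m2 (by simp)).trans (add_le_add ?_ ?_)) le_rfl)) ?_)
    · refine eLpNorm_mono fun x => ?_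
      rw [norm_mul]
      exact mul_le_of_le_one_left (norm_nonneg _) (hχ1 _)
    · refine eLpNorm_mono fun x => ?_
      rw [norm_mul]
      exact mul_le_of_le_one_left (norm_nonneg _) (hχ1 _)
    · have hn : ∀ x, ‖f4 x‖ ≤ (δ * (B * M)) * ‖Mu δ x‖ := by
        intro x
        rw [norm_mul, norm_mul, Real.norm_of_nonneg hδ'.le, mul_comm]
        gcongr
        exact ((fderiv ℝ χ (δ • x)).le_opNorm _).trans
          (mul_le_mul (hB _) (hM x) (norm_nonneg _) hB0)
      refine (eLpNorm_le_mul_eLpNorm_of_ae_le_mul (ae_of_all _ hn) 2).trans ?_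
      gcongr
      have e2 : Mu δ = (fun x => Mu δ x - u x) + u := by ext x; simp
      conv_lhs => rw [e2]
      exact eLpNorm_add_le ((hMus δ hδ).continuous.aestronglyMeasurable.sub hu.1) hu.1 (by simp)
  have l1 := tendsto_integral_mul hw hu (by
    filter_upwards [self_mem_nhdsWithin] with δ hδ
    exact (hφs δ hδ).continuous.aestronglyMeasurable) t1
  have l2 := tendsto_integral_mul hu hw (by
    filter_upwards [self_mem_nhdsWithin] with δ hδ
    exact (((hφs δ hδ).continuous_fderiv (by simp)).clm_apply
      hb.continuous).aestronglyMeasurable) t2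
  have l3 : Tendsto (fun δ => ∫ x, u x * fderiv ℝ (φ δ) x (b x)) (𝓝[>] 0)
      (𝓝 (-∫ x, w x * u x)) := by
    refine l1.neg.congr' ?_
    filter_upwards [self_mem_nhdsWithin] with δ hδ
    exact (h (φ δ) (hφs δ hδ) (hφc δ hδ)).symm
  have h3 := tendsto_nhds_unique l2 l3
  have h4 : ∫ x, w x * u x = ∫ x, u x * w x := by simp_rw [mul_comm]
  rw [h4] at h3
  linarith

/-- A divergence-free field generates a skew-symmetric operator, defined weakly on `L²`. -/
theorem transport_skew {b : E d → E d} (hb : DivFreeField b) {u w : E d → ℝ}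
    (hu : MemLp u 2 volume) (hw : MemLp w 2 volume)
    (h : ∀ φ : E d → ℝ, ContDiff ℝ ∞ φ → HasCompactSupport φ →
      ∫ x, u x * fderiv ℝ φ x (b x) = -∫ x, w x * φ x) :
    ∫ x, u x * w x = 0 := by
  have hu' := hu.1.ae_eq_mk
  have hw' := hw.1.ae_eq_mk
  have h1 := transport_skew_of_measurable hb (hu.ae_eq hu')
    hu.1.stronglyMeasurable_mk.measurable (hw.ae_eq hw') hw.1.stronglyMeasurable_mk.measurable
    (fun φ hφ hφc => by
      have h2 := h φ hφ hφc
      have e1 := integral_congr_ae (hu'.mul (ae_eq_refl fun x => fderiv ℝ φ x (b x)))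
      have e2 := integral_congr_ae (hw'.mul (ae_eq_refl φ))
      exact e1.symm.trans (h2.trans (congrArg Neg.neg e2)))
  rw [← h1]
  exact integral_congr_ae (hu'.mul hw')

/-! ### Functions with values in `L²` -/

/-- In a second countable space each open set is a countable union of balls, and the preimage of a
ball is a sublevel set of a distance. -/
theorem measurable_of_measurable_edist {α X : Type*} [MeasurableSpace α] [MetricSpace X]
    [SecondCountableTopology X] [MeasurableSpace X] [BorelSpace X] {f : α → X}
    (h : ∀ c, Measurable fun t => edist (f t) c) : Measurable f := by
  refine measurable_of_isOpen fun U hU => ?_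
  obtain ⟨S, hS, hSU⟩ := TopologicalSpace.isOpen_iUnion_countable
    (fun i : {p : X × ℝ≥0∞ // Metric.eball p.1 p.2 ⊆ U} => Metric.eball i.1.1 i.1.2)
    (fun _ => Metric.isOpen_eball)
  have hU' : U = ⋃ i : {p : X × ℝ≥0∞ // Metric.eball p.1 p.2 ⊆ U}, Metric.eball i.1.1 i.1.2 := by
    refine Subset.antisymm (fun x hx => ?_) (iUnion_subset fun i => i.2)
    obtain ⟨r, hr, hrU⟩ := EMetric.isOpen_iff.1 hU x hx
    exact mem_iUnion.2 ⟨⟨(x, r), hrU⟩, Metric.mem_eball_self hr⟩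
  rw [hU', ← hSU, preimage_iUnion₂]
  refine MeasurableSet.biUnion hS fun i _ => ?_
  exact measurableSet_lt (h i.1.1) measurable_const

open Classical in
/-- The class in `L²` of a function, or zero when it is not square integrable. -/
def toLpOrZero {Y : Type*} [MeasurableSpace Y] (ν : Measure Y) (f : Y → ℝ) : Lp ℝ 2 ν :=
  if h : MemLp f 2 ν then h.toLp f else 0

theorem toLpOrZero_of_memLp {Y : Type*} [MeasurableSpace Y] {ν : Measure Y} {f : Y → ℝ}
    (h : MemLp f 2 ν) : toLpOrZero ν f = h.toLp f := by
  rw [toLpOrZero, dif_pos h]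

theorem measurable_eLpNorm_slice {X Y : Type*} [MeasurableSpace X] [MeasurableSpace Y]
    {ν : Measure Y} [SFinite ν] {v : X → Y → ℝ} (hv : Measurable (Function.uncurry v)) :
    Measurable fun x => eLpNorm (v x) 2 ν := by
  have h1 : Measurable fun x => ∫⁻ y, ‖v x y‖ₑ ^ 2 ∂ν := by
    exact ((hv.enorm.pow_const 2)).lintegral_prod_right'
  have h2 : (fun x => eLpNorm (v x) 2 ν) = fun x => (∫⁻ y, ‖v x y‖ₑ ^ 2 ∂ν) ^ (1 / 2 : ℝ) := by
    ext x
    rw [← eLpNorm_two_sq, ← ENNReal.rpow_natCast, ← ENNReal.rpow_mul]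
    simp
  rw [h2]
  exact h1.pow_const _

/-- Distances to a fixed element of `L²` are slice norms, measurable by Tonelli. This turns a
function of `(t, x)` into a curve in `L²` that can be convolved in time. -/
theorem measurable_toLpOrZero {X Y : Type*} [MeasurableSpace X] [MeasurableSpace Y]
    {ν : Measure Y} [SFinite ν] [IsSeparable ν] {v : X → Y → ℝ}
    (hv : Measurable (Function.uncurry v)) : StronglyMeasurable fun x => toLpOrZero ν (v x) := by
  have : Fact ((2 : ℝ≥0∞) ≠ ⊤) := ⟨by simp⟩
  borelize ↥(Lp ℝ 2 ν)
  refine Measurable.stronglyMeasurable (measurable_of_measurable_edist fun c => ?_)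
  have hvx : ∀ x, Measurable (v x) := fun x => hv.comp measurable_prodMk_left
  have hS : MeasurableSet {x | eLpNorm (v x) 2 ν < ⊤} :=
    measurableSet_lt (measurable_eLpNorm_slice hv) measurable_const
  have hc : StronglyMeasurable (c : Y → ℝ) := Lp.stronglyMeasurable c
  have hd : Measurable fun x => eLpNorm (fun y => v x y - c y) 2 ν :=
    measurable_eLpNorm_slice (v := fun x y => v x y - c y)
      (hv.sub (hc.measurable.comp measurable_snd))
  set S := {x | eLpNorm (v x) 2 ν < ⊤} with hSdef
  have heq : (fun x => edist (toLpOrZero ν (v x)) c) =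
      fun x => S.piecewise
        (fun x => eLpNorm (fun y => v x y - c y) 2 ν) (fun _ => edist 0 c) x := by
    ext x
    by_cases hx : x ∈ S
    · have hm : MemLp (v x) 2 ν := ⟨(hvx x).aestronglyMeasurable, hx⟩
      rw [piecewise_eq_of_mem _ _ _ hx, toLpOrZero_of_memLp hm, Lp.edist_def]
      exact eLpNorm_congr_ae (hm.coeFn_toLp.sub (ae_eq_refl _))
    · rw [piecewise_eq_of_notMem _ _ _ hx, toLpOrZero, dif_neg fun h => hx h.2]
  rw [heq]
  exact hd.piecewise hS measurable_const

theorem inner_toLp {Y : Type*} [MeasurableSpace Y] {ν : Measure Y} {f g : Y → ℝ}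
    (hf : MemLp f 2 ν) (hg : MemLp g 2 ν) :
    inner ℝ (hf.toLp f) (hg.toLp g) = ∫ y, g y * f y ∂ν := by
  rw [L2.inner_def]
  refine integral_congr_ae ?_
  filter_upwards [hf.coeFn_toLp, hg.coeFn_toLp] with y h1 h2
  simp [h1, h2]

/-! ### The energy bound for the transport equation -/

/-- The identity is `(‖W‖²)' = 2 j ⟨W, U⟩`, so formally `‖W‖' ≤ j ‖U‖`, where `j` has integral at
most one. The norm is not differentiable at zero; `√(‖W‖² + κ²)` replaces it, and `κ` is arbitrary.
-/
theorem norm_le_of_energy {H : Type*} [NormedAddCommGroup H] [InnerProductSpace ℝ H]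
    {W W' : ℝ → H} (hW : ∀ t, HasDerivAt W (W' t) t) {j : ℝ → ℝ} (hj : Continuous j)
    (hj0 : ∀ t, 0 ≤ j t) {R : ℝ} (hjint : ∀ t, -R ≤ t → ∫ s in (-R)..t, j s ≤ 1) (hW0 : W (-R) = 0)
    {U : H} (hen : ∀ t, inner ℝ (W t) (W' t) = j t * inner ℝ (W t) U) {t : ℝ} (ht : -R ≤ t) :
    ‖W t‖ ≤ ‖U‖ := by
  refine le_of_forall_pos_le_add fun κ hκ => ?_
  set S : ℝ → ℝ := fun t => √(‖W t‖ ^ 2 + κ ^ 2) with hS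
  have hSpos : ∀ t, 0 < ‖W t‖ ^ 2 + κ ^ 2 := fun t => by positivity
  have hSW : ∀ t, ‖W t‖ ≤ S t := fun t => by
    refine Real.le_sqrt_of_sq_le ?_
    nlinarith [sq_nonneg κ]
  have hdS : ∀ t, HasDerivAt (fun t => S t - ‖U‖ * ∫ s in (-R)..t, j s)
      (2 * inner ℝ (W t) (W' t) / (2 * S t) - ‖U‖ * j t) t := by
    intro t
    have h1 := (((hW t).norm_sq).add_const (κ ^ 2)).sqrt (hSpos t).ne'
    have h2 : HasDerivAt (fun t => ∫ s in (-R)..t, j s) (j t) t :=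
      intervalIntegral.integral_hasDerivAt_right (hj.intervalIntegrable _ _)
        (hj.stronglyMeasurableAtFilter _ _) hj.continuousAt
    exact h1.sub (h2.const_mul ‖U‖)
  have hanti : Antitone fun t => S t - ‖U‖ * ∫ s in (-R)..t, j s := by
    refine antitone_of_deriv_nonpos (fun t => (hdS t).differentiableAt) fun t => ?_
    rw [(hdS t).deriv, hen, sub_nonpos, mul_div_mul_left _ _ two_ne_zero,
      div_le_iff₀ (Real.sqrt_pos.2 (hSpos t))]
    calc j t * inner ℝ (W t) U ≤ j t * (‖W t‖ * ‖U‖) := by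
          gcongr; exacts [hj0 t, real_inner_le_norm _ _]
      _ ≤ j t * (S t * ‖U‖) := by gcongr; exacts [hj0 t, hSW t]
      _ = ‖U‖ * j t * S t := by ring
  have h := hanti ht
  simp only [intervalIntegral.integral_same, mul_zero, sub_zero] at h
  have hS0 : S (-R) = κ := by
    simp only [hS, hW0, norm_zero]
    rw [zero_pow two_ne_zero, zero_add, Real.sqrt_sq hκ.le]
  rw [hS0] at h
  have h3 : ‖U‖ * ∫ s in (-R)..t, j s ≤ ‖U‖ * 1 := by gcongr; exact hjint t ht
  linarith [hSW t]

instance : SFinite timeMeasure := by unfold timeMeasure; infer_instance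

/-- The velocity moment identity: time mollification of a weak solution of the transport
equation. -/
theorem transport_mollified_identity {b : E d → E d} (hb : DivFreeField b) {u₀ : E d → ℝ}
    (hu₀ : MemLp u₀ 2 volume) {u : ℝ → E d → ℝ} (h : IsTransportSolution b u₀ u)
    {U : ℝ → Lp ℝ 2 (volume : Measure (E d))} (hUloc : LocallyIntegrable U)
    (hUneg : ∀ s < 0, U s = 0) (hU : ∀ᵐ s ∂timeMeasure, (U s : E d → ℝ) =ᵐ[volume] u s)
    {j : ℝ → ℝ} (hj : ContDiff ℝ ∞ j) (hjc : HasCompactSupport j)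
    {φ : E d → ℝ} (hφ : ContDiff ℝ ∞ φ) (hφc : HasCompactSupport φ) (t : ℝ) :
    ∫ x, convolution j U (ContinuousLinearMap.lsmul ℝ ℝ) volume t x * fderiv ℝ φ x (b x) =
      -∫ x, (j t • hu₀.toLp u₀ -
        convolution (deriv j) U (ContinuousLinearMap.lsmul ℝ ℝ) volume t) x * φ x := by
  have cB : Continuous fun x => fderiv ℝ φ x (b x) := continuous_fderiv_apply hφ hb.continuous
  have mφ : MemLp φ 2 (volume : Measure (E d)) := hφ.continuous.memLp_of_hasCompactSupport hφc
  have mB : MemLp (fun x => fderiv ℝ φ x (b x)) 2 (volume : Measure (E d)) :=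
    cB.memLp_of_hasCompactSupport (hasCompactSupport_fderiv_apply hφc b)
  set f0 := mφ.toLp φ
  set f1 := mB.toLp _
  have hinner : ∀ (g : Lp ℝ 2 (volume : Measure (E d))) {k : E d → ℝ} (hk : MemLp k 2 volume),
      ∫ x, g x * k x = inner ℝ (hk.toLp k) g := by
    intro g k hk
    rw [L2.inner_def]
    refine integral_congr_ae ?_
    filter_upwards [hk.coeFn_toLp] with x hx
    simp [hx]
  have hint : ∀ k : ℝ → ℝ, Continuous k → HasCompactSupport k →
      Integrable fun s => k (t - s) • U s := by
    intro k hk hkc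
    refine hUloc.integrable_smul_left_of_hasCompactSupport (by fun_prop) ?_
    exact hkc.comp_homeomorph (Homeomorph.subLeft t)
  have hconv : ∀ k : ℝ → ℝ, Continuous k → HasCompactSupport k →
      ∀ f : Lp ℝ 2 (volume : Measure (E d)),
      inner ℝ f (convolution k U (ContinuousLinearMap.lsmul ℝ ℝ) volume t) =
        ∫ s in Ici (0 : ℝ), k (t - s) * inner ℝ f (U s) := by
    intro k hk hkc f
    rw [convolution_lsmul_swap, ← integral_inner (hint k hk hkc)]
    simp_rw [inner_smul_right]
    refine (setIntegral_eq_integral_of_forall_compl_eq_zero fun s hs => ?_).symm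
    rw [hUneg s (by simpa using hs), inner_zero_right, mul_zero]
  have hdj : Continuous (deriv j) := hj.continuous_deriv (by simp)
  have hdjc : HasCompactSupport (deriv j) := hjc.deriv
  -- In the variable `s` this test function is the kernel of the time convolution at `t`. It need
  -- not vanish at `s = 0`, and the initial datum therefore enters with weight `j t`.
  have htest := h.2 (fun s x => j (t - s) * φ x)
    ((hj.comp (contDiff_const.sub contDiff_fst)).mul (hφ.comp contDiff_snd)) (by
      have hc := (hjc.comp_homeomorph (Homeomorph.subLeft t)).isCompact.prod hφc.isCompact
      refine HasCompactSupport.intro hc fun p hp => ?_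
      rw [mem_prod, not_and_or] at hp
      rcases hp with hp | hp
      · have : j (t - p.1) = 0 := image_eq_zero_of_notMem_tsupport
          (f := j ∘ Homeomorph.subLeft t) hp
        simp [Function.uncurry, this]
      · simp [Function.uncurry, image_eq_zero_of_notMem_tsupport hp])
  have hder : ∀ s x, deriv (fun s => j (t - s) * φ x) s = -deriv j (t - s) * φ x := by
    intro s x
    rw [deriv_mul_const]
    · rw [deriv_comp_const_sub]
    · exact ((hj.differentiable (by simp)).comp (differentiable_const t |>.sub differentiable_id)) s
  have hfd : ∀ s x, fderiv ℝ (fun x => j (t - s) * φ x) x (b x) =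
      j (t - s) * fderiv ℝ φ x (b x) := by
    intro s x
    rw [fderiv_const_mul (hφ.differentiable (by simp) x)]; rfl
  have hin : (∫ s in Ici (0 : ℝ), ∫ x, u s x * (deriv (fun s => j (t - s) * φ x) s +
      fderiv ℝ (fun x => j (t - s) * φ x) x (b x))) =
      ∫ s in Ici (0 : ℝ), (j (t - s) * inner ℝ f1 (U s) - deriv j (t - s) * inner ℝ f0 (U s)) := by
    refine integral_congr_ae ?_
    filter_upwards [hU] with s hs
    rw [← hinner, ← hinner, ← integral_const_mul, ← integral_const_mul, ← integral_sub]
    · refine integral_congr_ae ?_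
      filter_upwards [hs] with x hx
      rw [hder, hfd, hx]; ring
    · exact ((Lp.memLp (U s)).integrable_mul mB).const_mul _
    · exact ((Lp.memLp (U s)).integrable_mul mφ).const_mul _
  have hI : ∀ k : ℝ → ℝ, Continuous k → HasCompactSupport k →
      ∀ f : Lp ℝ 2 (volume : Measure (E d)),
      IntegrableOn (fun s => k (t - s) * inner ℝ f (U s)) (Ici 0) := by
    intro k hk hkc f
    have := (hint k hk hkc).const_inner (𝕜 := ℝ) f
    simp_rw [inner_smul_right] at this
    exact this.integrableOn
  rw [hin, integral_sub (hI j hj.continuous hjc f1) (hI _ hdj hdjc f0),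
    ← hconv j hj.continuous hjc, ← hconv _ hdj hdjc] at htest
  have hdata : ∫ x, u₀ x * (j (t - 0) * φ x) = j t * inner ℝ f0 (hu₀.toLp u₀) := by
    rw [inner_toLp, ← integral_const_mul, sub_zero]
    congr 1; ext x; ring
  rw [hdata] at htest
  rw [hinner _ mB, hinner _ mφ, inner_sub_right, inner_smul_right]
  linarith

/-- Weak solutions of the transport equation do not increase the `L²` norm. -/
theorem transport_eLpNorm_le {b : E d → E d} (hb : DivFreeField b) {u₀ : E d → ℝ}
    (hu₀ : MemLp u₀ 2 volume) {u : ℝ → E d → ℝ} (h : IsTransportSolution b u₀ u) :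
    ∀ᵐ t ∂timeMeasure, eLpNorm (u t) 2 volume ≤ eLpNorm u₀ 2 volume := by
  have : Fact ((2 : ℝ≥0∞) ≠ ⊤) := ⟨by simp⟩
  obtain ⟨hum, C, hC⟩ := h.1
  set v : ℝ → E d → ℝ := fun t x => hum.mk (Function.uncurry u) (t, x) with hv
  have hvm : Measurable (Function.uncurry v) := hum.stronglyMeasurable_mk.measurable
  have huv : ∀ᵐ t ∂timeMeasure, u t =ᵐ[volume] v t := Measure.ae_ae_of_ae_prod hum.ae_eq_mk
  -- Extension by zero to negative times makes the convolution defined at every time, and makes it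
  -- vanish at `-rOut`, where the energy estimate starts. The initial datum then acts as a source.
  set U : ℝ → Lp ℝ 2 (volume : Measure (E d)) :=
    (Ici (0 : ℝ)).indicator fun t => toLpOrZero volume (v t) with hUdef
  have hUmeas : StronglyMeasurable U := (measurable_toLpOrZero hvm).indicator measurableSet_Ici
  have hUneg : ∀ s < 0, U s = 0 := fun s hs => indicator_of_notMem (by simpa using hs) _
  have hmem : ∀ᵐ s ∂timeMeasure, MemLp (v s) 2 volume := by
    filter_upwards [huv, hC] with s hs hs'
    exact ⟨(hvm.comp measurable_prodMk_left).aestronglyMeasurable,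
      (eLpNorm_congr_ae hs ▸ hs').trans_lt ENNReal.coe_lt_top⟩
  have hnonneg : ∀ᵐ s ∂timeMeasure, s ∈ Ici (0 : ℝ) := ae_restrict_mem measurableSet_Ici
  have hUs : ∀ᵐ s ∂timeMeasure, ∃ hm : MemLp (v s) 2 volume, U s = hm.toLp (v s) := by
    filter_upwards [hmem, hnonneg] with s hs hs0
    exact ⟨hs, by rw [hUdef, indicator_of_mem hs0, toLpOrZero_of_memLp hs]⟩
  have hU : ∀ᵐ s ∂timeMeasure, (U s : E d → ℝ) =ᵐ[volume] u s := by
    filter_upwards [hUs, huv] with s ⟨hm, hs⟩ hs'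
    rw [hs]
    exact hm.coeFn_toLp.trans hs'.symm
  have hUC' : ∀ᵐ s ∂timeMeasure, ‖U s‖ ≤ C := by
    filter_upwards [hU, hC] with s hs hs'
    rw [Lp.norm_def, eLpNorm_congr_ae hs]
    exact ENNReal.toReal_le_coe_of_le_coe hs'
  have hUC : ∀ᵐ s, ‖U s‖ ≤ C := by
    rw [timeMeasure, ae_restrict_iff' measurableSet_Ici] at hUC'
    filter_upwards [hUC'] with s hs
    by_cases h0 : s ∈ Ici (0 : ℝ)
    · exact hs h0
    · rw [hUneg s (by simpa using h0), norm_zero]; exact C.2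
  have hUloc : LocallyIntegrable U := by
    refine (locallyIntegrable_const (C : ℝ)).mono hUmeas.aestronglyMeasurable ?_
    filter_upwards [hUC] with s hs
    simpa using hs
  have hkey : ∀ (B : ContDiffBump (0 : ℝ)) (t : ℝ), -B.rOut ≤ t →
      ‖convolution (B.normed volume) U (ContinuousLinearMap.lsmul ℝ ℝ) volume t‖ ≤
        ‖hu₀.toLp u₀‖ := by
    intro B t ht
    have hj : ContDiff ℝ ∞ (B.normed volume) := B.contDiff_normed
    have hjc : HasCompactSupport (B.normed volume) := B.hasCompactSupport_normed
    refine norm_le_of_energy (fun t => hjc.hasDerivAt_convolution_left _ (hj.of_le (by simp))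
      hUloc t) hj.continuous (fun s => B.nonneg_normed s) (R := B.rOut) (fun t ht => ?_) ?_
      (fun t => ?_) ht
    · rw [intervalIntegral.integral_of_le ht, ← B.integral_normed (μ := volume)]
      exact setIntegral_le_integral (hj.continuous.integrable_of_hasCompactSupport hjc)
        (ae_of_all _ fun s => B.nonneg_normed s)
    · rw [convolution_lsmul_swap]
      refine integral_eq_zero_of_ae (ae_of_all _ fun s => ?_)
      by_cases hs : s < 0
      · simp [hUneg s hs]
      · have : -B.rOut - s ∉ Function.support (B.normed volume) := by
          rw [B.support_normed_eq, mem_ball_zero_iff, Real.norm_eq_abs, not_lt]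
          rw [abs_of_nonpos (by linarith [B.rOut_pos, not_lt.1 hs])]
          linarith [not_lt.1 hs]
        simp [Function.notMem_support.1 this]
    · set W := convolution (B.normed volume) U (ContinuousLinearMap.lsmul ℝ ℝ) volume t
      set W' := convolution (deriv (B.normed volume)) U (ContinuousLinearMap.lsmul ℝ ℝ) volume t
      -- For the mollified curve `W`, weakly `b · ∇W = j u₀ - W'` with both sides in `L²`.
      -- Skew-symmetry gives `⟨W, W'⟩ = j ⟨W, u₀⟩`, the energy identity.
      have hskew := transport_skew hb (Lp.memLp W)
        (Lp.memLp (B.normed volume t • hu₀.toLp u₀ - W')) (fun φ hφ hφc =>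
          transport_mollified_identity hb hu₀ h hUloc hUneg hU hj hjc hφ hφc t)
      have h2 : inner ℝ W (B.normed volume t • hu₀.toLp u₀ - W') = (0 : ℝ) := by
        rw [L2.inner_def]
        refine Eq.trans ?_ hskew
        exact integral_congr_ae (ae_of_all _ fun x => by simp [mul_comm])
      rw [inner_sub_right, inner_smul_right, sub_eq_zero] at h2
      exact h2.symm
  have hpos : ∀ n : ℕ, (0 : ℝ) < 1 / (n + 1) := fun n => by positivity
  let B : ℕ → ContDiffBump (0 : ℝ) := fun n =>
    ⟨1 / (n + 1), 2 * (1 / (n + 1)), hpos n, by linarith [hpos n]⟩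
  have hlim : ∀ᵐ t, Tendsto (fun n => convolution ((B n).normed volume) U
      (ContinuousLinearMap.lsmul ℝ ℝ) volume t) atTop (𝓝 (U t)) := by
    -- Lebesgue differentiation needs the ratio of the outer to the inner radius of the bumps to be
    -- bounded; it is exactly `2` here.
    refine ContDiffBump.ae_convolution_tendsto_right_of_locallyIntegrable (K := 2) ?_ ?_ hUloc
    · have := (tendsto_one_div_add_atTop_nhds_zero_nat (𝕜 := ℝ)).const_mul 2
      rwa [mul_zero] at this
    · exact Eventually.of_forall fun n => le_rfl
  have hlim' : ∀ᵐ t ∂timeMeasure, Tendsto (fun n => convolution ((B n).normed volume) U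
      (ContinuousLinearMap.lsmul ℝ ℝ) volume t) atTop (𝓝 (U t)) := ae_restrict_of_ae hlim
  filter_upwards [hlim', hU, hnonneg] with t ht hUt ht0
  have hle : ‖U t‖ ≤ ‖hu₀.toLp u₀‖ := le_of_tendsto ht.norm
    (Eventually.of_forall fun n => hkey (B n) t (le_trans (by linarith [(B n).rOut_pos]) ht0))
  rw [Lp.norm_toLp, Lp.norm_def, eLpNorm_congr_ae hUt] at hle
  have hfin : eLpNorm (u t) 2 volume ≠ ⊤ := by
    rw [← eLpNorm_congr_ae hUt]; exact Lp.eLpNorm_ne_top _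
  exact (ENNReal.toReal_le_toReal hfin hu₀.2.ne).1 hle

/-! ### Stability of `K` and the invariant `σ`-algebra -/

variable {a : T d → E d} {ha : ContDiff ℝ 1 (fun y : E d => a (proj y))}

theorem inK_iff {g : T d → ℝ} : InK a ha g ↔
    MemLp g 2 volume ∧ ∀ ψ : T d → ℝ, SmoothTorus ψ → ∫ v, g v * torusDeriv ψ v (a v) = 0 := by
  have key : ∀ h : MemLp g 2 volume, (h.toLp g ∈ kernelK a ha ↔
      ∀ ψ : T d → ℝ, SmoothTorus ψ → ∫ v, g v * torusDeriv ψ v (a v) = 0) := by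
    intro h
    refine forall₂_congr fun ψ hψ => ?_
    have : ∫ v, h.toLp g v * torusDeriv ψ v (a v) = ∫ v, g v * torusDeriv ψ v (a v) := by
      apply integral_congr_ae
      filter_upwards [h.coeFn_toLp] with v hv
      rw [hv]
    rw [this]
  exact ⟨fun ⟨h, h'⟩ => ⟨h, (key h).1 h'⟩, fun ⟨h, h'⟩ => ⟨h, (key h).2 h'⟩⟩

theorem InK.memLp {g : T d → ℝ} (h : InK a ha g) : MemLp g 2 volume := h.1

theorem InK.integral_eq_zero {g : T d → ℝ} (h : InK a ha g) {ψ : T d → ℝ} (hψ : SmoothTorus ψ) :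
    ∫ v, g v * torusDeriv ψ v (a v) = 0 := (inK_iff.1 h).2 ψ hψ

theorem InK.congr_ae {g g' : T d → ℝ} (h : InK a ha g) (hg : g =ᵐ[volume] g') : InK a ha g' := by
  refine inK_iff.2 ⟨h.memLp.ae_eq hg, fun ψ hψ => ?_⟩
  rw [← h.integral_eq_zero hψ]
  apply integral_congr_ae
  filter_upwards [hg] with v hv
  rw [hv]

theorem MemLp.integrable_mul_torusDeriv {g : T d → ℝ} (h : MemLp g 2 volume) {ψ : T d → ℝ}
    (ha : ContDiff ℝ 1 (fun y : E d => a (proj y)))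
    (hψ : SmoothTorus ψ) : Integrable (fun v => g v * torusDeriv ψ v (a v)) volume :=
  h.integrable_mul (memLp_torusDeriv ha hψ)

theorem InK.add {g g' : T d → ℝ} (h : InK a ha g) (h' : InK a ha g') :
    InK a ha (fun v => g v + g' v) := by
  refine inK_iff.2 ⟨h.memLp.add h'.memLp, fun ψ hψ => ?_⟩
  simp only [add_mul]
  rw [integral_add (MemLp.integrable_mul_torusDeriv h.memLp ha hψ)
    (MemLp.integrable_mul_torusDeriv h'.memLp ha hψ), h.integral_eq_zero hψ,
    h'.integral_eq_zero hψ, add_zero]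

theorem InK.const_mul {g : T d → ℝ} (h : InK a ha g) (c : ℝ) :
    InK a ha (fun v => c * g v) := by
  refine inK_iff.2 ⟨h.memLp.const_mul c, fun ψ hψ => ?_⟩
  simp only [mul_assoc]
  rw [integral_const_mul, h.integral_eq_zero hψ, mul_zero]

theorem inK_const (hdiv : ∀ v, torusDiv a v = 0) (c : ℝ) : InK a ha (fun _ => c) := by
  refine inK_iff.2 ⟨memLp_const c, fun ψ hψ => ?_⟩
  rw [integral_const_mul, integral_torusDeriv_field ha hdiv hψ.contDiff_one, mul_zero]

/-- `K` is stable under bounded pointwise limits. -/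
theorem InK.of_tendsto {g : ℕ → T d → ℝ} {g' : T d → ℝ} (h : ∀ n, InK a ha (g n)) {C : ℝ}
    (hC : ∀ n v, ‖g n v‖ ≤ C) (hlim : ∀ v, Tendsto (fun n => g n v) atTop (𝓝 (g' v))) :
    InK a ha g' := by
  have hm : AEStronglyMeasurable g' volume :=
    aestronglyMeasurable_of_tendsto_ae atTop (fun n => (h n).memLp.1) (ae_of_all _ hlim)
  have hC' : ∀ v, ‖g' v‖ ≤ C := fun v =>
    le_of_tendsto (hlim v).norm (Eventually.of_forall fun n => hC n v)
  refine inK_iff.2 ⟨MemLp.of_bound hm C (ae_of_all _ hC'), fun ψ hψ => ?_⟩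
  have hq := (memLp_torusDeriv ha hψ)
  have := tendsto_integral_of_dominated_convergence (μ := volume)
    (F := fun n v => g n v * torusDeriv ψ v (a v)) (f := fun v => g' v * torusDeriv ψ v (a v))
    (fun v => C * ‖torusDeriv ψ v (a v)‖) (fun n => (h n).memLp.1.mul hq.1)
    ((hq.integrable (by norm_num)).norm.const_mul C)
    (fun n => ae_of_all _ fun v => by
      rw [norm_mul]; exact mul_le_mul_of_nonneg_right (hC n v) (norm_nonneg _))
    (ae_of_all _ fun v => (hlim v).mul_const _)
  simp only [fun n => (h n).integral_eq_zero hψ] at this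
  exact (tendsto_nhds_unique this tendsto_const_nhds)

/-- `K` is stable under composition with smooth bounded functions with bounded derivative. -/
theorem InK.comp (hdiv : ∀ v, torusDiv a v = 0) {g : T d → ℝ} (h : InK a ha g) {β : ℝ → ℝ}
    (hβ : ContDiff ℝ ∞ β) {B : ℝ≥0} (hB : ∀ s, ‖β s‖ ≤ B) (hB' : ∀ s, ‖deriv β s‖₊ ≤ B) :
    InK a ha (fun v => β (g v)) := by
  wlog hgm : Measurable g generalizing g
  · have hg' := h.memLp.1.ae_eq_mk
    have := this (h.congr_ae hg') h.memLp.1.stronglyMeasurable_mk.measurable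
    refine this.congr_ae ?_
    filter_upwards [hg'] with v hv
    rw [hv]
  have hβg : MemLp (fun v => β (g v)) 2 volume :=
    MemLp.of_bound (hβ.continuous.measurable.comp hgm).aestronglyMeasurable B
      (ae_of_all _ fun v => hB _)
  refine inK_iff.2 ⟨hβg, fun ψ hψ => ?_⟩
  -- Renormalization: the chain rule is applied to smooth `G n` with `a · ∇(G n) → 0`, since `g`
  -- itself has no derivative to which it would apply.
  obtain ⟨G, hG, hG1, hG2⟩ := exists_smooth_approx_kernel ha hdiv h.memLp hgm
    (fun ψ hψ => h.integral_eq_zero hψ)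
  have hL : LipschitzWith B β :=
    lipschitzWith_of_nnnorm_deriv_le (hβ.differentiable (by simp)) hB'
  have h1 : Tendsto (fun n => eLpNorm (fun v => β (G n v) - β (g v)) 2 volume) atTop (𝓝 0) := by
    refine tendsto_zero_of_le_const_mul (C := B) (by simp) hG1 (Eventually.of_forall fun n => ?_)
    have := eLpNorm_le_nnreal_smul_eLpNorm_of_ae_le_mul (μ := volume) (c := B)
      (f := fun v => β (G n v) - β (g v)) (g := fun v => G n v - g v)
      (ae_of_all _ fun v => by
        have := hL.nndist_le (G n v) (g v)
        simpa [nndist_eq_nnnorm] using this) 2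
    simpa [ENNReal.smul_def] using this
  have hβG : ∀ n, SmoothTorus (fun v => β (G n v)) := fun n => (hG n).comp hβ
  have h2 := tendsto_integral_mul (memLp_torusDeriv ha hψ) hβg
    (Eventually.of_forall fun n => (hβG n).continuous.aestronglyMeasurable) h1
  obtain ⟨C, hC0, hC⟩ := exists_bound_of_continuous hψ.continuous
  -- Integration by parts moves the derivative from `ψ` to `β(G n)`. The result contains `a · ∇(G
  -- n)`, which tends to zero in `L²`, multiplied by factors bounded uniformly in `n`.
  have h3 : ∀ n, ∫ v, torusDeriv ψ v (a v) * β (G n v) =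
      -∫ v, (ψ v * deriv β (G n v)) * torusDeriv (G n) v (a v) := by
    intro n
    have h0 := integral_torusDeriv_field ha hdiv
      (F := fun v => β (G n v) * ψ v) ((hβG n).mul hψ).contDiff_one
    simp only [torusDeriv_mul (F := fun v => β (G n v)) (hβG n).contDiff_one hψ.contDiff_one,
      torusDeriv_comp (hβ.of_le (by simp)) (hG n).contDiff_one] at h0
    have hcd : Continuous (fun v => ψ v * deriv β (G n v)) :=
      hψ.continuous.mul ((hβ.continuous_deriv (by simp)).comp (hG n).continuous)
    rw [integral_add] at h0
    · rw [eq_neg_iff_add_eq_zero, ← h0]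
      congr 1
      · simp only [mul_comm]
      · simp only [mul_assoc]
    · exact MemLp.integrable_mul_torusDeriv (memLp_of_continuous (hβG n).continuous 2) ha hψ
    · simp only [← mul_assoc]
      exact MemLp.integrable_mul_torusDeriv (memLp_of_continuous hcd 2) ha (hG n)
  have h4 : Tendsto (fun n => ∫ v, torusDeriv ψ v (a v) * β (G n v)) atTop (𝓝 0) := by
    refine tendsto_of_enorm_sub_tendsto ?_
    refine tendsto_zero_of_le_const_mul (C := ENNReal.ofReal (C * B)) (by simp) hG2
      (Eventually.of_forall fun n => ?_)
    have hcd : Continuous (fun v => ψ v * deriv β (G n v)) :=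
      hψ.continuous.mul ((hβ.continuous_deriv (by simp)).comp (hG n).continuous)
    rw [h3, sub_zero, enorm_neg]
    refine (enorm_integral_mul_le hcd.aestronglyMeasurable
      (continuous_torusDeriv ha (hG n)).aestronglyMeasurable).trans ?_
    gcongr
    have hb : ∀ v, ‖ψ v * deriv β (G n v)‖ ≤ C * B := fun v => by
      rw [norm_mul]
      exact mul_le_mul (hC v) (hB' _) (norm_nonneg _) hC0
    simpa using eLpNorm_le_of_ae_bound (p := 2) (ae_of_all volume hb)
  simpa only [mul_comm] using tendsto_nhds_unique h2 h4

/-- A smooth approximation of the indicator function of `(c, ∞)`. -/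
def smoothStep (n : ℕ) (c s : ℝ) : ℝ := Real.smoothTransition (n * (s - c))

theorem contDiff_smoothStep (n : ℕ) (c : ℝ) : ContDiff ℝ ∞ (smoothStep n c) :=
  Real.smoothTransition.contDiff.comp (contDiff_const.mul (contDiff_id.sub contDiff_const))

theorem norm_smoothStep_le (n : ℕ) (c s : ℝ) : ‖smoothStep n c s‖ ≤ 1 := by
  rw [smoothStep, Real.norm_eq_abs, abs_of_nonneg (Real.smoothTransition.nonneg _)]
  exact Real.smoothTransition.le_one _

theorem exists_deriv_smoothTransition_le : ∃ B : ℝ≥0, ∀ s, ‖deriv Real.smoothTransition s‖₊ ≤ B := by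
  have hc : Continuous (deriv Real.smoothTransition) :=
    (Real.smoothTransition.contDiff (n := 1)).continuous_deriv (by simp)
  obtain ⟨C, hC⟩ := (isCompact_Icc (a := (0 : ℝ)) (b := 1)).exists_bound_of_continuousOn
    hc.continuousOn
  refine ⟨C.toNNReal, fun s => ?_⟩
  rw [← NNReal.coe_le_coe, coe_nnnorm]
  have hC0 : 0 ≤ C := (norm_nonneg _).trans (hC 0 (by simp))
  rw [Real.coe_toNNReal C hC0]
  rcases lt_or_ge s 0 with hs | hs
  · have : Real.smoothTransition =ᶠ[𝓝 s] fun _ => 0 := by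
      filter_upwards [Iio_mem_nhds hs] with r hr
      exact Real.smoothTransition.zero_of_nonpos (le_of_lt hr)
    rw [this.deriv_eq]; simpa
  rcases lt_or_ge 1 s with hs' | hs'
  · have : Real.smoothTransition =ᶠ[𝓝 s] fun _ => 1 := by
      filter_upwards [Ioi_mem_nhds hs'] with r hr
      exact Real.smoothTransition.one_of_one_le (le_of_lt hr)
    rw [this.deriv_eq]; simpa
  · exact hC s ⟨hs, hs'⟩

theorem InK.smoothStep (hdiv : ∀ v, torusDiv a v = 0) {g : T d → ℝ} (h : InK a ha g) (n : ℕ)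
    (c : ℝ) : InK a ha (fun v => smoothStep n c (g v)) := by
  obtain ⟨B, hB⟩ := exists_deriv_smoothTransition_le
  -- One constant must bound the function, which is at most `1`, and its derivative, at most `n`
  -- times that of the transition.
  refine h.comp hdiv (B := max 1 (n * B)) (contDiff_smoothStep n c)
    (fun s => (norm_smoothStep_le n c s).trans (by simp)) fun s => ?_
  have h1 : HasDerivAt (Homog.smoothStep n c)
      (deriv Real.smoothTransition (n * (s - c)) * (n * 1)) s := by
    refine HasDerivAt.comp s (h₂ := Real.smoothTransition) ?_ (((hasDerivAt_id s).sub_const c).const_mul (n : ℝ))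
    exact ((Real.smoothTransition.contDiff (n := 1)).differentiable (by simp) _).hasDerivAt
  rw [h1.deriv, nnnorm_mul, mul_one, mul_comm]
  refine le_max_of_le_right ?_
  gcongr
  · simp
  · exact hB _

theorem tendsto_smoothStep (c s : ℝ) :
    Tendsto (fun n : ℕ => smoothStep n c s) atTop (𝓝 ((Ioi c).indicator 1 s)) := by
  rcases le_or_gt s c with hs | hs
  · rw [indicator_of_notMem (by simpa using hs)]
    refine tendsto_const_nhds.congr fun n => ?_
    exact (Real.smoothTransition.zero_of_nonpos
      (mul_nonpos_of_nonneg_of_nonpos (by positivity) (by linarith))).symm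
  · rw [indicator_of_mem (by simpa using hs)]
    obtain ⟨N, hN⟩ := exists_nat_ge ((s - c)⁻¹)
    refine tendsto_const_nhds.congr' ?_
    filter_upwards [eventually_ge_atTop N] with n hn
    refine (Real.smoothTransition.one_of_one_le ?_).symm
    have h0 : 0 < s - c := by linarith
    have : (s - c)⁻¹ ≤ n := hN.trans (by exact_mod_cast hn)
    rwa [inv_le_iff_one_le_mul₀ h0] at this

/-- The superlevel sets of a function in `K` have their indicator function in `K`. -/
theorem InK.indicator_lt (hdiv : ∀ v, torusDiv a v = 0) {g : T d → ℝ} (h : InK a ha g) (c : ℝ) :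
    InK a ha ({v | c < g v}.indicator 1) :=
  InK.of_tendsto (C := 1) (fun n => h.smoothStep hdiv n c) (fun n v => norm_smoothStep_le n c (g v))
    (fun v => tendsto_smoothStep c (g v))

theorem InK.indicator_compl (hdiv : ∀ v, torusDiv a v = 0) {A : Set (T d)}
    (h : InK a ha (A.indicator 1)) : InK a ha (Aᶜ.indicator 1) := by
  have := (inK_const (ha := ha) hdiv 1).add (h.const_mul (-1))
  convert this using 2 with v
  by_cases hv : v ∈ A <;> simp [hv]

theorem InK.indicator_union (hdiv : ∀ v, torusDiv a v = 0) {A B : Set (T d)}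
    (h : InK a ha (A.indicator 1)) (h' : InK a ha (B.indicator 1)) :
    InK a ha ((A ∪ B).indicator 1) := by
  -- The union is the set where the sum of the two indicators exceeds `1/2`.
  convert (h.add h').indicator_lt hdiv (1 / 2) using 2
  ext v
  by_cases hv : v ∈ A <;> by_cases hv' : v ∈ B <;> simp [hv, hv'] <;> norm_num

/-- The `σ`-algebra of the measurable sets that are invariant under the field `a`. -/
@[reducible] def invariantAlgebra (a : T d → E d) (ha : ContDiff ℝ 1 (fun y : E d => a (proj y)))
    (hdiv : ∀ v, torusDiv a v = 0) : MeasurableSpace (T d) where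
  MeasurableSet' A := MeasurableSet A ∧ InK a ha (A.indicator 1)
  measurableSet_empty := ⟨MeasurableSet.empty, by
    rw [indicator_empty]; exact inK_const hdiv 0⟩
  measurableSet_compl A hA := ⟨hA.1.compl, hA.2.indicator_compl hdiv⟩
  measurableSet_iUnion A hA := by
    refine ⟨MeasurableSet.iUnion fun i => (hA i).1, ?_⟩
    have h1 : ∀ n, InK a ha ((accumulate A n).indicator 1) := by
      intro n
      induction n with
      | zero => simpa using (hA 0).2
      | succ n ih =>
        rw [accumulate_succ]
        exact ih.indicator_union hdiv (hA (n + 1)).2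
    refine InK.of_tendsto (C := 1) h1 (fun n v => ?_) fun v => ?_
    · by_cases hv : v ∈ accumulate A n <;> simp [hv]
    · rw [← iUnion_accumulate]
      exact (monotone_accumulate.tendsto_indicator _ _ v).mono_right (pure_le_nhds _)

variable {hdiv : ∀ v, torusDiv a v = 0}

theorem invariantAlgebra_le : invariantAlgebra a ha hdiv ≤ MeasurableSpace.pi := fun _ h => h.1

/-- Superlevel sets of `g` are invariant and the half-lines generate the Borel sets. With
`inK_of_measurable` as converse, `K` is identified with the `L²` space of the invariant `σ`-algebra.
-/
theorem InK.measurable {g : T d → ℝ} (h : InK a ha g) (hg : Measurable g) :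
    Measurable[invariantAlgebra a ha hdiv] g := by
  refine measurable_of_Ioi fun c => ⟨hg measurableSet_Ioi, ?_⟩
  exact h.indicator_lt hdiv c

/-! ### `K` as a space of conditional expectations -/

/-- The hypothesis says that `q` has zero conditional expectation, and the measurable factor `g` can
be pulled out. -/
theorem integral_mul_eq_zero_of_setIntegral_eq_zero {Ω : Type*} {m m₀ : MeasurableSpace Ω}
    {μ : Measure Ω} (hm : m ≤ m₀) [SigmaFinite (μ.trim hm)] {q g : Ω → ℝ} (hq : Integrable q μ)
    (h : ∀ s, MeasurableSet[m] s → ∫ x in s, q x ∂μ = 0) (hg : StronglyMeasurable[m] g)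
    (hgq : Integrable (fun x => g x * q x) μ) : ∫ x, g x * q x ∂μ = 0 := by
  have h0 : (0 : Ω → ℝ) =ᵐ[μ] μ[q | m] :=
    ae_eq_condExp_of_forall_setIntegral_eq hm hq (fun s _ _ => integrableOn_zero)
      (fun s hs _ => by simp [h s hs]) aestronglyMeasurable_zero
  have h1 := condExp_mul_of_stronglyMeasurable_left hg hgq hq
  have h2 : ∫ x, g x * q x ∂μ = ∫ x, μ[g * q | m] x ∂μ := (integral_condExp hm).symm
  rw [h2, integral_congr_ae h1]
  refine (integral_congr_ae ?_).trans (integral_zero Ω ℝ)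
  filter_upwards [h0] with x hx
  simp [← hx]

variable {a : T d → E d} {ha : ContDiff ℝ 1 (fun y : E d => a (proj y))}
  {hdiv : ∀ v, torusDiv a v = 0}

/-- By the very definition of an invariant set, `a · ∇ψ` has integral zero over it; so `a · ∇ψ` has
zero conditional expectation and integrates to zero against `g`. -/
theorem inK_of_measurable {g : T d → ℝ} (hg : Measurable[invariantAlgebra a ha hdiv] g)
    (hg2 : MemLp g 2 volume) : InK a ha g := by
  refine inK_iff.2 ⟨hg2, fun ψ hψ => ?_⟩
  refine integral_mul_eq_zero_of_setIntegral_eq_zero (invariantAlgebra_le (hdiv := hdiv))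
    ((memLp_torusDeriv ha hψ).integrable (by norm_num)) (fun s hs => ?_)
    hg.stronglyMeasurable (MemLp.integrable_mul_torusDeriv hg2 ha hψ)
  rw [← hs.2.integral_eq_zero hψ, ← integral_indicator hs.1]
  congr 1 with v
  by_cases hv : v ∈ s <;> simp [hv]

theorem projFun_ae_eq {g : T d → ℝ} (hg : MemLp g 2 volume) :
    projFun a ha g =ᵐ[volume] projK a ha (hg.toLp g) := by
  rw [projFun, dif_pos hg]

theorem inK_projFun {g : T d → ℝ} (hg : MemLp g 2 volume) : InK a ha (projFun a ha g) := by
  have : InK a ha (projK a ha (hg.toLp g)) :=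
    ⟨Lp.memLp _, by rw [Lp.toLp_coeFn]; exact Submodule.starProjection_apply_mem _ _⟩
  exact this.congr_ae (projFun_ae_eq hg).symm

theorem integral_mul_eq_inner_toLp {α : Type*} [MeasurableSpace α] {μ : Measure α} {g h : α → ℝ}
    (hg : MemLp g 2 μ) (hh : MemLp h 2 μ) :
    ∫ v, g v * h v ∂μ = inner ℝ (hg.toLp g) (hh.toLp h) := by
  rw [L2.inner_def]
  apply integral_congr_ae
  filter_upwards [hg.coeFn_toLp, hh.coeFn_toLp] with v h1 h2
  simp [h1, h2, mul_comm]

/-- The projection onto `K` is symmetric. -/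
theorem integral_projFun_mul {g h : T d → ℝ} (hg : MemLp g 2 volume) (hh : MemLp h 2 volume) :
    ∫ v, projFun a ha g v * h v = ∫ v, g v * projFun a ha h v := by
  rw [integral_mul_eq_inner_toLp (inK_projFun hg).memLp hh,
    integral_mul_eq_inner_toLp hg (inK_projFun hh).memLp]
  have h1 : (inK_projFun (ha := ha) hg).memLp.toLp _ = projK a ha (hg.toLp g) :=
    Lp.ext ((MemLp.coeFn_toLp _).trans (projFun_ae_eq hg))
  have h2 : (inK_projFun (ha := ha) hh).memLp.toLp _ = projK a ha (hh.toLp h) :=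
    Lp.ext ((MemLp.coeFn_toLp _).trans (projFun_ae_eq hh))
  rw [h1, h2]
  exact Submodule.inner_starProjection_left_eq_right _ _ _

theorem InK.projFun_ae_eq {g : T d → ℝ} (hg : InK a ha g) :
    projFun a ha g =ᵐ[volume] g := by
  refine (Homog.projFun_ae_eq hg.memLp).trans ?_
  obtain ⟨h, hK⟩ := hg
  have : projK a ha (h.toLp g) = h.toLp g := Submodule.starProjection_eq_self_iff.2 hK
  rw [this]
  exact h.coeFn_toLp

theorem InK.exists_measurable (hdiv : ∀ v, torusDiv a v = 0) {g : T d → ℝ} (hg : InK a ha g) :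
    ∃ g', Measurable[invariantAlgebra a ha hdiv] g' ∧ g =ᵐ[volume] g' :=
  ⟨_, (hg.congr_ae hg.memLp.1.ae_eq_mk).measurable hg.memLp.1.stronglyMeasurable_mk.measurable,
    hg.memLp.1.ae_eq_mk⟩

/-- The projection onto `K` is a conditional expectation. -/
theorem projFun_ae_eq_condExp {g : T d → ℝ} (hg : MemLp g 2 volume) :
    projFun a ha g =ᵐ[volume] volume[g | invariantAlgebra a ha hdiv] := by
  have hK := inK_projFun (ha := ha) hg
  refine ae_eq_condExp_of_forall_setIntegral_eq invariantAlgebra_le (hg.integrable (by norm_num))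
    (fun s _ _ => (hK.memLp.integrable (by norm_num)).integrableOn) (fun s hs _ => ?_) ?_
  · have h1 : ∀ h : T d → ℝ, ∫ v in s, h v = ∫ v, h v * s.indicator 1 v := by
      intro h
      rw [← integral_indicator hs.1]
      congr 1 with v
      by_cases hv : v ∈ s <;> simp [hv]
    -- Symmetry moves `P` onto the indicator of the invariant set, which `P` fixes.
    rw [h1, h1, integral_projFun_mul hg hs.2.memLp]
    apply integral_congr_ae
    filter_upwards [hs.2.projFun_ae_eq] with v hv
    rw [hv]
  · obtain ⟨g', hg', hgg⟩ := hK.exists_measurable hdiv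
    exact ⟨g', hg'.stronglyMeasurable, hgg⟩

/-- The projection onto `K` of a bounded function has a bounded representative that is measurable
for the invariant `σ`-algebra. -/
theorem exists_measurable_proj (ha : ContDiff ℝ 1 (fun y : E d => a (proj y)))
    (hdiv : ∀ v, torusDiv a v = 0) {h : T d → ℝ} (hm : Measurable h) {M : ℝ}
    (hM : ∀ v, ‖h v‖ ≤ M) :
    ∃ c : T d → ℝ, Measurable[invariantAlgebra a ha hdiv] c ∧ (∀ v, ‖c v‖ ≤ M) ∧
      projFun a ha h =ᵐ[volume] c ∧ ∀ g, InK a ha g → ∫ v, g v * (h v - c v) = 0 := by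
  have h2 : MemLp h 2 volume := MemLp.of_bound hm.aestronglyMeasurable M (ae_of_all _ hM)
  have hM0 : 0 ≤ M := (norm_nonneg _).trans (hM 0)
  set m := invariantAlgebra a ha hdiv
  let c₀ : T d → ℝ := volume[h | m]
  -- The conditional expectation obeys the bound only almost everywhere; clamping keeps it invariant
  -- and makes the bound hold at every point.
  let c : T d → ℝ := fun v => max (-M) (min M (c₀ v))
  have hc : Measurable[m] c :=
    measurable_const.max (measurable_const.min stronglyMeasurable_condExp.measurable)
  have hcM : ∀ v, ‖c v‖ ≤ M := fun v => by
    rw [Real.norm_eq_abs, abs_le]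
    exact ⟨le_max_left _ _, max_le (by linarith) (min_le_left _ _)⟩
  have hbd : ∀ᵐ v, |c₀ v| ≤ M := ae_bdd_abs_condExp_of_ae_bdd_abs (m := m) (ae_of_all _ hM)
  have hPc : projFun a ha h =ᵐ[volume] c := by
    filter_upwards [projFun_ae_eq_condExp (hdiv := hdiv) h2, hbd] with v h1 hv
    rw [abs_le] at hv
    rw [h1]
    simp [c, c₀, m, hv.1, hv.2]
  refine ⟨c, hc, hcM, hPc, fun g hg => ?_⟩
  have hP := (inK_projFun (ha := ha) h2).memLp
  have h3 : ∫ v, g v * (h v - c v) = ∫ v, (g v * h v - g v * projFun a ha h v) := by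
    apply integral_congr_ae
    filter_upwards [hPc] with v hv
    rw [hv, mul_sub]
  have h4 : ∫ v, projFun a ha g v * h v = ∫ v, g v * h v := by
    apply integral_congr_ae
    filter_upwards [hg.projFun_ae_eq] with v hv
    rw [hv]
  have h5 : ∫ v, (g v * h v - g v * projFun a ha h v) =
      (∫ v, g v * h v) - ∫ v, g v * projFun a ha h v :=
    integral_sub (hg.memLp.integrable_mul h2) (hg.memLp.integrable_mul hP)
  rw [h3, h5, ← integral_projFun_mul hg.memLp h2, h4, sub_self]

/-- A bounded representative of `P a` that is measurable for the invariant `σ`-algebra. -/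
theorem exists_field (a : T d → E d) (ha : ContDiff ℝ 1 (fun y : E d => a (proj y)))
    (hdiv : ∀ v, torusDiv a v = 0) :
    ∃ b : T d → E d, Measurable[invariantAlgebra a ha hdiv] b ∧ (∃ M, ∀ v, ‖b v‖ ≤ M) ∧
      projField a ha =ᵐ[volume] b ∧
      ∀ g, InK a ha g → ∀ i, ∫ v, g v * (a v i - b v i) = 0 := by
  have hac : Continuous a := continuous_of_lift ha.continuous
  obtain ⟨M, hM0, hM⟩ := exists_bound_of_continuous hac
  have haic : ∀ i, Continuous fun v => a v i := fun i => by fun_prop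
  choose b hb hbM hbP hbK using fun i => exists_measurable_proj ha hdiv (haic i).measurable
    fun v => (PiLp.norm_apply_le (a v) i).trans (hM v)
  refine ⟨fun v => WithLp.toLp 2 fun i => b i v, ?_, ⟨√(d * M ^ 2), fun v => ?_⟩, ?_, ?_⟩
  · let m := invariantAlgebra a ha hdiv
    exact (WithLp.measurable_toLp 2 _).comp (measurable_pi_lambda _ hb)
  · rw [EuclideanSpace.norm_eq]
    apply Real.sqrt_le_sqrt
    calc ∑ i, ‖b i v‖ ^ 2 ≤ ∑ _i : Fin d, M ^ 2 :=
          Finset.sum_le_sum fun i _ => pow_le_pow_left₀ (norm_nonneg _) (hbM i v) 2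
      _ = d * M ^ 2 := by simp
  · filter_upwards [ae_all_iff.2 hbP] with v hv
    simp only [projField, hv]
  · exact fun g hg i => hbK i g hg

variable {a : T d → E d} {ha : ContDiff ℝ 1 (fun y : E d => a (proj y))}
  {hdiv : ∀ v, torusDiv a v = 0}

/-! ### The projected profile -/

theorem integral_sub_mul {α : Type*} [MeasurableSpace α] {μ : Measure α} {f g h : α → ℝ}
    (hf : MemLp f 2 μ) (hg : MemLp g 2 μ) (hh : MemLp h 2 μ) :
    ∫ x, (f x - g x) * h x ∂μ = ∫ x, f x * h x ∂μ - ∫ x, g x * h x ∂μ := by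
  simp only [sub_mul]
  exact integral_sub (hf.integrable_mul hh) (hg.integrable_mul hh)

theorem MemLp.slice_ae {α β : Type*} [MeasurableSpace α] [MeasurableSpace β] {μ : Measure α}
    {ν : Measure β} [SFinite μ] [SFinite ν] {F : α × β → ℝ} (hF : MemLp F 2 (μ.prod ν)) :
    ∀ᵐ x ∂μ, MemLp (fun y => F (x, y)) 2 ν := by
  filter_upwards [hF.integrable_sq.prod_right_ae, hF.1.prodMk_left] with x h1 h2
  exact (memLp_two_iff_integrable_sq h2).2 h1

theorem ae_eq_zero_of_integral_continuousMap {g : T d → ℝ} (hg : Integrable g volume)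
    (h : ∀ ψ : C(T d, ℝ), ∫ v, g v * ψ v = 0) : g =ᵐ[volume] 0 := by
  refine ae_eq_zero_of_forall_setIntegral_isClosed_eq_zero hg fun s hs => ?_
  let ψ : ℕ → C(T d, ℝ) := fun n => ⟨fun v => (hs.apprSeq n v : ℝ), by fun_prop⟩
  have h1 : Tendsto (fun n => ∫ v, g v * ψ n v) atTop (𝓝 (∫ v, g v * s.indicator 1 v)) := by
    refine tendsto_integral_of_dominated_convergence (fun v => ‖g v‖)
      (fun n => hg.1.mul (ψ n).continuous.aestronglyMeasurable) hg.norm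
      (fun n => ae_of_all _ fun v => ?_) (ae_of_all _ fun v => ?_)
    · rw [norm_mul]
      refine mul_le_of_le_one_right (norm_nonneg _) ?_
      have := HasOuterApproxClosed.apprSeq_apply_le_one hs n v
      simpa [ψ] using this
    · refine Tendsto.const_mul _ ?_
      have h2 := (tendsto_pi_nhds.1 (HasOuterApproxClosed.tendsto_apprSeq hs)) v
      have h3 := (NNReal.continuous_coe.tendsto _).comp h2
      have e : s.indicator (1 : T d → ℝ) v = ((s.indicator (fun _ => (1 : ℝ≥0)) v : ℝ≥0) : ℝ) := by
        by_cases hv : v ∈ s <;> simp [hv]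
      rw [e]
      exact h3
  simp only [h] at h1
  rw [← integral_indicator hs.measurableSet, ← tendsto_nhds_unique h1 tendsto_const_nhds]
  congr 1 with v
  by_cases hv : v ∈ s <;> simp [hv]

theorem integrable_mul_continuousMap {g : T d → ℝ} (hg : Integrable g volume) (h : C(T d, ℝ)) :
    Integrable (fun v => g v * h v) volume :=
  hg.mul_bdd (c := ‖h‖) h.continuous.aestronglyMeasurable (ae_of_all _ h.norm_coe_le_norm)

theorem continuous_integral_mul {g : T d → ℝ} (hg : Integrable g volume) :
    Continuous fun h : C(T d, ℝ) => ∫ v, g v * h v := by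
  refine (LipschitzWith.of_dist_le_mul (K := (∫ v, ‖g v‖).toNNReal) fun h h' => ?_).continuous
  rw [Real.coe_toNNReal _ (integral_nonneg fun _ => norm_nonneg _), dist_eq_norm,
    ← integral_sub (integrable_mul_continuousMap hg h) (integrable_mul_continuousMap hg h'),
    ← integral_mul_const]
  refine norm_integral_le_of_norm_le (hg.norm.mul_const _) (ae_of_all _ fun v => ?_)
  rw [← mul_sub, norm_mul, ← dist_eq_norm]
  exact mul_le_mul_of_nonneg_left (ContinuousMap.dist_apply_le_dist v) (norm_nonneg _)

/-- Continuous functions from a countable family separate the elements of `L¹(𝕋^d)`. -/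
theorem ae_eq_zero_of_integral_denseSeq {g : T d → ℝ} (hg : Integrable g volume)
    (h : ∀ n, ∫ v, g v * TopologicalSpace.denseSeq C(T d, ℝ) n v = 0) : g =ᵐ[volume] 0 := by
  have h0 : (fun h : C(T d, ℝ) => ∫ v, g v * h v) = fun _ => 0 := by
    refine Continuous.ext_on (TopologicalSpace.denseRange_denseSeq C(T d, ℝ))
      (continuous_integral_mul hg) continuous_const ?_
    rintro _ ⟨n, rfl⟩
    exact h n
  exact ae_eq_zero_of_integral_continuousMap hg fun ψ => congrFun h0 ψ

/-- Smooth functions separate the elements of `L¹(𝕋^d)`. -/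
theorem ae_eq_zero_of_integral_smooth_of_integrable {g : T d → ℝ} (hg : Integrable g volume)
    (h : ∀ ψ : T d → ℝ, SmoothTorus ψ → ∫ v, g v * ψ v = 0) : g =ᵐ[volume] 0 := by
  have h0 : (fun h : C(T d, ℝ) => ∫ v, g v * h v) = fun _ => 0 := by
    have hd : Dense {ψ : C(T d, ℝ) | SmoothTorus ψ} := fun ψ => by
      refine Metric.mem_closure_iff.2 fun η hη => ?_
      obtain ⟨ψ', hψ', hle⟩ := exists_smooth_near ψ (half_pos hη)
      refine ⟨⟨ψ', hψ'.continuous⟩, hψ', ?_⟩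
      refine lt_of_le_of_lt ((ContinuousMap.dist_le (half_pos hη).le).2 fun v => ?_)
        (half_lt_self hη)
      rw [dist_eq_norm]
      exact hle v
    exact Continuous.ext_on hd (continuous_integral_mul hg) continuous_const fun ψ hψ => h ψ hψ
  exact ae_eq_zero_of_integral_continuousMap hg fun ψ => congrFun h0 ψ

/-- The `σ`-algebra on `ℝ^d × 𝕋^d` generated by the Borel sets and the invariant sets. -/
@[reducible] def invariantProd (a : T d → E d) (ha : ContDiff ℝ 1 (fun y : E d => a (proj y)))
    (hdiv : ∀ v, torusDiv a v = 0) : MeasurableSpace (E d × T d) :=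
  @Prod.instMeasurableSpace _ _ inferInstance (invariantAlgebra a ha hdiv)

theorem invariantProd_le : invariantProd a ha hdiv ≤ Prod.instMeasurableSpace :=
  sup_le_sup le_rfl (MeasurableSpace.comap_mono (invariantAlgebra_le (hdiv := hdiv)))

theorem measurable_fst_mul_snd {χ : E d → ℝ} {g : T d → ℝ} (hχ : Measurable χ)
    (hg : Measurable[invariantAlgebra a ha hdiv] g) :
    Measurable[invariantProd a ha hdiv] fun p : E d × T d => χ p.1 * g p.2 :=
  (hχ.comp (@measurable_fst _ _ _ (invariantAlgebra a ha hdiv))).mul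
    (hg.comp (@measurable_snd _ _ _ (invariantAlgebra a ha hdiv)))

theorem measurable_invariantProd_slice {α : Type*} {F : E d × T d → α} [MeasurableSpace α]
    (hF : Measurable[invariantProd a ha hdiv] F) {X : T d → E d}
    (hX : Measurable[invariantAlgebra a ha hdiv] X) :
    Measurable[invariantAlgebra a ha hdiv] fun v => F (X v, v) := by
  have h : @Measurable _ _ (invariantAlgebra a ha hdiv) (invariantProd a ha hdiv)
      fun v => (X v, v) := by
    refine @Measurable.prodMk (T d) (invariantAlgebra a ha hdiv) (E d) (T d) _
      (invariantAlgebra a ha hdiv) X id hX ?_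
    exact @measurable_id _ (invariantAlgebra a ha hdiv)
  exact hF.comp h

/-- `projFun` picks an unrelated representative for each `x`, so joint measurability of `PU⁰` is
obtained differently: by conditioning once on the product space, and comparing slices afterwards. -/
theorem exists_condExpL2 (a : T d → E d) (ha : ContDiff ℝ 1 (fun y : E d => a (proj y)))
    (hdiv : ∀ v, torusDiv a v = 0) {U : E d × T d → ℝ} (hU : MemLp U 2 volume) :
    ∃ F : E d × T d → ℝ, Measurable[invariantProd a ha hdiv] F ∧ MemLp F 2 volume ∧
      ∀ θ : E d × T d → ℝ, Measurable[invariantProd a ha hdiv] θ → MemLp θ 2 volume →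
        ∫ p, F p * θ p = ∫ p, U p * θ p := by
  have hm := invariantProd_le (ha := ha) (hdiv := hdiv)
  set F₀ := condExpL2 ℝ ℝ hm (hU.toLp U)
  obtain ⟨F, hF, hFF⟩ := lpMeas.aestronglyMeasurable F₀
  have hF2 : MemLp F 2 volume := (Lp.memLp (F₀ : Lp ℝ 2 (volume : Measure (E d × T d)))).ae_eq hFF
  refine ⟨F, hF.measurable, hF2, fun θ hθ hθ2 => ?_⟩
  rw [integral_mul_eq_inner_toLp hU hθ2, integral_mul_eq_inner_toLp hF2 hθ2]
  have h1 : hF2.toLp F = F₀ := Lp.ext (hF2.coeFn_toLp.trans hFF.symm)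
  rw [h1]
  exact inner_condExpL2_eq_inner_fun hm _ _ ⟨θ, hθ.stronglyMeasurable, hθ2.coeFn_toLp⟩

theorem MemLp.fst_mul_snd {α β : Type*} [MeasurableSpace α] [MeasurableSpace β] {μ : Measure α}
    {ν : Measure β} [SFinite μ] [SFinite ν] {χ : α → ℝ} {g : β → ℝ} (hχ : MemLp χ 2 μ)
    (hg : MemLp g 2 ν) : MemLp (fun p : α × β => χ p.1 * g p.2) 2 (μ.prod ν) := by
  have hm : AEStronglyMeasurable (fun p : α × β => χ p.1 * g p.2) (μ.prod ν) :=
    hχ.1.comp_fst.mul hg.1.comp_snd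
  refine (memLp_two_iff_integrable_sq hm).2 ?_
  simp only [mul_pow]
  exact hχ.integrable_sq.mul_prod hg.integrable_sq

/-- A jointly measurable representative of the projected profile. -/
theorem exists_profile (a : T d → E d) (ha : ContDiff ℝ 1 (fun y : E d => a (proj y)))
    (hdiv : ∀ v, torusDiv a v = 0) {U : E d × T d → ℝ} (hU : MemLp U 2 volume) :
    ∃ F : E d × T d → ℝ, Measurable[invariantProd a ha hdiv] F ∧ MemLp F 2 volume ∧
      (∀ᵐ x, projFun a ha (fun v => U (x, v)) =ᵐ[volume] fun v => F (x, v)) ∧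
      ∀ θ : E d × T d → ℝ, Measurable[invariantProd a ha hdiv] θ → MemLp θ 2 volume →
        ∫ p, F p * θ p = ∫ p, U p * θ p := by
  obtain ⟨F, hF, hF2, hFU⟩ := exists_condExpL2 a ha hdiv hU
  refine ⟨F, hF, hF2, ?_, hFU⟩
  have hW : MemLp (fun p => F p - U p) 2 (volume.prod volume) := hF2.sub hU
  -- Slices are compared through tests `1_s(x) g(v)`, where `g` is an invariant version of the
  -- projection of a continuous function. A dense sequence of continuous functions suffices, so the
  -- exceptional sets of `x` remain countable in number.
  have key : ∀ n, ∀ᵐ x, ∫ v, (F (x, v) - U (x, v)) *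
      projFun a ha (TopologicalSpace.denseSeq C(T d, ℝ) n) v = 0 := by
    intro n
    set ψ := TopologicalSpace.denseSeq C(T d, ℝ) n
    obtain ⟨g, hg, hψg⟩ := (inK_projFun (ha := ha)
      (memLp_of_continuous ψ.continuous 2)).exists_measurable hdiv
    have hg2 : MemLp g 2 volume :=
      (inK_projFun (ha := ha) (memLp_of_continuous ψ.continuous 2)).memLp.ae_eq hψg
    have h1 : ∀ s : Set (E d), MeasurableSet s → volume s < ⊤ →
        MemLp (s.indicator (1 : E d → ℝ)) 2 volume := fun s hs hs' =>
      memLp_indicator_const 2 hs 1 (Or.inr hs'.ne)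
    have h2 : ∀ s : Set (E d), MeasurableSet s → volume s < ⊤ →
        Integrable (fun p : E d × T d => (F p - U p) * (s.indicator 1 p.1 * g p.2))
          (volume.prod volume) := fun s hs hs' =>
      hW.integrable_mul (MemLp.fst_mul_snd (h1 s hs hs') hg2)
    have h3 : ∀ (s : Set (E d)) (x : E d), s.indicator
        (fun x => ∫ v, (F (x, v) - U (x, v)) * g v) x =
        ∫ v, (F (x, v) - U (x, v)) * (s.indicator 1 x * g v) := by
      intro s x
      by_cases hx : x ∈ s <;> simp [hx]
    have h4 : (fun x => ∫ v, (F (x, v) - U (x, v)) * g v) =ᵐ[volume] 0 := by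
      refine ae_eq_zero_of_forall_setIntegral_eq_of_sigmaFinite (fun s hs hs' => ?_)
        (fun s hs hs' => ?_)
      · rw [← integrable_indicator_iff hs]
        refine ((h2 s hs hs').integral_prod_left).congr (ae_of_all _ fun x => (h3 s x).symm)
      · rw [← integral_indicator hs]
        simp only [h3]
        rw [← integral_prod _ (h2 s hs hs')]
        have hθ := measurable_fst_mul_snd (χ := s.indicator 1) (measurable_const.indicator hs) hg
        have hθ2 := MemLp.fst_mul_snd (h1 s hs hs') hg2
        have := hFU _ hθ hθ2
        refine (integral_sub_mul hF2 hU hθ2).trans ?_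
        exact sub_eq_zero.2 this
    filter_upwards [h4] with x hx
    rw [← show ∫ v, (F (x, v) - U (x, v)) * g v = 0 from hx]
    apply integral_congr_ae
    filter_upwards [hψg] with v hv
    rw [hv]
  have hFs : ∀ᵐ x, MemLp (fun v => F (x, v)) 2 volume := MemLp.slice_ae hF2
  have hUs : ∀ᵐ x, MemLp (fun v => U (x, v)) 2 volume := MemLp.slice_ae hU
  filter_upwards [ae_all_iff.2 key, hFs, hUs] with x hx hFx hUx
  have hFK : InK a ha fun v => F (x, v) :=
    inK_of_measurable (measurable_invariantProd_slice hF measurable_const) hFx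
  have hPU := inK_projFun (ha := ha) hUx
  -- Against `ψ`, both `P U(x, ·)` and `F(x, ·)` may transfer a projection to `ψ`: the first by
  -- symmetry, the second also because it lies in `K`. This leaves the pairing already known to
  -- vanish.
  have h0 := ae_eq_zero_of_integral_denseSeq
    (g := fun v => projFun a ha (fun v => U (x, v)) v - F (x, v))
    ((hPU.memLp.sub hFx).integrable (by norm_num)) fun n => ?_
  · filter_upwards [h0] with v hv
    exact sub_eq_zero.1 hv
  set ψ := TopologicalSpace.denseSeq C(T d, ℝ) n with hψ
  have hψ2 : MemLp ψ 2 volume := memLp_of_continuous ψ.continuous 2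
  have hPψ := (inK_projFun (ha := ha) hψ2).memLp
  have h5 := hx n
  rw [integral_sub_mul hFx hUx hPψ] at h5
  rw [integral_sub_mul hPU.memLp hFx hψ2, integral_projFun_mul hUx hψ2]
  have h6 : ∫ v, F (x, v) * ψ v = ∫ v, F (x, v) * projFun a ha ψ v := by
    rw [← integral_projFun_mul hFx hψ2]
    apply integral_congr_ae
    filter_upwards [hFK.projFun_ae_eq] with v hv
    rw [hv]
  rw [h6]
  linarith

/-! ### Solving the transport equation along straight lines -/

section Line

variable {H F : Type} [NormedAddCommGroup H] [NormedSpace ℝ H] [NormedAddCommGroup F]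
  [NormedSpace ℝ F]

theorem hasFDerivAt_lineIntegral {χ : H → F} (hχ : ContDiff ℝ 1 χ) (hc : HasCompactSupport χ)
    (e : H) (L : ℝ) (p : H) :
    HasFDerivAt (fun p => ∫ r in (0 : ℝ)..L, χ (p + r • e))
      (∫ r in (0 : ℝ)..L, fderiv ℝ χ (p + r • e)) p := by
  have hd : Continuous (fderiv ℝ χ) := hχ.continuous_fderiv one_ne_zero
  obtain ⟨C, hC⟩ := hd.bounded_above_of_compact_support (hc.fderiv ℝ)
  have hl : ∀ p : H, Continuous fun r : ℝ => p + r • e := fun p => by fun_prop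
  refine (intervalIntegral.hasFDerivAt_integral_of_dominated_of_fderiv_le (s := univ)
    (bound := fun _ => C) (F' := fun p r => fderiv ℝ χ (p + r • e)) univ_mem
    (Eventually.of_forall fun p => (hχ.continuous.comp (hl p)).aestronglyMeasurable)
    ((hχ.continuous.comp (hl p)).intervalIntegrable _ _)
    (hd.comp (hl p)).aestronglyMeasurable (ae_of_all _ fun r _ p _ => hC _)
    intervalIntegrable_const (ae_of_all _ fun r _ p _ => ?_))
  have h := (hχ.differentiable one_ne_zero (p + r • e)).hasFDerivAt
  exact (hasFDerivAt_comp_add_right _).2 h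

/-- The derivative of a line integral is the line integral of `fderiv ℝ χ`, which takes values in
another space; the induction must therefore range over the target space as well. -/
theorem contDiff_lineIntegral_nat (n : ℕ) : ∀ (F : Type) [NormedAddCommGroup F] [NormedSpace ℝ F]
    (χ : H → F), ContDiff ℝ ∞ χ → HasCompactSupport χ → ∀ (e : H) (L : ℝ),
    ContDiff ℝ n (fun p => ∫ r in (0 : ℝ)..L, χ (p + r • e)) := by
  induction n with
  | zero =>
    intro F _ _ χ hχ hc e L
    refine contDiff_zero.2 (continuous_iff_continuousAt.2 fun p => ?_)
    exact (hasFDerivAt_lineIntegral (hχ.of_le (by simp)) hc e L p).continuousAt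
  | succ n ih =>
    intro F _ _ χ hχ hc e L
    have h := fun p => hasFDerivAt_lineIntegral (hχ.of_le (by simp)) hc e L p
    push_cast
    rw [contDiff_succ_iff_hasFDerivAt]
    exact ⟨_, ih _ _ (hχ.fderiv_right (by simp)) (hc.fderiv ℝ) e L, h⟩

theorem contDiff_lineIntegral {χ : H → F} (hχ : ContDiff ℝ ∞ χ) (hc : HasCompactSupport χ)
    (e : H) (L : ℝ) : ContDiff ℝ ∞ (fun p => ∫ r in (0 : ℝ)..L, χ (p + r • e)) :=
  contDiff_infty.2 fun n => contDiff_lineIntegral_nat n F χ hχ hc e L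

theorem fderiv_lineIntegral_apply {χ : H → F} (hχ : ContDiff ℝ 1 χ) (hc : HasCompactSupport χ)
    [CompleteSpace F] (e : H) (L : ℝ) (p w : H) :
    fderiv ℝ (fun p => ∫ r in (0 : ℝ)..L, χ (p + r • e)) p w =
      ∫ r in (0 : ℝ)..L, fderiv ℝ χ (p + r • e) w := by
  rw [(hasFDerivAt_lineIntegral hχ hc e L p).fderiv]
  have hd : Continuous fun r : ℝ => fderiv ℝ χ (p + r • e) :=
    (hχ.continuous_fderiv one_ne_zero).comp (by fun_prop)
  exact ContinuousLinearMap.intervalIntegral_apply (hd.intervalIntegrable _ _) w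

/-- The derivative along `e` telescopes. When `p + L • e` lies outside the support of `χ`, the line
integral solves the transport equation in direction `e` with right-hand side `-χ`. -/
theorem fderiv_lineIntegral_self {χ : H → F} (hχ : ContDiff ℝ 1 χ) (hc : HasCompactSupport χ)
    [CompleteSpace F] (e : H) (L : ℝ) (p : H) :
    fderiv ℝ (fun p => ∫ r in (0 : ℝ)..L, χ (p + r • e)) p e = χ (p + L • e) - χ p := by
  rw [fderiv_lineIntegral_apply hχ hc]
  have h : ∀ r : ℝ, HasDerivAt (fun r : ℝ => χ (p + r • e)) (fderiv ℝ χ (p + r • e) e) r := by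
    intro r
    have h1 : HasDerivAt (fun r : ℝ => p + r • e) e r := by
      simpa using ((hasDerivAt_id r).smul_const e).const_add p
    exact (hχ.differentiable one_ne_zero _).hasFDerivAt.comp_hasDerivAt r h1
  rw [intervalIntegral.integral_eq_sub_of_hasDerivAt (fun r _ => h r)]
  · simp
  · have hd : Continuous fun r : ℝ => fderiv ℝ χ (p + r • e) e :=
      ((hχ.continuous_fderiv one_ne_zero).comp (by fun_prop)).clm_apply continuous_const
    exact hd.intervalIntegrable _ _

theorem lineIntegral_eq_zero {χ : H → F} {R : ℝ} (hR : ∀ p, R < ‖p‖ → χ p = 0) {e : H} {L N : ℝ}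
    (hL : 0 ≤ L) (he : ‖e‖ ≤ N) {p : H} (hp : R + L * N < ‖p‖) :
    ∫ r in (0 : ℝ)..L, χ (p + r • e) = 0 := by
  rw [intervalIntegral.integral_congr (g := fun _ => 0), intervalIntegral.integral_zero]
  intro r hr
  rw [uIcc_of_le hL] at hr
  refine hR _ ?_
  have h1 : ‖r • e‖ ≤ L * N := by
    rw [norm_smul, Real.norm_of_nonneg hr.1]
    exact mul_le_mul hr.2 he (norm_nonneg _) hL
  have h2 := norm_sub_le (p + r • e) (r • e)
  rw [add_sub_cancel_right] at h2
  linarith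

end Line

/-! ### Functionals that almost vanish on the range of a kinetic transport operator -/

/-- Bounded measurable functions of `(t, x)` and `v`, supported in `|(t, x)| ≤ R`. -/
structure Admissible (R : ℝ) (θ : ℝ × E d → T d → ℝ) : Prop where
  measurable : Measurable (Function.uncurry θ)
  bounded : ∃ B, ∀ p v, ‖θ p v‖ ≤ B
  eq_zero : ∀ p v, R < ‖p‖ → θ p v = 0

theorem Admissible.add {R : ℝ} {θ θ' : ℝ × E d → T d → ℝ} (h : Admissible R θ)
    (h' : Admissible R θ') : Admissible R (fun p v => θ p v + θ' p v) where
  measurable := h.measurable.add h'.measurable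
  bounded := by
    obtain ⟨B, hB⟩ := h.bounded
    obtain ⟨B', hB'⟩ := h'.bounded
    exact ⟨B + B', fun p v => (norm_add_le _ _).trans (add_le_add (hB p v) (hB' p v))⟩
  eq_zero p v hp := by rw [h.eq_zero p v hp, h'.eq_zero p v hp, add_zero]

theorem Admissible.zero (R : ℝ) : Admissible R (fun (_ : ℝ × E d) (_ : T d) => (0 : ℝ)) where
  measurable := measurable_const
  bounded := ⟨0, by simp⟩
  eq_zero _ _ _ := rfl

theorem Admissible.sum {κ : Type*} {R : ℝ} (s : Finset κ) {θ : κ → ℝ × E d → T d → ℝ}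
    (h : ∀ k ∈ s, Admissible R (θ k)) : Admissible R (fun p v => ∑ k ∈ s, θ k p v) := by
  classical
  induction s using Finset.induction_on with
  | empty => simpa using Admissible.zero R
  | insert k s hk ih =>
    simp only [Finset.sum_insert hk]
    exact (h k (Finset.mem_insert_self k s)).add
      (ih fun k hk => h k (Finset.mem_insert_of_mem hk))

theorem Admissible.mul {R : ℝ} {χ : ℝ × E d → ℝ} {ψ : T d → ℝ} (hχ : Measurable χ)
    (hχb : ∃ B, ∀ p, ‖χ p‖ ≤ B) (hχ0 : ∀ p, R < ‖p‖ → χ p = 0) (hψ : Measurable ψ)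
    (hψb : ∃ B, ∀ v, ‖ψ v‖ ≤ B) : Admissible R (fun p v => χ p * ψ v) where
  measurable := (hχ.comp measurable_fst).mul (hψ.comp measurable_snd)
  bounded := by
    obtain ⟨B, hB⟩ := hχb
    obtain ⟨B', hB'⟩ := hψb
    refine ⟨B * B', fun p v => ?_⟩
    rw [norm_mul]
    exact mul_le_mul (hB p) (hB' v) (norm_nonneg _) ((norm_nonneg _).trans (hB p))
  eq_zero p v hp := by rw [hχ0 p hp, zero_mul]

theorem Admissible.fderiv_mul {R : ℝ} {φ : ℝ × E d → ℝ} {ψ : T d → ℝ} {b : T d → E d}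
    (hφ : ContDiff ℝ ∞ φ) (hc : HasCompactSupport φ)
    (hb : Measurable b) {M : ℝ} (hM : ∀ v, ‖b v‖ ≤ M) (hψ : Measurable ψ)
    (hψb : ∃ B, ∀ v, ‖ψ v‖ ≤ B) (h0 : ∀ p v, R < ‖p‖ → fderiv ℝ φ p (1, b v) * ψ v = 0) :
    Admissible R (fun p v => fderiv ℝ φ p (1, b v) * ψ v) where
  measurable := by
    have hd : Continuous fun q : (ℝ × E d) × (ℝ × E d) => fderiv ℝ φ q.1 q.2 :=
      ((hφ.continuous_fderiv (by simp)).comp continuous_fst).clm_apply continuous_snd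
    refine (hd.measurable.comp (measurable_fst.prodMk
      (measurable_const.prodMk (hb.comp measurable_snd)))).mul (hψ.comp measurable_snd)
  bounded := by
    obtain ⟨B, hB⟩ := hψb
    obtain ⟨C, hC⟩ := (hφ.continuous_fderiv (by simp)).bounded_above_of_compact_support
      (hc.fderiv ℝ)
    refine ⟨C * max 1 M * B, fun p v => ?_⟩
    rw [norm_mul]
    have hC0 : 0 ≤ C := (norm_nonneg _).trans (hC p)
    refine mul_le_mul ?_ (hB v) (norm_nonneg _) (by positivity)
    refine (ContinuousLinearMap.le_opNorm _ _).trans (mul_le_mul (hC p) ?_ (norm_nonneg _) hC0)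
    rw [Prod.norm_def]
    exact max_le_max (by simp) (hM v)
  eq_zero p v hp := h0 p v hp

theorem exists_simpleFunc_near (M : ℝ) {δ : ℝ} (hδ : 0 < δ) :
    ∃ σ : SimpleFunc (E d) (E d), ∀ y, ‖y‖ ≤ M → ‖σ y - y‖ ≤ δ := by
  let e := TopologicalSpace.denseSeq (E d)
  have hcov : Metric.closedBall (0 : E d) M ⊆ ⋃ k, Metric.ball (e k) δ := fun y _ => by
    obtain ⟨k, hk⟩ := (TopologicalSpace.denseRange_denseSeq (E d)).exists_dist_lt y hδ
    exact mem_iUnion.2 ⟨k, hk⟩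
  obtain ⟨t, ht⟩ := (isCompact_closedBall (0 : E d) M).elim_finite_subcover _
    (fun k => Metric.isOpen_ball) hcov
  refine ⟨SimpleFunc.nearestPt e (t.sup id), fun y hy => ?_⟩
  obtain ⟨k, hk, hyk⟩ := mem_iUnion₂.1 (ht (show y ∈ Metric.closedBall (0 : E d) M by simpa using hy))
  have h1 := SimpleFunc.edist_nearestPt_le e y (Finset.le_sup (f := id) hk)
  rw [edist_dist, edist_dist, ENNReal.ofReal_le_ofReal_iff dist_nonneg] at h1
  rw [← dist_eq_norm]
  exact h1.trans ((dist_comm _ _).trans_le (le_of_lt hyk))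

/-- The radius depends on the bound `N` and not on the direction `y`, so one constant controls all
the pieces of a partition. Directions with `ψ = 0` need no bound, as they contribute nothing. -/
theorem admissible_lineIntegral {χ : ℝ × E d → ℝ} (hχ : ContDiff ℝ ∞ χ) (hc : HasCompactSupport χ)
    {R : ℝ} (hR : ∀ p, R < ‖p‖ → χ p = 0) {b : T d → E d} (hb : Measurable b) {M : ℝ}
    (hM : ∀ v, ‖b v‖ ≤ M) {ψ : T d → ℝ} (hψ : Measurable ψ) (hψb : ∃ B, ∀ v, ‖ψ v‖ ≤ B)
    {y : E d} {N L : ℝ} (hN : 1 ≤ N) (hL : 0 ≤ L) (hy : ∀ v, ψ v ≠ 0 → ‖y‖ ≤ N) :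
    Admissible (R + L * N) (fun p v => fderiv ℝ (fun p => ∫ r in (0 : ℝ)..L,
      χ (p + r • ((1, y) : ℝ × E d))) p (1, b v) * ψ v) := by
  have hsm := contDiff_lineIntegral hχ hc ((1, y) : ℝ × E d) L
  have hz : ∀ N', ‖((1, y) : ℝ × E d)‖ ≤ N' → ∀ p : ℝ × E d, R + L * N' < ‖p‖ →
      ∫ r in (0 : ℝ)..L, χ (p + r • ((1, y) : ℝ × E d)) = 0 :=
    fun N' hN' p hp => lineIntegral_eq_zero hR hL hN' hp
  refine Admissible.fderiv_mul hsm ?_ hb hM hψ hψb fun p v hp => ?_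
  · refine HasCompactSupport.intro (isCompact_closedBall (0 : ℝ × E d)
      (R + L * ‖((1, y) : ℝ × E d)‖)) fun p hp => hz _ le_rfl p ?_
    simpa using hp
  · by_cases hv : ψ v = 0
    · rw [hv, mul_zero]
    have hyN : ‖((1, y) : ℝ × E d)‖ ≤ N := by
      rw [Prod.norm_def]
      exact max_le (by simpa using hN) (hy v hv)
    have : (fun p => ∫ r in (0 : ℝ)..L, χ (p + r • ((1, y) : ℝ × E d))) =ᶠ[𝓝 p] fun _ => 0 := by
      filter_upwards [(isOpen_lt continuous_const continuous_norm).mem_nhds hp] with q hq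
      exact hz N hyN q hq
    rw [this.fderiv_eq]
    simp

/-- Write `(1, w) = (1, y) + (0, w - y)`. Along `(1, y)` the derivative is exactly `-χ p`, since for
`p.1 ≥ 0` and `R < L` the endpoint has left the support; the rest is linear in `w - y`. The
restriction `p.1 ≥ 0` is the reason why test functions are bounded only at nonnegative times in
`tendsto_zero_of_transport`. -/
theorem norm_sub_lineIntegral_le {χ : ℝ × E d → ℝ} (hχ : ContDiff ℝ ∞ χ)
    (hc : HasCompactSupport χ) {R G : ℝ} (hR : ∀ p, R < ‖p‖ → χ p = 0)
    (hG : ∀ p, ‖fderiv ℝ χ p‖ ≤ G) {L : ℝ} (hL : 0 ≤ L) (hRL : R < L) {p : ℝ × E d}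
    (hp : 0 ≤ p.1) (y w : E d) :
    ‖χ p + fderiv ℝ (fun p => ∫ r in (0 : ℝ)..L, χ (p + r • ((1, y) : ℝ × E d))) p (1, w)‖ ≤
      L * G * ‖y - w‖ := by
  have h1 : ((1, w) : ℝ × E d) = (1, y) + (0, w - y) := by simp
  have hχ1 : ContDiff ℝ 1 χ := hχ.of_le (by simp)
  have hG0 : 0 ≤ G := (norm_nonneg _).trans (hG p)
  have h2 : χ (p + L • ((1, y) : ℝ × E d)) = 0 := by
    refine hR _ (lt_of_lt_of_le ?_ (norm_fst_le _))
    simp only [Prod.fst_add, Prod.smul_mk, smul_eq_mul, mul_one]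
    rw [Real.norm_of_nonneg (by positivity)]
    linarith
  rw [h1, map_add, fderiv_lineIntegral_self hχ1 hc, h2, zero_sub, add_neg_cancel_left,
    fderiv_lineIntegral_apply hχ1 hc]
  have h3 : ∀ r ∈ uIoc (0 : ℝ) L, ‖fderiv ℝ χ (p + r • ((1, y) : ℝ × E d)) (0, w - y)‖ ≤
      G * ‖y - w‖ := fun r _ => by
    refine (ContinuousLinearMap.le_opNorm _ _).trans
      (mul_le_mul (hG _) ?_ (norm_nonneg _) hG0)
    rw [Prod.norm_def, norm_sub_rev y w]
    simp
  refine (intervalIntegral.norm_integral_le_of_norm_le_const h3).trans ?_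
  rw [sub_zero, abs_of_nonneg hL]
  linarith

/-- A family of functionals that is asymptotically bounded, additive and vanishing on the functions
`(∂_t φ + b · ∇_x φ) ψ` is asymptotically vanishing on the functions `χ ψ`. -/
theorem tendsto_zero_of_transport {ι : Type*} {l : Filter ι} (𝓐 : MeasurableSpace (T d))
    (h𝓐 : 𝓐 ≤ MeasurableSpace.pi)
    {b : T d → E d} (hb : Measurable[𝓐] b) {M : ℝ} (hM : ∀ v, ‖b v‖ ≤ M)
    (D : ι → (ℝ × E d → T d → ℝ) → ℝ)
    (hadd : ∀ R θ θ', Admissible R θ → Admissible R θ' →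
      ∀ᶠ i in l, D i (fun p v => θ p v + θ' p v) = D i θ + D i θ')
    (hbd : ∀ R, ∃ C : ℝ, 0 ≤ C ∧ ∀ᶠ i in l, ∀ θ B, Admissible R θ → 0 ≤ B →
      (∀ p v, 0 ≤ p.1 → ‖θ p v‖ ≤ B) → ‖D i θ‖ ≤ C * B)
    (htr : ∀ φ : ℝ × E d → ℝ, ContDiff ℝ ∞ φ → HasCompactSupport φ → ∀ ψ : T d → ℝ,
      Measurable[𝓐] ψ → (∃ B, ∀ v, ‖ψ v‖ ≤ B) →
      Tendsto (fun i => D i (fun p v => fderiv ℝ φ p (1, b v) * ψ v)) l (𝓝 0))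
    {χ : ℝ × E d → ℝ} (hχ : ContDiff ℝ ∞ χ) (hc : HasCompactSupport χ) {ψ : T d → ℝ}
    (hψ : Measurable[𝓐] ψ) (hψb : ∃ B, ∀ v, ‖ψ v‖ ≤ B) :
    Tendsto (fun i => D i (fun p v => χ p * ψ v)) l (𝓝 0) := by
  obtain ⟨B, hB⟩ := hψb
  have hB0 : 0 ≤ B := (norm_nonneg _).trans (hB 0)
  have hM0 : 0 ≤ M := (norm_nonneg _).trans (hM 0)
  obtain ⟨R, hR0, hR⟩ : ∃ R : ℝ, 0 ≤ R ∧ ∀ p, R < ‖p‖ → χ p = 0 := by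
    obtain ⟨R, hR⟩ := hc.isCompact.isBounded.subset_closedBall (0 : ℝ × E d)
    refine ⟨max R 0, le_max_right _ _, fun p hp => image_eq_zero_of_notMem_tsupport fun h => ?_⟩
    have := hR h
    rw [mem_closedBall_zero_iff] at this
    exact absurd (this.trans (le_max_left _ _)) (not_le.2 hp)
  obtain ⟨G, hG⟩ := (hχ.continuous_fderiv (by simp)).bounded_above_of_compact_support (hc.fderiv ℝ)
  obtain ⟨G', hG'⟩ := hχ.continuous.bounded_above_of_compact_support hc
  have hG0 : 0 ≤ G := (norm_nonneg _).trans (hG 0)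
  set L := R + 1
  have hL : 0 ≤ L := by positivity
  set N := M + 1
  set Φ : E d → ℝ × E d → ℝ := fun y p => ∫ r in (0 : ℝ)..L, χ (p + r • ((1, y) : ℝ × E d))
  obtain ⟨C, hC0, hC⟩ := hbd (R + L * N)
  rw [Metric.tendsto_nhds]
  intro η hη
  -- `δ` is the precision to which `b` is approximated by a simple function; `δ ≤ 1` keeps every
  -- value that is used within norm `N = M + 1`. The constant `C` is fixed beforehand, on a ball
  -- whose radius does not depend on `δ`.
  obtain ⟨δ, hδ0, hδ1, hδ⟩ : ∃ δ : ℝ, 0 < δ ∧ δ ≤ 1 ∧ C * (L * G * δ * B) < η / 2 := by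
    have h1 : Tendsto (fun δ : ℝ => C * (L * G * δ * B)) (𝓝[>] 0) (𝓝 0) := by
      have : Continuous fun δ : ℝ => C * (L * G * δ * B) := by fun_prop
      simpa using (this.tendsto 0).mono_left nhdsWithin_le_nhds
    obtain ⟨δ, h2, h3⟩ := ((h1.eventually_lt_const (half_pos hη)).and
      (Ioc_mem_nhdsGT one_pos)).exists
    exact ⟨δ, h3.1, h3.2, h2⟩
  obtain ⟨σ, hσ⟩ := exists_simpleFunc_near (d := d) M hδ0
  -- The piece of `ψ` on which the approximation of `b` takes the value `y`. It stays `𝓐`-measurable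
  -- because `b` is, so the vanishing hypothesis applies to it; the field in that hypothesis is
  -- still `b`, only the test function uses `y`.
  let ψ' : E d → T d → ℝ := fun y v => ((b ⁻¹' (σ ⁻¹' {y})).indicator ψ) v
  have hψ' : ∀ y, Measurable[𝓐] (ψ' y) := fun y =>
    Measurable.indicator hψ (hb (σ.measurableSet_fiber y))
  have hψ'B : ∀ y v, ‖ψ' y v‖ ≤ B := fun y v => (norm_indicator_le_norm_self _ _).trans (hB v)
  have hψ'y : ∀ y v, ψ' y v ≠ 0 → ‖y‖ ≤ N := fun y v h => by
    have hv : v ∈ b ⁻¹' (σ ⁻¹' {y}) := mem_of_indicator_ne_zero h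
    have hv : σ (b v) = y := hv
    have h1 := hσ (b v) (hM v)
    rw [hv] at h1
    have h2 := norm_add_le (y - b v) (b v)
    rw [sub_add_cancel] at h2
    have h3 := hM v
    simp only [N]
    linarith
  have hadm : ∀ y, Admissible (R + L * N) (fun p v => fderiv ℝ (Φ y) p (1, b v) * ψ' y v) :=
    fun y => admissible_lineIntegral hχ hc hR (hb.mono h𝓐 le_rfl) hM ((hψ' y).mono h𝓐 le_rfl) ⟨B, hψ'B y⟩
      (by simp only [N]; linarith) hL (hψ'y y)
  have hadmχ : Admissible (R + L * N) (fun p v => χ p * ψ v) :=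
    Admissible.mul hχ.continuous.measurable ⟨G', hG'⟩
      (fun p hp => hR p (lt_of_le_of_lt (le_add_of_nonneg_right (by positivity)) hp)) (hψ.mono h𝓐 le_rfl) ⟨B, hB⟩
  have hΦ : ∀ y, Tendsto (fun i => D i (fun p v => fderiv ℝ (Φ y) p (1, b v) * ψ' y v)) l
      (𝓝 0) := fun y => by
    refine htr _ (contDiff_lineIntegral hχ hc _ L) ?_ _ (hψ' y) ⟨B, hψ'B y⟩
    refine HasCompactSupport.intro (isCompact_closedBall (0 : ℝ × E d)
      (R + L * ‖((1, y) : ℝ × E d)‖)) fun p hp => lineIntegral_eq_zero hR hL le_rfl ?_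
    simpa using hp
  have hsum : ∀ s : Finset (E d), Tendsto (fun i => D i (fun p v =>
      ∑ y ∈ s, fderiv ℝ (Φ y) p (1, b v) * ψ' y v)) l (𝓝 0) := by
    classical
    intro s
    induction s using Finset.induction_on with
    | empty =>
      simp only [Finset.sum_empty]
      refine tendsto_const_nhds.congr' ?_
      filter_upwards [hC] with i hi
      have := hi _ 0 (Admissible.zero _) le_rfl (by simp)
      rw [mul_zero] at this
      exact (norm_le_zero_iff.1 this).symm
    | insert y s hy ih =>
      simp only [Finset.sum_insert hy]
      have := (hΦ y).add ih
      rw [add_zero] at this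
      refine this.congr' ?_
      filter_upwards [hadd _ _ _ (hadm y) (Admissible.sum s fun k _ => hadm k)] with i hi
      exact hi.symm
  -- At each `v` a single piece is active, the one for `y = σ (b v)`, where the line integral solves
  -- the adjoint equation up to an error proportional to `‖σ (b v) - b v‖`.
  have hdiff : ∀ p v, 0 ≤ p.1 → ‖χ p * ψ v +
      ∑ y ∈ σ.range, fderiv ℝ (Φ y) p (1, b v) * ψ' y v‖ ≤ L * G * δ * B := by
    intro p v hp
    rw [Finset.sum_eq_single (σ (b v))]
    · have h1 : ψ' (σ (b v)) v = ψ v :=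
        indicator_of_mem (s := b ⁻¹' (σ ⁻¹' {σ (b v)})) rfl ψ
      rw [h1, ← add_mul, norm_mul]
      refine mul_le_mul ?_ (hB v) (norm_nonneg _) (by positivity)
      refine (norm_sub_lineIntegral_le hχ hc hR hG hL (by simp [L]) hp _ _).trans ?_
      exact mul_le_mul_of_nonneg_left (hσ _ (hM v)) (by positivity)
    · intro y _ hy
      have : ψ' y v = 0 :=
        indicator_of_notMem (s := b ⁻¹' (σ ⁻¹' {y})) (fun h => hy (Eq.symm h)) ψ
      rw [this, mul_zero]
    · intro h
      exact absurd (σ.mem_range_self _) h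
  have hadmsum := Admissible.sum σ.range fun k _ => hadm k
  filter_upwards [hC, hadd _ _ _ hadmχ hadmsum,
    (Metric.tendsto_nhds.1 (hsum σ.range)) (η / 2) (half_pos hη)] with i h1 h2 h3
  have h4 := h1 _ (L * G * δ * B) (hadmχ.add hadmsum) (by positivity) hdiff
  rw [h2] at h4
  rw [dist_zero_right] at h3 ⊢
  have h5 := norm_sub_le (D i (fun p v => χ p * ψ v) + D i (fun p v =>
    ∑ y ∈ σ.range, fderiv ℝ (Φ y) p (1, b v) * ψ' y v)) (D i (fun p v =>
    ∑ y ∈ σ.range, fderiv ℝ (Φ y) p (1, b v) * ψ' y v))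
  rw [add_sub_cancel_right] at h5
  linarith

/-! ### Pairings with bounded families -/

section Pairing

variable {X : Type*} [MeasureSpace X]

theorem lintegral_eLpNorm_le {θ : ℝ → X → ℝ} {R B : ℝ} {A : Set X}
    (hB : ∀ t x, 0 ≤ t → ‖θ t x‖ ≤ B) (h0 : ∀ t x, R < t ∨ x ∉ A → θ t x = 0) :
    ∫⁻ t, eLpNorm (θ t) 2 volume ∂timeMeasure ≤
      ENNReal.ofReal R * volume A ^ (1 / 2 : ℝ) * ENNReal.ofReal B := by
  have h1 : ∀ t, 0 ≤ t → eLpNorm (θ t) 2 volume ≤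
      (Icc 0 R).indicator (fun _ => volume A ^ (1 / 2 : ℝ) * ENNReal.ofReal B) t := by
    intro t ht
    by_cases hR : R < t
    · have : θ t = 0 := funext fun x => h0 t x (Or.inl hR)
      simp [this]
    rw [indicator_of_mem (show t ∈ Icc 0 R from ⟨ht, not_lt.1 hR⟩)]
    calc eLpNorm (θ t) 2 volume ≤ eLpNorm (A.indicator fun _ => B) 2 volume := by
          refine eLpNorm_mono fun x => ?_
          by_cases hx : x ∈ A
          · rw [indicator_of_mem hx]
            exact (hB t x ht).trans (le_abs_self B)
          · rw [h0 t x (Or.inr hx)]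
            simp
      _ ≤ ‖B‖ₑ * volume A ^ (1 / (2 : ℝ≥0∞).toReal) := eLpNorm_indicator_const_le _ _
      _ ≤ volume A ^ (1 / 2 : ℝ) * ENNReal.ofReal B := by
          rw [mul_comm]
          rcases le_or_gt 0 B with hB0 | hB0
          · rw [Real.enorm_of_nonneg hB0]
            simp
          -- A negative `B` can bound a norm only when there are no points at all.
          · by_cases hX : IsEmpty X
            · have : A = ∅ := Set.eq_empty_of_isEmpty A
              simp [this]
            · rw [not_isEmpty_iff] at hX
              obtain ⟨x⟩ := hX
              exact absurd ((norm_nonneg _).trans (hB t x ht)) (not_le.2 hB0)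
  calc ∫⁻ t, eLpNorm (θ t) 2 volume ∂timeMeasure
      ≤ ∫⁻ t, (Icc 0 R).indicator (fun _ => volume A ^ (1 / 2 : ℝ) * ENNReal.ofReal B) t
          ∂timeMeasure := by
        refine setLIntegral_mono_ae' measurableSet_Ici (ae_of_all _ fun t ht => h1 t ht)
    _ ≤ ∫⁻ t, (Icc 0 R).indicator (fun _ => volume A ^ (1 / 2 : ℝ) * ENNReal.ofReal B) t :=
        lintegral_mono' Measure.restrict_le_self le_rfl
    _ = ENNReal.ofReal R * volume A ^ (1 / 2 : ℝ) * ENNReal.ofReal B := by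
        rw [lintegral_indicator measurableSet_Icc, setLIntegral_const, Real.volume_Icc, sub_zero]
        ring

theorem lintegral_eLpNorm_lt_top {θ : ℝ → X → ℝ} {R B : ℝ} {A : Set X}
    (hA : volume A ≠ ⊤)
    (hB : ∀ t x, 0 ≤ t → ‖θ t x‖ ≤ B) (h0 : ∀ t x, R < t ∨ x ∉ A → θ t x = 0) :
    ∫⁻ t, eLpNorm (θ t) 2 volume ∂timeMeasure < ⊤ :=
  (lintegral_eLpNorm_le hB h0).trans_lt (ENNReal.mul_lt_top
    (ENNReal.mul_lt_top (by simp) (ENNReal.rpow_lt_top_of_nonneg (by norm_num) hA)) (by simp))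

variable [SFinite (volume : Measure X)]

theorem lintegral_enorm_pairing_le {h θ : ℝ → X → ℝ}
    (hm : AEStronglyMeasurable (Function.uncurry h) (timeMeasure.prod volume))
    (hθ : AEStronglyMeasurable (Function.uncurry θ) (timeMeasure.prod volume)) {C : ℝ≥0}
    (hC : ∀ᵐ t ∂timeMeasure, eLpNorm (h t) 2 volume ≤ C) :
    ∫⁻ p, ‖h p.1 p.2 * θ p.1 p.2‖ₑ ∂(timeMeasure.prod volume) ≤
      C * ∫⁻ t, eLpNorm (θ t) 2 volume ∂timeMeasure := by
  rw [lintegral_prod (fun p : ℝ × X => ‖h p.1 p.2 * θ p.1 p.2‖ₑ) (hm.mul hθ).enorm,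
    ← lintegral_const_mul' _ _ (by simp)]
  refine lintegral_mono_ae ?_
  filter_upwards [hC, hm.prodMk_left, hθ.prodMk_left] with t h1 h2 h3
  exact (lintegral_enorm_mul_le h2 h3).trans (mul_le_mul' h1 le_rfl)

theorem integrable_pairing {h θ : ℝ → X → ℝ} (hh : MemLinftyL2 h)
    (hθ : AEStronglyMeasurable (Function.uncurry θ) (timeMeasure.prod volume))
    (hθ' : ∫⁻ t, eLpNorm (θ t) 2 volume ∂timeMeasure < ⊤) :
    Integrable (fun p : ℝ × X => h p.1 p.2 * θ p.1 p.2) (timeMeasure.prod volume) := by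
  obtain ⟨hm, C, hC⟩ := hh
  exact ⟨hm.mul hθ, (lintegral_enorm_pairing_le hm hθ hC).trans_lt
    (ENNReal.mul_lt_top (by simp) hθ')⟩

theorem enorm_integral_pairing_le {h θ : ℝ → X → ℝ}
    (hm : AEStronglyMeasurable (Function.uncurry h) (timeMeasure.prod volume))
    (hθ : AEStronglyMeasurable (Function.uncurry θ) (timeMeasure.prod volume)) {C : ℝ≥0}
    (hC : ∀ᵐ t ∂timeMeasure, eLpNorm (h t) 2 volume ≤ C) :
    ‖∫ p, h p.1 p.2 * θ p.1 p.2 ∂(timeMeasure.prod volume)‖ₑ ≤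
      C * ∫⁻ t, eLpNorm (θ t) 2 volume ∂timeMeasure :=
  (enorm_integral_le_lintegral_enorm _).trans (lintegral_enorm_pairing_le hm hθ hC)

end Pairing

theorem integral_time_prod {h : ℝ × E d → ℝ} (hi : Integrable h (timeMeasure.prod volume)) :
    ∫ t in Ici (0 : ℝ), ∫ x, h (t, x) = ∫ p, h p ∂(timeMeasure.prod volume) :=
  (integral_prod _ hi).symm

theorem integral_time_prod_torus {h : ℝ → E d × T d → ℝ}
    (hi : Integrable (Function.uncurry h) (timeMeasure.prod volume)) :
    ∫ t in Ici (0 : ℝ), ∫ x, ∫ v, h t (x, v) =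
      ∫ q, h q.1 q.2 ∂(timeMeasure.prod volume) := by
  have h1 : ∫ q, h q.1 q.2 ∂(timeMeasure.prod volume) =
      ∫ t, (∫ p, h t p) ∂timeMeasure := integral_prod _ hi
  rw [h1]
  refine integral_congr_ae ?_
  filter_upwards [hi.prod_right_ae] with t ht
  exact (integral_prod _ ht).symm

/-! ### Shear flows -/

theorem measurePreserving_shear {b : T d → E d} (hb : Measurable b) (t : ℝ) :
    MeasurePreserving (fun p : E d × T d => (p.1 + t • b p.2, p.2)) volume volume := by
  have h1 : MeasurePreserving (fun p : T d × E d => (p.1, p.2 + t • b p.1))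
      (volume.prod volume) (volume.prod volume) := by
    refine (MeasurePreserving.id volume).skew_product
      (g := fun v x => x + t • b v) (by fun_prop) (ae_of_all _ fun v => ?_)
    exact (measurePreserving_add_right volume (t • b v)).map_eq
  have h2 : MeasurePreserving (Prod.swap : E d × T d → T d × E d) (volume.prod volume)
    (volume.prod volume) := Measure.measurePreserving_swap
  have h3 : MeasurePreserving (Prod.swap : T d × E d → E d × T d) (volume.prod volume)
    (volume.prod volume) := Measure.measurePreserving_swap
  exact h3.comp (h1.comp h2)

/-- The function obtained by transporting `F` along the field `b`. -/
def shear (b : T d → E d) (F : E d × T d → ℝ) (t : ℝ) (p : E d × T d) : ℝ :=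
  F (p.1 - t • b p.2, p.2)

theorem shear_eq_comp (b : T d → E d) (F : E d × T d → ℝ) (t : ℝ) :
    shear b F t = F ∘ fun p : E d × T d => (p.1 + (-t) • b p.2, p.2) := by
  ext p
  simp [shear, sub_eq_add_neg]

theorem measurable_shear {b : T d → E d} (hb : Measurable b) {F : E d × T d → ℝ}
    (hF : Measurable F) : Measurable (Function.uncurry (shear b F)) := by
  refine hF.comp (Measurable.prodMk ?_ (by fun_prop))
  exact (measurable_fst.comp measurable_snd).sub
    (measurable_fst.smul (hb.comp (measurable_snd.comp measurable_snd)))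

theorem eLpNorm_shear {b : T d → E d} (hb : Measurable b) {F : E d × T d → ℝ}
    (hF : Measurable F) (t : ℝ) : eLpNorm (shear b F t) 2 volume = eLpNorm F 2 volume := by
  rw [shear_eq_comp]
  exact eLpNorm_comp_measurePreserving hF.aestronglyMeasurable (measurePreserving_shear hb _)

theorem memLinftyL2_shear {b : T d → E d} (hb : Measurable b) {F : E d × T d → ℝ}
    (hF : Measurable F) (hF2 : MemLp F 2 volume) : MemLinftyL2 (shear b F) := by
  refine ⟨(measurable_shear hb hF).aestronglyMeasurable, (eLpNorm F 2 volume).toNNReal,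
    ae_of_all _ fun t => ?_⟩
  rw [eLpNorm_shear hb hF, ENNReal.coe_toNNReal hF2.2.ne]

/-- At each time the shear preserves the `L²` norm, so almost every slice is square integrable. The
exceptional set is measurable in `(t, x)`, so these statements combine into one about the product
measure. -/
theorem ae_memLp_shear {b : T d → E d} (hb : Measurable b) {F : E d × T d → ℝ}
    (hF : Measurable F) (hF2 : MemLp F 2 volume) :
    ∀ᵐ p ∂(timeMeasure.prod (volume : Measure (E d))),
      MemLp (fun v => shear b F p.1 (p.2, v)) 2 volume := by
  have hm : Measurable fun q : (ℝ × E d) × T d => shear b F q.1.1 (q.1.2, q.2) :=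
    (measurable_shear hb hF).comp (f := fun q : (ℝ × E d) × T d => (q.1.1, (q.1.2, q.2)))
      (by fun_prop)
  have h1 : Measurable fun p : ℝ × E d => ∫⁻ v, ‖shear b F p.1 (p.2, v)‖ₑ ^ 2 :=
    Measurable.lintegral_prod_right' (f := fun q : (ℝ × E d) × T d =>
      ‖shear b F q.1.1 (q.1.2, q.2)‖ₑ ^ 2) (hm.enorm.pow_const 2)
  have h2 : ∀ᵐ p ∂(timeMeasure.prod (volume : Measure (E d))),
      ∫⁻ v, ‖shear b F p.1 (p.2, v)‖ₑ ^ 2 < ⊤ := by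
    refine (Measure.ae_prod_iff_ae_ae (p := fun p : ℝ × E d =>
      ∫⁻ v, ‖shear b F p.1 (p.2, v)‖ₑ ^ 2 < ⊤) (h1 measurableSet_Iio)).2 (ae_of_all _ fun t => ?_)
    have h3 : MemLp (shear b F t) 2 (volume.prod volume) :=
      ⟨((measurable_shear hb hF).comp measurable_prodMk_left).aestronglyMeasurable, by
        have := eLpNorm_shear hb hF t
        rw [Measure.volume_eq_prod] at this
        rw [this]
        exact hF2.2⟩
    filter_upwards [MemLp.slice_ae h3] with x hx
    have := hx.2
    rw [← eLpNorm_two_sq]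
    exact ENNReal.pow_lt_top this
  filter_upwards [h2] with p hp
  refine ⟨(hm.comp measurable_prodMk_left).aestronglyMeasurable, ?_⟩
  rw [← eLpNorm_two_sq] at hp
  by_contra h
  rw [not_lt_top_iff] at h
  simp [h] at hp

theorem integral_shear_mul {b : T d → E d} (hb : Measurable b) {F : E d × T d → ℝ}
    (hF : Measurable F) {g : E d × T d → ℝ} (hg : Measurable g) (t : ℝ) :
    ∫ p, shear b F t p * g p = ∫ p : E d × T d, F p * g (p.1 + t • b p.2, p.2) := by
  have hS := measurePreserving_shear hb t
  have hm : Measurable fun p => shear b F t p * g p :=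
    ((measurable_shear hb hF).comp measurable_prodMk_left).mul hg
  have h := integral_map (μ := volume) hS.measurable.aemeasurable (f := fun p => shear b F t p * g p)
    hm.aestronglyMeasurable
  rw [hS.map_eq] at h
  rw [h]
  simp [shear]

theorem Admissible.measurable_uncurry {R : ℝ} {θ : ℝ × E d → T d → ℝ} (h : Admissible R θ) :
    Measurable (Function.uncurry fun (t : ℝ) (p : E d × T d) => θ (t, p.1) p.2) :=
  h.measurable.comp (f := fun q : ℝ × (E d × T d) => ((q.1, q.2.1), q.2.2)) (by fun_prop)

theorem Admissible.lintegral_lt_top {R : ℝ} {θ : ℝ × E d → T d → ℝ} (h : Admissible R θ) :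
    ∫⁻ t, eLpNorm (fun p : E d × T d => θ (t, p.1) p.2) 2 volume ∂timeMeasure < ⊤ := by
  obtain ⟨B, hB⟩ := h.bounded
  refine lintegral_eLpNorm_lt_top (X := E d × T d) (R := R) (B := B)
    (A := Metric.closedBall 0 R ×ˢ univ) ?_ (fun t p _ => hB _ _)
    fun t p hp => h.eq_zero _ _ ?_
  · rw [Measure.volume_eq_prod, Measure.prod_prod]
    exact (ENNReal.mul_lt_top measure_closedBall_lt_top (measure_lt_top _ _)).ne
  · rw [Prod.norm_def, lt_max_iff]
    refine hp.imp (fun h => h.trans_le (le_abs_self t)) fun h => ?_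
    simpa using h

theorem Admissible.integrable_mul {R : ℝ} {θ : ℝ × E d → T d → ℝ} (h : Admissible R θ)
    {f : ℝ → E d × T d → ℝ} (hf : MemLinftyL2 f) :
    Integrable (fun q : ℝ × (E d × T d) => f q.1 q.2 * θ (q.1, q.2.1) q.2.2)
      (timeMeasure.prod volume) :=
  integrable_pairing hf (θ := fun (t : ℝ) (p : E d × T d) => θ (t, p.1) p.2)
    h.measurable_uncurry.aestronglyMeasurable h.lintegral_lt_top

theorem Admissible.exists_norm_integral_le (R : ℝ) {f : ℝ → E d × T d → ℝ} (hf : MemLinftyL2 f) :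
    ∃ C : ℝ, 0 ≤ C ∧ ∀ (θ : ℝ × E d → T d → ℝ) (B : ℝ), Admissible R θ → 0 ≤ B →
      (∀ p v, 0 ≤ p.1 → ‖θ p v‖ ≤ B) →
      ‖∫ q, f q.1 q.2 * θ (q.1, q.2.1) q.2.2 ∂(timeMeasure.prod volume)‖ ≤ C * B := by
  obtain ⟨hm, C, hC⟩ := hf
  set A : Set (E d × T d) := Metric.closedBall 0 R ×ˢ univ
  set V : ℝ≥0∞ := C * (ENNReal.ofReal R * volume A ^ (1 / 2 : ℝ))
  have hA : volume A ≠ ⊤ := by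
    rw [Measure.volume_eq_prod, Measure.prod_prod]
    exact (ENNReal.mul_lt_top measure_closedBall_lt_top (measure_lt_top _ _)).ne
  have hV : V ≠ ⊤ := ENNReal.mul_ne_top (by simp) (ENNReal.mul_ne_top (by simp)
    (ENNReal.rpow_lt_top_of_nonneg (by norm_num) hA).ne)
  refine ⟨V.toReal, ENNReal.toReal_nonneg, fun θ B hθ hB hθB => ?_⟩
  have h1 := enorm_integral_pairing_le hm (θ := fun (t : ℝ) (p : E d × T d) => θ (t, p.1) p.2)
    hθ.measurable_uncurry.aestronglyMeasurable hC
  have h2 := lintegral_eLpNorm_le (X := E d × T d) (R := R) (B := B) (A := A)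
    (θ := fun (t : ℝ) (p : E d × T d) => θ (t, p.1) p.2) (fun t p ht => hθB _ _ ht)
    fun t p hp => hθ.eq_zero _ _ (by
      rw [Prod.norm_def, lt_max_iff]
      refine hp.imp (fun h => h.trans_le (le_abs_self t)) fun h => ?_
      simpa [A] using h)
  have h3 := h1.trans (mul_le_mul' le_rfl h2)
  rw [← mul_assoc, show C * (ENNReal.ofReal R * volume A ^ (1 / 2 : ℝ)) = ENNReal.ofReal V.toReal
    from (ENNReal.ofReal_toReal hV).symm, ← ENNReal.ofReal_mul ENNReal.toReal_nonneg,
    ← ofReal_norm, ENNReal.ofReal_le_ofReal_iff (by positivity)] at h3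
  exact h3

/-- On the support `|t| ≤ R`, so the shear displaces `x` by at most `R M`. -/
theorem Admissible.comp_shear {R : ℝ} {θ : ℝ × E d → T d → ℝ} (h : Admissible R θ)
    {b : T d → E d} (hb : Measurable b) {M : ℝ} (hM : ∀ v, ‖b v‖ ≤ M) :
    Admissible (R + R * M) (fun p v => θ (p.1, p.2 + p.1 • b v) v) where
  measurable := by
    refine h.measurable.comp (f := fun q : (ℝ × E d) × T d =>
      ((q.1.1, q.1.2 + q.1.1 • b q.2), q.2)) ?_
    refine (Measurable.prodMk (by fun_prop) ?_).prodMk measurable_snd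
    exact (by fun_prop : Measurable fun q : (ℝ × E d) × T d => q.1.2).add
      ((by fun_prop : Measurable fun q : (ℝ × E d) × T d => q.1.1).smul (hb.comp measurable_snd))
  bounded := by
    obtain ⟨B, hB⟩ := h.bounded
    exact ⟨B, fun p v => hB _ _⟩
  eq_zero p v hp := by
    by_contra hne
    have h1 := not_lt.1 (mt (h.eq_zero _ v) hne)
    rw [Prod.norm_def, max_le_iff] at h1
    obtain ⟨h1, h2⟩ := h1
    dsimp only at h1 h2
    have hM0 : 0 ≤ M := (norm_nonneg _).trans (hM v)
    have hR0 : 0 ≤ R := (norm_nonneg _).trans h1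
    have h3 : ‖p.1 • b v‖ ≤ R * M := by
      rw [norm_smul]
      exact mul_le_mul h1 (hM v) (norm_nonneg _) hR0
    have h4 := norm_sub_le (p.2 + p.1 • b v) (p.1 • b v)
    rw [add_sub_cancel_right] at h4
    rw [Prod.norm_def, lt_max_iff] at hp
    have h5 : 0 ≤ R * M := by positivity
    rcases hp with hp | hp <;> linarith

theorem integral_fderiv_line {φ : ℝ × E d → ℝ} (hφ : ContDiff ℝ 1 φ) {R : ℝ}
    (hR : ∀ p, R < ‖p‖ → φ p = 0) (y w : E d) :
    ∫ t, fderiv ℝ φ (t, y + t • w) (1, w) ∂timeMeasure = -φ (0, y) := by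
  have hl : ContDiff ℝ 1 fun t : ℝ => ((t, y + t • w) : ℝ × E d) := by fun_prop
  have hd : ∀ t : ℝ, HasDerivAt (fun t : ℝ => φ (t, y + t • w))
      (fderiv ℝ φ (t, y + t • w) (1, w)) t := by
    intro t
    have h1 : HasDerivAt (fun t : ℝ => ((t, y + t • w) : ℝ × E d)) (1, w) t := by
      refine (hasDerivAt_id t).prodMk ?_
      simpa using ((hasDerivAt_id t).smul_const w).const_add y
    exact (hφ.differentiable one_ne_zero _).hasFDerivAt.comp_hasDerivAt t h1
  have hc : HasCompactSupport fun t : ℝ => φ (t, y + t • w) := by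
    refine HasCompactSupport.intro (isCompact_closedBall (0 : ℝ) R) fun t ht => hR _ ?_
    refine lt_of_lt_of_le ?_ (norm_fst_le _)
    simpa using ht
  have hC : ContDiff ℝ 1 fun t : ℝ => φ (t, y + t • w) := hφ.comp hl
  have := hc.integral_Ioi_deriv_eq hC 0
  rw [timeMeasure, integral_Ici_eq_integral_Ioi]
  rw [funext fun t => (hd t).deriv] at this
  simpa using this

/-- The transported function solves the kinetic equation. -/
theorem integral_shear_transport {b : T d → E d} (hb : Measurable b) {M : ℝ}
    (hM : ∀ v, ‖b v‖ ≤ M) {F : E d × T d → ℝ} (hF : Measurable F) (hF2 : MemLp F 2 volume)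
    {φ : ℝ × E d → T d → ℝ} (hφ : ∀ v, ContDiff ℝ 1 (fun p => φ p v)) {R : ℝ}
    (hR : ∀ p v, R < ‖p‖ → φ p v = 0)
    (hadm : Admissible R (fun p v => fderiv ℝ (fun p => φ p v) p (1, b v))) :
    ∫ q, shear b F q.1 q.2 * fderiv ℝ (fun p => φ p q.2.2) (q.1, q.2.1) (1, b q.2.2)
      ∂(timeMeasure.prod volume) = -∫ p, F p * φ (0, p.1) p.2 := by
  have hsh := hadm.comp_shear hb hM
  have hFc : MemLinftyL2 (fun _ : ℝ => F) :=
    ⟨hF2.1.comp_snd, (eLpNorm F 2 volume).toNNReal, ae_of_all _ fun t => by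
      rw [ENNReal.coe_toNNReal hF2.2.ne]⟩
  rw [integral_prod _ (hadm.integrable_mul (memLinftyL2_shear hb hF hF2))]
  -- At fixed `t` the change of variables moves the shear from `F` to the test function. After
  -- Fubini the inner time integral is that of a total derivative along `x + t b(v)`, and only the
  -- boundary term at `t = 0` survives.
  have h1 : ∀ t, ∫ p : E d × T d, shear b F t p *
      fderiv ℝ (fun q => φ q p.2) (t, p.1) (1, b p.2) =
      ∫ p : E d × T d, F p * fderiv ℝ (fun q => φ q p.2) (t, p.1 + t • b p.2) (1, b p.2) :=
    fun t => integral_shear_mul hb hF (g := fun p : E d × T d =>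
      fderiv ℝ (fun q => φ q p.2) (t, p.1) (1, b p.2))
      (hadm.measurable_uncurry.comp measurable_prodMk_left) t
  refine (integral_congr_ae (ae_of_all _ h1)).trans ?_
  rw [integral_integral_swap (hsh.integrable_mul hFc), ← integral_neg]
  congr 1 with p
  rw [integral_const_mul, integral_fderiv_line (hφ p.2) (fun q hq => hR q p.2 hq), mul_neg]

/-! ### Kinetic test functions -/

theorem deriv_add_fderiv_apply {Ψ : ℝ × E d → ℝ} {t : ℝ} {x : E d}
    (h : DifferentiableAt ℝ Ψ (t, x)) (w : E d) :
    deriv (fun s => Ψ (s, x)) t + fderiv ℝ (fun y => Ψ (t, y)) x w = fderiv ℝ Ψ (t, x) (1, w) := by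
  have h1 : HasDerivAt (fun s => Ψ (s, x)) (fderiv ℝ Ψ (t, x) (1, 0)) t :=
    h.hasFDerivAt.comp_hasDerivAt t ((hasDerivAt_id t).prodMk (hasDerivAt_const t x))
  have h2 : HasFDerivAt (fun y => Ψ (t, y))
      ((fderiv ℝ Ψ (t, x)).comp (ContinuousLinearMap.inr ℝ ℝ (E d))) x :=
    h.hasFDerivAt.comp x (hasFDerivAt_prodMk_right t x)
  rw [h1.deriv, h2.fderiv, ContinuousLinearMap.comp_apply, ContinuousLinearMap.inr_apply,
    ← map_add]
  simp

/-- Smooth compactly supported functions on `ℝ × ℝ^d × 𝕋^d`. -/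
structure KineticTest (φ : ℝ → E d → T d → ℝ) : Prop where
  contDiff : ContDiff ℝ ∞ (fun p : ℝ × E d × E d => φ p.1 p.2.1 (proj p.2.2))
  hasCompactSupport : HasCompactSupport (fun p : ℝ × E d × T d => φ p.1 p.2.1 p.2.2)

namespace KineticTest

variable {φ : ℝ → E d → T d → ℝ}

theorem contDiff_slice (h : KineticTest φ) (v : T d) :
    ContDiff ℝ ∞ (fun p : ℝ × E d => φ p.1 p.2 v) := by
  obtain ⟨z, rfl⟩ := proj_surjective v
  exact h.contDiff.comp (f := fun p : ℝ × E d => (p.1, p.2, z)) (by fun_prop)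

theorem contDiff_assoc (h : KineticTest φ) :
    ContDiff ℝ ∞ (fun q : (ℝ × E d) × E d => φ q.1.1 q.1.2 (proj q.2)) :=
  h.contDiff.comp (f := fun q : (ℝ × E d) × E d => (q.1.1, q.1.2, q.2)) (by fun_prop)

theorem continuous (h : KineticTest φ) :
    Continuous (fun q : (ℝ × E d) × T d => φ q.1.1 q.1.2 q.2) := by
  have hq : IsOpenQuotientMap (Prod.map id proj : (ℝ × E d) × E d → (ℝ × E d) × T d) :=
    IsOpenQuotientMap.id.prodMap isOpenQuotientMap_proj
  exact hq.isQuotientMap.continuous_iff.2 h.contDiff_assoc.continuous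

/-- The direction is kept as an independent variable so that inserting the merely measurable `b v`
gives a jointly measurable function. -/
theorem continuous_fderiv (h : KineticTest φ) :
    Continuous (fun q : ((ℝ × E d) × E d) × T d =>
      fderiv ℝ (fun p : ℝ × E d => φ p.1 p.2 q.2) q.1.1 (1, q.1.2)) := by
  have hq : IsOpenQuotientMap
      (Prod.map id proj : ((ℝ × E d) × E d) × E d → ((ℝ × E d) × E d) × T d) :=
    IsOpenQuotientMap.id.prodMap isOpenQuotientMap_proj
  refine hq.isQuotientMap.continuous_iff.2 ?_
  have key : ∀ (p : ℝ × E d) (z : E d) (w : ℝ × E d),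
      fderiv ℝ (fun p : ℝ × E d => φ p.1 p.2 (proj z)) p w =
      fderiv ℝ (fun q : (ℝ × E d) × E d => φ q.1.1 q.1.2 (proj q.2)) (p, z) (w, 0) := by
    intro p z w
    have h0 : HasFDerivAt (fun p : ℝ × E d => (p, z))
      (ContinuousLinearMap.inl ℝ (ℝ × E d) (E d)) p := hasFDerivAt_prodMk_left p z
    have h1 := (h.contDiff_assoc.differentiable (by simp) (p, z)).hasFDerivAt.comp p h0
    have h2 : (fun p : ℝ × E d => φ p.1 p.2 (proj z)) =
      (fun q : (ℝ × E d) × E d => φ q.1.1 q.1.2 (proj q.2)) ∘ fun p => (p, z) := rfl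
    rw [h2, h1.fderiv, ContinuousLinearMap.comp_apply, ContinuousLinearMap.inl_apply]
  have h3 : (fun q : ((ℝ × E d) × E d) × T d =>
      fderiv ℝ (fun p : ℝ × E d => φ p.1 p.2 q.2) q.1.1 (1, q.1.2)) ∘ Prod.map id proj =
      fun q : ((ℝ × E d) × E d) × E d => fderiv ℝ (fun q : (ℝ × E d) × E d =>
        φ q.1.1 q.1.2 (proj q.2)) (q.1.1, q.2) ((1, q.1.2), 0) := by
    funext q
    exact key _ _ _
  rw [h3]
  exact ((h.contDiff_assoc.continuous_fderiv (by simp)).comp (by fun_prop)).clm_apply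
    (by fun_prop)

theorem exists_radius (h : KineticTest φ) :
    ∃ R : ℝ, ∀ (p : ℝ × E d) v, R < ‖p‖ → φ p.1 p.2 v = 0 := by
  obtain ⟨R, hR⟩ := h.hasCompactSupport.isCompact.isBounded.subset_closedBall 0
  refine ⟨R, fun p v hp => ?_⟩
  refine image_eq_zero_of_notMem_tsupport (f := fun p : ℝ × E d × T d => φ p.1 p.2.1 p.2.2)
    (x := (p.1, p.2, v)) fun hmem => ?_
  have h1 := hR hmem
  rw [mem_closedBall_zero_iff] at h1
  simp only [Prod.norm_def, max_le_iff, lt_max_iff] at h1 hp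
  rcases hp with hp | hp <;> linarith [h1.1, h1.2.1]

theorem fderiv_eq_zero {R : ℝ} (hR : ∀ (p : ℝ × E d) v, R < ‖p‖ → φ p.1 p.2 v = 0)
    {p : ℝ × E d} (hp : R < ‖p‖) (v : T d) :
    fderiv ℝ (fun p : ℝ × E d => φ p.1 p.2 v) p = 0 := by
  have : (fun p : ℝ × E d => φ p.1 p.2 v) =ᶠ[𝓝 p] fun _ => 0 := by
    filter_upwards [(isOpen_lt continuous_const continuous_norm).mem_nhds hp] with q hq
    exact hR q v hq
  rw [this.fderiv_eq]
  simp

theorem admissible (h : KineticTest φ) {b : T d → E d} (hb : Measurable b) {M : ℝ}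
    (hM : ∀ v, ‖b v‖ ≤ M) {R : ℝ} (hR : ∀ (p : ℝ × E d) v, R < ‖p‖ → φ p.1 p.2 v = 0) :
    Admissible R (fun p v => fderiv ℝ (fun p : ℝ × E d => φ p.1 p.2 v) p (1, b v)) where
  measurable := h.continuous_fderiv.measurable.comp
    (f := fun q : (ℝ × E d) × T d => ((q.1, b q.2), q.2))
    ((measurable_fst.prodMk (hb.comp measurable_snd)).prodMk measurable_snd)
  bounded := by
    obtain ⟨C, hC⟩ := (((isCompact_closedBall (0 : ℝ × E d) R).prod
      (isCompact_closedBall (0 : E d) M)).prod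
      (isCompact_univ (X := T d))).exists_bound_of_continuousOn h.continuous_fderiv.continuousOn
    refine ⟨max C 0, fun p v => ?_⟩
    by_cases hp : R < ‖p‖
    · rw [fderiv_eq_zero hR hp]
      simp
    · refine (hC ((p, b v), v) ⟨⟨?_, ?_⟩, mem_univ _⟩).trans (le_max_left _ _)
      · simpa using hp
      · simpa using hM v
  eq_zero p v hp := by rw [fderiv_eq_zero hR hp]; simp

/-- The weak formulation of the kinetic equation as an integral over the product space. -/
theorem integral_eq (h : KineticTest φ) {b : T d → E d} (hb : Measurable b) {M : ℝ}
    (hM : ∀ v, ‖b v‖ ≤ M) {b' : T d → E d} (hbb : b' =ᵐ[volume] b) {f : ℝ → E d × T d → ℝ}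
    (hf : MemLinftyL2 f) :
    ∫ t in Ici (0 : ℝ), ∫ x, ∫ v, f t (x, v) *
      (deriv (fun s => φ s x v) t + fderiv ℝ (fun y => φ t y v) x (b' v)) =
    ∫ q, f q.1 q.2 * fderiv ℝ (fun p : ℝ × E d => φ p.1 p.2 q.2.2) (q.1, q.2.1) (1, b q.2.2)
      ∂(timeMeasure.prod volume) := by
  obtain ⟨R, hR⟩ := h.exists_radius
  rw [← integral_time_prod_torus (h := fun t p => f t p *
    fderiv ℝ (fun q : ℝ × E d => φ q.1 q.2 p.2) (t, p.1) (1, b p.2))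
    ((h.admissible hb hM hR).integrable_mul hf)]
  congr 1 with t
  congr 1 with x
  refine integral_congr_ae ?_
  filter_upwards [hbb] with v hv
  rw [hv]
  rw [← deriv_add_fderiv_apply (Ψ := fun q : ℝ × E d => φ q.1 q.2 v)
    ((h.contDiff_slice v).differentiable (by simp) _)]

end KineticTest

/-! ### Existence and uniqueness for the kinetic equation -/

theorem isKineticSolution_shear {b : T d → E d} (hb : Measurable b) {M : ℝ}
    (hM : ∀ v, ‖b v‖ ≤ M) {b' : T d → E d} (hbb : b' =ᵐ[volume] b) {F : E d × T d → ℝ}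
    (hF : Measurable F) (hF2 : MemLp F 2 volume) {f₀ : E d → T d → ℝ}
    (hf₀ : ∀ᵐ x, f₀ x =ᵐ[volume] fun v => F (x, v)) :
    IsKineticSolution b' f₀ (shear b F) := by
  refine ⟨memLinftyL2_shear hb hF hF2, fun φ hφ hφc => ?_⟩
  have h : KineticTest φ := ⟨hφ, hφc⟩
  obtain ⟨R, hR⟩ := h.exists_radius
  rw [h.integral_eq hb hM hbb (memLinftyL2_shear hb hF hF2)]
  rw [integral_shear_transport hb hM hF hF2 (φ := fun p v => φ p.1 p.2 v)
    (fun v => (h.contDiff_slice v).of_le (by simp)) hR (h.admissible hb hM hR)]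
  have h1 : ∫ x, ∫ v, f₀ x v * φ 0 x v = ∫ x, ∫ v, F (x, v) * φ 0 x v := by
    refine integral_congr_ae ?_
    filter_upwards [hf₀] with x hx
    refine integral_congr_ae ?_
    filter_upwards [hx] with v hv
    rw [hv]
  have h2 : MemLp (fun p : E d × T d => φ 0 p.1 p.2) 2 (volume.prod volume) := by
    have hc : Continuous fun p : E d × T d => φ 0 p.1 p.2 :=
      h.continuous.comp (f := fun p : E d × T d => ((0, p.1), p.2)) (by fun_prop)
    refine hc.memLp_of_hasCompactSupport (HasCompactSupport.intro
      ((isCompact_closedBall (0 : E d) R).prod isCompact_univ) fun p hp => ?_)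
    refine hR (0, p.1) p.2 ?_
    rw [Prod.norm_def]
    simpa using hp
  have h3 : ∫ p : E d × T d, F p * φ 0 p.1 p.2 = ∫ x, ∫ v, F (x, v) * φ 0 x v :=
    integral_prod _ (MemLp.integrable_mul hF2 h2)
  rw [h1, ← h3]
  exact neg_add_cancel _

theorem measurable_shear_slice {a : T d → E d} {ha : ContDiff ℝ 1 (fun y : E d => a (proj y))}
    {hdiv : ∀ v, torusDiv a v = 0} {b : T d → E d} (hb : Measurable[invariantAlgebra a ha hdiv] b)
    {F : E d × T d → ℝ} (hF : Measurable[invariantProd a ha hdiv] F) (t : ℝ) (x : E d) :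
    Measurable[invariantAlgebra a ha hdiv] fun v => shear b F t (x, v) :=
  measurable_invariantProd_slice hF (X := fun v => x - t • b v)
    (Measurable.const_sub (Measurable.const_smul hb t) x)

theorem inK_shear {a : T d → E d} {ha : ContDiff ℝ 1 (fun y : E d => a (proj y))}
    {hdiv : ∀ v, torusDiv a v = 0} {b : T d → E d} (hb : Measurable[invariantAlgebra a ha hdiv] b)
    {F : E d × T d → ℝ} (hF : Measurable[invariantProd a ha hdiv] F) (hF2 : MemLp F 2 volume) :
    ∀ᵐ p ∂(timeMeasure.prod (volume : Measure (E d))),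
      InK a ha (fun v => shear b F p.1 (p.2, v)) := by
  filter_upwards [ae_memLp_shear (hb.mono invariantAlgebra_le le_rfl)
    (hF.mono invariantProd_le le_rfl) hF2] with p hp
  exact inK_of_measurable (measurable_shear_slice hb hF p.1 p.2) hp

theorem kineticTest_mul {φ : ℝ × E d → ℝ} (hφ : ContDiff ℝ ∞ φ) (hc : HasCompactSupport φ)
    {ψ : T d → ℝ} (hψ : SmoothTorus ψ) : KineticTest fun t x v => φ (t, x) * ψ v where
  contDiff := (hφ.comp (g := φ) (f := fun p : ℝ × E d × E d => (p.1, p.2.1)) (by fun_prop)).mul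
    (ContDiff.comp (g := fun y => ψ (proj y)) hψ
      (by fun_prop : ContDiff ℝ ∞ fun p : ℝ × E d × E d => p.2.2))
  hasCompactSupport := by
    have hcl : IsClosed {p : ℝ × E d × T d | (p.1, p.2.1) ∈ tsupport φ} :=
      (isClosed_tsupport φ).preimage (by fun_prop)
    obtain ⟨R, hR⟩ := hc.isCompact.isBounded.subset_closedBall 0
    refine HasCompactSupport.intro ((isCompact_closedBall (0 : ℝ) R).prod
      ((isCompact_closedBall (0 : E d) R).prod (isCompact_univ (X := T d)))) fun p hp => ?_
    have : φ (p.1, p.2.1) = 0 := image_eq_zero_of_notMem_tsupport fun h => hp ?_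
    · simp only [this, zero_mul]
    · have h1 := hR h
      rw [mem_closedBall_zero_iff, Prod.norm_def, max_le_iff] at h1
      exact ⟨by simpa using h1.1, by simpa using h1.2, mem_univ _⟩

theorem MemLinftyL2.sub {X : Type*} [MeasureSpace X] [SFinite (volume : Measure X)]
    {f g : ℝ → X → ℝ} (hf : MemLinftyL2 f) (hg : MemLinftyL2 g) :
    MemLinftyL2 (fun t x => f t x - g t x) := by
  obtain ⟨hfm, C, hC⟩ := hf
  obtain ⟨hgm, C', hC'⟩ := hg
  refine ⟨hfm.sub hgm, C + C', ?_⟩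
  filter_upwards [hC, hC', hfm.prodMk_left, hgm.prodMk_left] with t h1 h2 h3 h4
  push_cast
  exact (eLpNorm_sub_le h3 h4 (by norm_num)).trans (add_le_add h1 h2)

theorem integral_prod_assoc_eq {h : ℝ → E d × T d → ℝ}
    (hi : Integrable (Function.uncurry h) (timeMeasure.prod volume)) :
    Integrable (fun q : (ℝ × E d) × T d => h q.1.1 (q.1.2, q.2))
      ((timeMeasure.prod volume).prod volume) ∧
    ∫ q : (ℝ × E d) × T d, h q.1.1 (q.1.2, q.2) ∂((timeMeasure.prod volume).prod volume) =
      ∫ q, h q.1 q.2 ∂(timeMeasure.prod volume) := by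
  have hmp : MeasurePreserving (MeasurableEquiv.prodAssoc : (ℝ × E d) × T d ≃ᵐ ℝ × E d × T d)
      ((timeMeasure.prod volume).prod volume) (timeMeasure.prod (volume.prod volume)) :=
    measurePreserving_prodAssoc _ _ _
  exact ⟨hmp.integrable_comp_of_integrable hi, hmp.integral_comp' (Function.uncurry h)⟩

theorem admissible_fderiv_mul {b : T d → E d} (hb : Measurable b) {M : ℝ}
    (hM : ∀ v, ‖b v‖ ≤ M) {φ : ℝ × E d → ℝ} (hφ : ContDiff ℝ ∞ φ) (hc : HasCompactSupport φ)
    {ψ : T d → ℝ} (hψ : Measurable ψ) (hψb : ∃ B, ∀ v, ‖ψ v‖ ≤ B) :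
    ∃ R, Admissible R (fun p v => fderiv ℝ φ p (1, b v) * ψ v) := by
  obtain ⟨R, hR⟩ := hc.isCompact.isBounded.subset_closedBall 0
  refine ⟨R, Admissible.fderiv_mul hφ hc hb hM hψ hψb fun p v hp => ?_⟩
  have : fderiv ℝ φ p = 0 := image_eq_zero_of_notMem_tsupport fun hmem => by
    have := hR (tsupport_fderiv_subset ℝ hmem)
    rw [mem_closedBall_zero_iff] at this
    linarith
  simp [this]

theorem SmoothTorus.exists_bound {ψ : T d → ℝ} (hψ : SmoothTorus ψ) : ∃ B, ∀ v, ‖ψ v‖ ≤ B := by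
  obtain ⟨C, -, hC⟩ := exists_bound_of_continuous hψ.continuous
  exact ⟨C, hC⟩

/-- Uniqueness in linear form, `w` being the difference of two solutions. Only tensor test functions
are needed, and `v` is a mere parameter of the equation. -/
theorem ae_eq_zero_of_kinetic {b : T d → E d} (hb : Measurable b) {M : ℝ}
    (hM : ∀ v, ‖b v‖ ≤ M) {w : ℝ → E d × T d → ℝ} (hw : MemLinftyL2 w)
    (h : ∀ φ : ℝ × E d → ℝ, ContDiff ℝ ∞ φ → HasCompactSupport φ → ∀ ψ : T d → ℝ,
      SmoothTorus ψ → ∫ q, w q.1 q.2 * (fderiv ℝ φ (q.1, q.2.1) (1, b q.2.2) * ψ q.2.2)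
        ∂(timeMeasure.prod volume) = 0) :
    Function.uncurry w =ᵐ[timeMeasure.prod volume] 0 := by
  have htr : ∀ φ : ℝ × E d → ℝ, ContDiff ℝ ∞ φ → HasCompactSupport φ → ∀ ψ : T d → ℝ,
      Measurable ψ → (∃ B, ∀ v, ‖ψ v‖ ≤ B) →
      ∫ q, w q.1 q.2 * (fderiv ℝ φ (q.1, q.2.1) (1, b q.2.2) * ψ q.2.2)
        ∂(timeMeasure.prod volume) = 0 := by
    intro φ hφ hc ψ hψ hψb
    have hI : ∀ {ψ : T d → ℝ}, Measurable ψ → (∃ B, ∀ v, ‖ψ v‖ ≤ B) →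
        ∫ q, w q.1 q.2 * (fderiv ℝ φ (q.1, q.2.1) (1, b q.2.2) * ψ q.2.2)
          ∂(timeMeasure.prod volume) =
        ∫ v, (∫ p : ℝ × E d, w p.1 (p.2, v) * fderiv ℝ φ p (1, b v)
          ∂(timeMeasure.prod volume)) * ψ v := by
      intro ψ hψ hψb
      obtain ⟨R, hR⟩ := admissible_fderiv_mul hb hM hφ hc hψ hψb
      obtain ⟨h1, h2⟩ := integral_prod_assoc_eq (h := fun t p => w t p *
        (fderiv ℝ φ (t, p.1) (1, b p.2) * ψ p.2)) (hR.integrable_mul hw)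
      rw [← h2, integral_prod_symm _ h1]
      congr 1 with v
      rw [← integral_mul_const]
      congr 1 with p
      ring
    -- For fixed `φ` the equation says that this integrable function of `v` is orthogonal to smooth
    -- `ψ`. It is therefore zero, and the equation extends to bounded measurable `ψ`, as the
    -- partition by values of `b` requires.
    have hWi : Integrable (fun v => ∫ p : ℝ × E d, w p.1 (p.2, v) * fderiv ℝ φ p (1, b v)
        ∂(timeMeasure.prod volume)) volume := by
      obtain ⟨R, hR⟩ := admissible_fderiv_mul hb hM hφ hc (ψ := fun _ => 1) measurable_const ⟨1, by simp⟩
      obtain ⟨h1, -⟩ := integral_prod_assoc_eq (h := fun t p => w t p *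
        (fderiv ℝ φ (t, p.1) (1, b p.2) * 1)) (hR.integrable_mul hw)
      simpa using h1.integral_prod_right
    have hW0 := ae_eq_zero_of_integral_smooth_of_integrable hWi fun ψ hψ => by
      obtain ⟨C, -, hC⟩ := exists_bound_of_continuous hψ.continuous
      rw [← hI hψ.continuous.measurable ⟨C, hC⟩]
      exact h φ hφ hc ψ hψ
    rw [hI hψ hψb]
    refine (integral_congr_ae ?_).trans (integral_zero _ _)
    filter_upwards [hW0] with v hv
    rw [hv, Pi.zero_apply, zero_mul]
  have hχ : ∀ χ : ℝ × E d → ℝ, ContDiff ℝ ∞ χ → HasCompactSupport χ → ∀ ψ : T d → ℝ,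
      Measurable ψ → (∃ B, ∀ v, ‖ψ v‖ ≤ B) →
      ∫ q, w q.1 q.2 * (χ (q.1, q.2.1) * ψ q.2.2) ∂(timeMeasure.prod volume) = 0 := by
    intro χ hχ hc ψ hψ hψb
    -- The functional does not depend on the index, so the limit zero is its value. The `σ`-algebra
    -- is the full Borel one: no invariance plays a role in uniqueness.
    have := tendsto_zero_of_transport (l := (atTop : Filter ℕ)) MeasurableSpace.pi le_rfl hb hM
      (fun _ θ => ∫ q, w q.1 q.2 * θ (q.1, q.2.1) q.2.2 ∂(timeMeasure.prod volume)) ?_ ?_ ?_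
      hχ hc hψ hψb
    · exact tendsto_nhds_unique tendsto_const_nhds this
    · intro R θ θ' h1 h2
      refine Eventually.of_forall fun _ => ?_
      simp only [mul_add]
      exact integral_add (h1.integrable_mul hw) (h2.integrable_mul hw)
    · intro R
      obtain ⟨C, hC0, hC⟩ := Admissible.exists_norm_integral_le R hw
      exact ⟨C, hC0, Eventually.of_forall fun _ => hC⟩
    · intro φ hφ hφc ψ hψ hψb
      simp only [htr φ hφ hφc ψ hψ hψb]
      exact tendsto_const_nhds
  have hind : ∀ (k : Set (ℝ × E d)), IsCompact k → ∀ ψ : C(T d, ℝ),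
      Integrable (fun q : (ℝ × E d) × T d => w q.1.1 (q.1.2, q.2) *
        (k.indicator 1 q.1 * ψ q.2)) ((timeMeasure.prod volume).prod volume) := by
    intro k hk ψ
    obtain ⟨R, hR⟩ := hk.isBounded.subset_closedBall 0
    have : Admissible R fun (p : ℝ × E d) v => k.indicator 1 p * ψ v :=
      Admissible.mul (measurable_const.indicator hk.measurableSet)
        ⟨1, fun p => (norm_indicator_le_norm_self _ _).trans (by simp)⟩
        (fun p hp => indicator_of_notMem (fun hmem => by
          have := hR hmem
          rw [mem_closedBall_zero_iff] at this
          linarith) _) ψ.continuous.measurable ⟨‖ψ‖, ψ.norm_coe_le_norm⟩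
    exact (integral_prod_assoc_eq (h := fun t p => w t p *
      (k.indicator 1 (t, p.1) * ψ p.2)) (this.integrable_mul hw)).1
  have hV : ∀ n, ∀ᵐ p ∂(timeMeasure.prod (volume : Measure (E d))),
      ∫ v, w p.1 (p.2, v) * TopologicalSpace.denseSeq C(T d, ℝ) n v = 0 := by
    intro n
    set ψ := TopologicalSpace.denseSeq C(T d, ℝ) n
    refine ae_eq_zero_of_integral_contDiff_smul_eq_zero
      (f := fun p : ℝ × E d => ∫ v, w p.1 (p.2, v) * ψ v) ?_ fun χ hχs hχc => ?_
    · refine locallyIntegrable_iff.2 fun k hk => ?_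
      rw [← integrable_indicator_iff hk.measurableSet]
      refine (hind k hk ψ).integral_prod_left.congr (ae_of_all _ fun p => ?_)
      by_cases hp : p ∈ k <;> simp [hp]
    · have h1 := hχ χ hχs hχc ψ ψ.continuous.measurable ⟨‖ψ‖, ψ.norm_coe_le_norm⟩
      obtain ⟨R, hR⟩ := hχc.isCompact.isBounded.subset_closedBall 0
      obtain ⟨B, hB⟩ := hχs.continuous.bounded_above_of_compact_support hχc
      have hadm : Admissible R fun (p : ℝ × E d) v => χ p * ψ v :=
        Admissible.mul hχs.continuous.measurable ⟨B, hB⟩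
          (fun p hp => image_eq_zero_of_notMem_tsupport fun hmem => by
            have := hR hmem
            rw [mem_closedBall_zero_iff] at this
            linarith) ψ.continuous.measurable ⟨‖ψ‖, ψ.norm_coe_le_norm⟩
      obtain ⟨h2, h3⟩ := integral_prod_assoc_eq (h := fun t p => w t p *
        (χ (t, p.1) * ψ p.2)) (hadm.integrable_mul hw)
      rw [← h3, integral_prod _ h2] at h1
      rw [← h1]
      congr 1 with p
      rw [smul_eq_mul, ← integral_const_mul]
      congr 1 with v
      ring
  have hint : ∀ᵐ p ∂(timeMeasure.prod (volume : Measure (E d))), ∀ n : ℕ,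
      Integrable (fun v => w p.1 (p.2, v) *
        ((Metric.closedBall (0 : ℝ × E d) n).indicator 1 p * (1 : C(T d, ℝ)) v)) volume :=
    ae_all_iff.2 fun n => (hind _ (isCompact_closedBall _ _) 1).prod_right_ae
  have hslice : ∀ᵐ p ∂(timeMeasure.prod (volume : Measure (E d))),
      (fun v => w p.1 (p.2, v)) =ᵐ[volume] 0 := by
    filter_upwards [ae_all_iff.2 hV, hint] with p h1 h2
    obtain ⟨n, hn⟩ := exists_nat_ge ‖p‖
    have h3 := h2 n
    rw [indicator_of_mem (by simpa using hn)] at h3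
    exact ae_eq_zero_of_integral_denseSeq (by simpa using h3) h1
  have hmp : MeasurePreserving (MeasurableEquiv.prodAssoc : (ℝ × E d) × T d ≃ᵐ ℝ × E d × T d)
      ((timeMeasure.prod volume).prod volume) (timeMeasure.prod (volume.prod volume)) :=
    measurePreserving_prodAssoc _ _ _
  have h1 : ∫⁻ q, ‖Function.uncurry w q‖ₑ ∂(timeMeasure.prod (volume.prod volume)) = 0 := by
    rw [← hmp.lintegral_comp_emb MeasurableEquiv.prodAssoc.measurableEmbedding,
      lintegral_prod (fun q => ‖Function.uncurry w (MeasurableEquiv.prodAssoc q)‖ₑ)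
        (hw.1.comp_measurePreserving hmp).enorm]
    refine (lintegral_congr_ae ?_).trans lintegral_zero
    filter_upwards [hslice] with p hp
    refine (lintegral_congr_ae ?_).trans lintegral_zero
    filter_upwards [hp] with v hv
    change ‖w p.1 (p.2, v)‖ₑ = 0
    simp [hv]
  have h2 := (lintegral_eq_zero_iff' (AEStronglyMeasurable.enorm hw.1)).1 h1
  filter_upwards [h2] with q hq
  simpa using hq

theorem fderiv_mul_slice {φ : ℝ × E d → ℝ} (hφ : ContDiff ℝ ∞ φ) (c : ℝ) (p w : ℝ × E d) :
    fderiv ℝ (fun p : ℝ × E d => φ (p.1, p.2) * c) p w = fderiv ℝ φ p w * c := by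
  have h := (hφ.differentiable (by simp) p).hasFDerivAt.mul_const c
  rw [show (fun p : ℝ × E d => φ (p.1, p.2) * c) = fun p => φ p * c from rfl, h.fderiv]
  simp [mul_comm]

theorem IsKineticSolution.integral_eq {b : T d → E d} (hb : Measurable b) {M : ℝ}
    (hM : ∀ v, ‖b v‖ ≤ M) {b' : T d → E d} (hbb : b' =ᵐ[volume] b) {f₀ : E d → T d → ℝ}
    {f : ℝ → E d × T d → ℝ} (hf : IsKineticSolution b' f₀ f) {φ : ℝ × E d → ℝ}
    (hφ : ContDiff ℝ ∞ φ) (hc : HasCompactSupport φ) {ψ : T d → ℝ} (hψ : SmoothTorus ψ) :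
    ∫ q, f q.1 q.2 * (fderiv ℝ φ (q.1, q.2.1) (1, b q.2.2) * ψ q.2.2)
        ∂(timeMeasure.prod volume) = -∫ x, ∫ v, f₀ x v * (φ (0, x) * ψ v) := by
  have hk := kineticTest_mul hφ hc hψ
  have h1 := hf.2 (fun t x v => φ (t, x) * ψ v) hk.contDiff hk.hasCompactSupport
  rw [hk.integral_eq hb hM hbb hf.1] at h1
  simp only [fderiv_mul_slice hφ] at h1
  linarith

theorem IsKineticSolution.ae_eq {b : T d → E d} (hb : Measurable b) {M : ℝ}
    (hM : ∀ v, ‖b v‖ ≤ M) {b' : T d → E d} (hbb : b' =ᵐ[volume] b) {f₀ : E d → T d → ℝ}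
    {f g : ℝ → E d × T d → ℝ} (hf : IsKineticSolution b' f₀ f) (hg : IsKineticSolution b' f₀ g) :
    Function.uncurry g =ᵐ[timeMeasure.prod volume] Function.uncurry f := by
  have h0 : Function.uncurry (fun t x => g t x - f t x) =ᵐ[timeMeasure.prod volume] 0 := by
    refine ae_eq_zero_of_kinetic hb hM (hg.1.sub hf.1) fun φ hφ hc ψ hψ => ?_
    obtain ⟨R, hadm⟩ := admissible_fderiv_mul hb hM hφ hc hψ.continuous.measurable hψ.exists_bound
    simp only [sub_mul]
    rw [integral_sub (hadm.integrable_mul hg.1) (hadm.integrable_mul hf.1),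
      hg.integral_eq hb hM hbb hφ hc hψ, hf.integral_eq hb hM hbb hφ hc hψ, sub_self]
  filter_upwards [h0] with q hq
  exact sub_eq_zero.1 hq

/-! ### Pairings with oscillating functions -/

/-- The constant in the comparison of `L²` norms of oscillating functions on balls. -/
def oscConst (d : ℕ) (R : ℝ) : ℝ≥0∞ :=
  volume (Metric.closedBall (0 : E d) (R + (d + 1))) ^ (1 / 2 : ℝ)

theorem oscConst_ne_top (R : ℝ) : oscConst d R ≠ ⊤ :=
  (ENNReal.rpow_lt_top_of_nonneg (by norm_num) measure_closedBall_lt_top.ne).ne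

/-- The constant does not depend on `ε`, and `h` need only be measurable. This is what admits
discontinuous invariant functions in the fast variable. -/
theorem eLpNorm_mul_osc_le {R B : ℝ} {ε : ℝ} (hε : ε ∈ Ioc (0 : ℝ) 1) {g : E d → ℝ}
    (hgB : ∀ x, ‖g x‖ ≤ B) (hg0 : ∀ x, R < ‖x‖ → g x = 0) {h : T d → ℝ} (hh : Measurable h) :
    eLpNorm (fun x => g x * h (osc ε x)) 2 volume ≤
      ENNReal.ofReal B * oscConst d R * eLpNorm h 2 volume := by
  rw [← ENNReal.pow_le_pow_left_iff two_ne_zero, eLpNorm_two_sq, mul_pow, mul_pow, eLpNorm_two_sq]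
  have hV : oscConst d R ^ 2 = volume (Metric.closedBall (0 : E d) (R + (d + 1))) := by
    rw [oscConst, ← ENNReal.rpow_natCast, ← ENNReal.rpow_mul]
    norm_num
  rw [hV, mul_assoc]
  calc ∫⁻ x, ‖g x * h (osc ε x)‖ₑ ^ 2
      ≤ ∫⁻ x, (Metric.closedBall (0 : E d) R).indicator
          (fun x => ENNReal.ofReal B ^ 2 * ‖h (osc ε x)‖ₑ ^ 2) x := by
        refine lintegral_mono fun x => ?_
        by_cases hx : R < ‖x‖
        · simp [hg0 x hx]
        · rw [indicator_of_mem (by simpa using hx), enorm_mul, mul_pow]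
          gcongr
          rw [← ofReal_norm]
          exact ENNReal.ofReal_le_ofReal (hgB x)
    _ = ENNReal.ofReal B ^ 2 * ∫⁻ x in Metric.closedBall (0 : E d) R, ‖h (osc ε x)‖ₑ ^ 2 := by
        rw [lintegral_indicator Metric.isClosed_closedBall.measurableSet,
          lintegral_const_mul' _ _ (by simp)]
    _ ≤ _ := by
        gcongr
        exact lintegral_ball_osc_le R hε (fun v => ‖h v‖ₑ ^ 2) (hh.enorm.pow_const 2)

theorem lintegral_eLpNorm_osc_le {R B : ℝ} {ε : ℝ} (hε : ε ∈ Ioc (0 : ℝ) 1)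
    {G : ℝ × E d → T d → ℝ} (hB : ∀ p v, 0 ≤ p.1 → ‖G p v‖ ≤ B) (h0 : ∀ p v, R < ‖p‖ → G p v = 0)
    {h : T d → ℝ} (hh : Measurable h) :
    ∫⁻ t, eLpNorm (fun x => G (t, x) (osc ε x) * h (osc ε x)) 2 volume ∂timeMeasure ≤
      ENNReal.ofReal R * (ENNReal.ofReal B * oscConst d R * eLpNorm h 2 volume) := by
  have h1 : ∀ t, 0 ≤ t → eLpNorm (fun x => G (t, x) (osc ε x) * h (osc ε x)) 2 volume ≤
      (Icc 0 R).indicator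
        (fun _ => ENNReal.ofReal B * oscConst d R * eLpNorm h 2 volume) t := by
    intro t ht
    by_cases hR : R < t
    · have : ∀ x, G (t, x) (osc ε x) = 0 := fun x =>
        h0 _ _ (hR.trans_le ((le_abs_self t).trans (norm_fst_le (t, x))))
      simp [this]
    rw [indicator_of_mem (show t ∈ Icc 0 R from ⟨ht, not_lt.1 hR⟩)]
    exact eLpNorm_mul_osc_le hε (fun x => hB _ _ ht)
      (fun x hx => h0 _ _ (hx.trans_le (norm_snd_le (t, x)))) hh
  calc ∫⁻ t, eLpNorm (fun x => G (t, x) (osc ε x) * h (osc ε x)) 2 volume ∂timeMeasure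
      ≤ ∫⁻ t, (Icc 0 R).indicator
          (fun _ => ENNReal.ofReal B * oscConst d R * eLpNorm h 2 volume) t ∂timeMeasure :=
        setLIntegral_mono_ae' measurableSet_Ici (ae_of_all _ fun t ht => h1 t ht)
    _ ≤ ∫⁻ t, (Icc 0 R).indicator
          (fun _ => ENNReal.ofReal B * oscConst d R * eLpNorm h 2 volume) t :=
        lintegral_mono' Measure.restrict_le_self le_rfl
    _ = _ := by
        rw [lintegral_indicator measurableSet_Icc, setLIntegral_const, Real.volume_Icc, sub_zero,
          mul_comm]

theorem Admissible.measurable_osc {R : ℝ} {G : ℝ × E d → T d → ℝ} (hG : Admissible R G)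
    (ε : ℝ) {h : T d → ℝ} (hh : Measurable h) :
    Measurable (Function.uncurry fun (t : ℝ) (x : E d) => G (t, x) (osc ε x) * h (osc ε x)) := by
  have hosc : Measurable fun p : ℝ × E d => osc ε p.2 :=
    (continuous_osc ε).measurable.comp measurable_snd
  exact (hG.measurable.comp (f := fun p : ℝ × E d => (p, osc ε p.2))
    (measurable_id.prodMk hosc)).mul (hh.comp hosc)

/-- `∫∫ u(t, x) θ(t, x, x/ε) dx dt`. -/
def oscPairing (ε : ℝ) (u : ℝ → E d → ℝ) (θ : ℝ × E d → T d → ℝ) : ℝ :=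
  ∫ p : ℝ × E d, u p.1 p.2 * θ p (osc ε p.2) ∂(timeMeasure.prod volume)

theorem Admissible.integrable_oscPairing {R : ℝ} {G : ℝ × E d → T d → ℝ} (hG : Admissible R G)
    {ε : ℝ} (hε : ε ∈ Ioc (0 : ℝ) 1) {h : T d → ℝ} (hh : Measurable h) (hh2 : MemLp h 2 volume)
    {u : ℝ → E d → ℝ} (hu : MemLinftyL2 u) :
    Integrable (fun p : ℝ × E d => u p.1 p.2 * (G p (osc ε p.2) * h (osc ε p.2)))
      (timeMeasure.prod volume) := by
  obtain ⟨B, hB⟩ := hG.bounded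
  refine integrable_pairing hu (hG.measurable_osc ε hh).aestronglyMeasurable
    ((lintegral_eLpNorm_osc_le hε (fun p v _ => hB p v) hG.eq_zero hh).trans_lt ?_)
  exact ENNReal.mul_lt_top (by simp) (ENNReal.mul_lt_top
    (ENNReal.mul_lt_top (by simp) (oscConst_ne_top R).lt_top) hh2.2)

/-- Uniformly in `ε`, the pairing is continuous for the `L²` norm of the factor in `v`; all
approximations in the fast variable rest on this bound. -/
theorem Admissible.enorm_oscPairing_le {R B : ℝ} {G : ℝ × E d → T d → ℝ} (hG : Admissible R G)
    (hB : ∀ p v, 0 ≤ p.1 → ‖G p v‖ ≤ B) {ε : ℝ} (hε : ε ∈ Ioc (0 : ℝ) 1) {h : T d → ℝ}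
    (hh : Measurable h) {u : ℝ → E d → ℝ}
    (hu : AEStronglyMeasurable (Function.uncurry u) (timeMeasure.prod volume)) {C : ℝ≥0}
    (hC : ∀ᵐ t ∂timeMeasure, eLpNorm (u t) 2 volume ≤ C) :
    ‖oscPairing ε u (fun p v => G p v * h v)‖ₑ ≤
      C * (ENNReal.ofReal R * (ENNReal.ofReal B * oscConst d R)) * eLpNorm h 2 volume := by
  refine (enorm_integral_pairing_le hu (hG.measurable_osc ε hh).aestronglyMeasurable hC).trans ?_
  rw [mul_assoc, mul_assoc]
  exact mul_le_mul' le_rfl (lintegral_eLpNorm_osc_le hε hB hG.eq_zero hh)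

/-! ### Families of solutions with oscillating data -/

/-- Bounded families of weak solutions of the oscillating transport problems. -/
structure OscSolution (a : T d → E d) (U₀ : E d × T d → ℝ) (u : ℝ → ℝ → E d → ℝ) (C : ℝ≥0) :
    Prop where
  measurable : ∀ ε ∈ Ioc (0 : ℝ) 1,
    AEStronglyMeasurable (Function.uncurry (u ε)) (timeMeasure.prod volume)
  bound : ∀ ε ∈ Ioc (0 : ℝ) 1, ∀ᵐ t ∂timeMeasure, eLpNorm (u ε t) 2 volume ≤ C
  data_measurable : ∀ ε ∈ Ioc (0 : ℝ) 1,
    AEStronglyMeasurable (fun x => U₀ (x, osc ε x)) volume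
  data_bound : ∀ ε ∈ Ioc (0 : ℝ) 1, eLpNorm (fun x => U₀ (x, osc ε x)) 2 volume ≤ C
  weak : ∀ ε ∈ Ioc (0 : ℝ) 1, ∀ φ : ℝ × E d → ℝ, ContDiff ℝ ∞ φ → HasCompactSupport φ →
    oscPairing ε (u ε) (fun p v => fderiv ℝ φ p (1, a v)) = -∫ x, U₀ (x, osc ε x) * φ (0, x)

theorem admissible_fderiv {b : T d → E d} (hb : Measurable b) {M : ℝ}
    (hM : ∀ v, ‖b v‖ ≤ M) {φ : ℝ × E d → ℝ} (hφ : ContDiff ℝ ∞ φ) (hc : HasCompactSupport φ) :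
    ∃ R, Admissible R (fun p v => fderiv ℝ φ p (1, b v)) := by
  obtain ⟨R, hR⟩ := admissible_fderiv_mul hb hM hφ hc (ψ := fun _ => 1) measurable_const
    ⟨1, by simp⟩
  exact ⟨R, by simpa using hR⟩

/-- The bound on each `u ε` contained in its definition may depend on `ε`. The energy estimate
replaces it by that of the data, which is uniform. -/
theorem exists_oscSolution {a : T d → E d} (ha : ContDiff ℝ 1 (fun y : E d => a (proj y)))
    (hdiv : ∀ v, torusDiv a v = 0) {U₀ : E d × T d → ℝ} (hU : BoundedData U₀)
    {u : ℝ → ℝ → E d → ℝ} (hu : ∀ ε ∈ Ioc (0 : ℝ) 1,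
      IsTransportSolution (fun x => a (osc ε x)) (fun x => U₀ (x, osc ε x)) (u ε)) :
    ∃ C, OscSolution a U₀ u C := by
  obtain ⟨C, hC⟩ := hU
  have hbd : ∀ ε ∈ Ioc (0 : ℝ) 1, ∀ᵐ t ∂timeMeasure, eLpNorm (u ε t) 2 volume ≤ C := fun ε hε => by
    have h2 : MemLp (fun x => U₀ (x, osc ε x)) 2 volume :=
      ⟨(hC ε hε).1, (hC ε hε).2.trans_lt (by simp)⟩
    filter_upwards [transport_eLpNorm_le (divFreeField_osc ha hdiv ε) h2 (hu ε hε)] with t ht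
    exact ht.trans (hC ε hε).2
  refine ⟨C, fun ε hε => (hu ε hε).1.1, hbd, fun ε hε => (hC ε hε).1, fun ε hε => (hC ε hε).2,
    fun ε hε φ hφ hφc => ?_⟩
  have hac : Continuous a := continuous_of_lift ha.continuous
  obtain ⟨M, -, hM⟩ := exists_bound_of_continuous hac
  obtain ⟨R, hR⟩ := admissible_fderiv hac.measurable hM hφ hφc
  have hi := hR.integrable_oscPairing hε (h := fun _ => 1) measurable_const (memLp_const 1)
    (hu ε hε).1
  simp only [mul_one] at hi
  have h1 := (hu ε hε).2 (fun t x => φ (t, x)) hφ hφc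
  rw [oscPairing, ← integral_time_prod hi]
  refine eq_neg_of_add_eq_zero_left ?_
  refine Eq.trans ?_ h1
  congr 1
  refine integral_congr_ae (ae_of_all _ fun t => integral_congr_ae (ae_of_all _ fun x => ?_))
  dsimp only
  rw [deriv_add_fderiv_apply (Ψ := φ) (hφ.differentiable (by simp) _)]

theorem contDiff_osc_mul {φ : ℝ × E d → ℝ} (hφ : ContDiff ℝ ∞ φ) {ψ : T d → ℝ}
    (hψ : SmoothTorus ψ) (ε : ℝ) : ContDiff ℝ ∞ fun p : ℝ × E d => φ p * ψ (osc ε p.2) :=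
  hφ.mul (ContDiff.comp (g := fun y => ψ (proj y)) hψ
    (by fun_prop : ContDiff ℝ ∞ fun p : ℝ × E d => ε⁻¹ • p.2))

theorem fderiv_osc_mul {φ : ℝ × E d → ℝ} (hφ : ContDiff ℝ ∞ φ) {ψ : T d → ℝ}
    (hψ : SmoothTorus ψ) (ε : ℝ) (p : ℝ × E d) (w : E d) :
    fderiv ℝ (fun p : ℝ × E d => φ p * ψ (osc ε p.2)) p (1, w) =
      fderiv ℝ φ p (1, w) * ψ (osc ε p.2) +
        ε⁻¹ * (φ p * torusDeriv ψ (osc ε p.2) w) := by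
  have h1 : HasFDerivAt (fun p : ℝ × E d => ε⁻¹ • p.2)
      (ε⁻¹ • ContinuousLinearMap.snd ℝ ℝ (E d)) p := hasFDerivAt_snd.const_smul ε⁻¹
  have h2 : HasFDerivAt (fun y : E d => ψ (proj y)) (fderiv ℝ (fun y : E d => ψ (proj y))
      (ε⁻¹ • p.2)) (ε⁻¹ • p.2) := (ContDiff.differentiable hψ (by simp) _).hasFDerivAt
  have h3 := (hφ.differentiable (by simp) p).hasFDerivAt.mul (h2.comp p h1)
  have h4 : (fun p : ℝ × E d => φ p * ψ (osc ε p.2)) =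
    φ * ((fun y : E d => ψ (proj y)) ∘ fun p : ℝ × E d => ε⁻¹ • p.2) := rfl
  rw [h4, h3.fderiv, osc, torusDeriv_proj]
  simp
  ring

/-- The equation is tested with `φ(t, x) ψ(x/ε)`; the chain rule in the fast variable produces the
factor `1/ε`. -/
theorem OscSolution.weak_mul {a : T d → E d} (ha : ContDiff ℝ 1 (fun y : E d => a (proj y)))
    {U₀ : E d × T d → ℝ} {u : ℝ → ℝ → E d → ℝ} {C : ℝ≥0} (hu : OscSolution a U₀ u C)
    {ε : ℝ} (hε : ε ∈ Ioc (0 : ℝ) 1) {φ : ℝ × E d → ℝ} (hφ : ContDiff ℝ ∞ φ)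
    (hc : HasCompactSupport φ) {ψ : T d → ℝ} (hψ : SmoothTorus ψ) :
    oscPairing ε (u ε) (fun p v => fderiv ℝ φ p (1, a v) * ψ v) +
      ε⁻¹ * oscPairing ε (u ε) (fun p v => φ p * torusDeriv ψ v (a v)) =
      -∫ x, U₀ (x, osc ε x) * (φ (0, x) * ψ (osc ε x)) := by
  have hu2 : MemLinftyL2 (u ε) := ⟨hu.measurable ε hε, C, hu.bound ε hε⟩
  have h1 := hu.weak ε hε _ (contDiff_osc_mul hφ hψ ε) hc.mul_right
  rw [← h1]
  have hac : Continuous a := continuous_of_lift ha.continuous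
  obtain ⟨M, -, hM⟩ := exists_bound_of_continuous hac
  obtain ⟨R, hR⟩ := admissible_fderiv hac.measurable hM hφ hc
  obtain ⟨R', hR'⟩ := hc.isCompact.isBounded.subset_closedBall 0
  obtain ⟨B, hB⟩ := hφ.continuous.bounded_above_of_compact_support hc
  have hφa : Admissible R' fun (p : ℝ × E d) (_ : T d) => φ p * 1 :=
    Admissible.mul hφ.continuous.measurable ⟨B, hB⟩
      (fun p hp => image_eq_zero_of_notMem_tsupport fun hmem => by
        have := hR' hmem
        rw [mem_closedBall_zero_iff] at this
        linarith) measurable_const ⟨1, by simp⟩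
  have hq := continuous_torusDeriv ha hψ
  have hi1 := hR.integrable_oscPairing hε hψ.continuous.measurable
    (memLp_of_continuous hψ.continuous 2) hu2
  have hi2 := hφa.integrable_oscPairing hε hq.measurable (memLp_of_continuous hq 2) hu2
  simp only [mul_one] at hi2
  simp only [oscPairing]
  rw [← integral_const_mul, ← integral_add hi1 (hi2.const_mul _)]
  congr 1 with p
  have h5 : fderiv ℝ (fun p : ℝ × E d => φ p * ψ (osc ε p.2)) p (1, a (osc ε p.2)) = _ :=
    fderiv_osc_mul hφ hψ ε p (a (osc ε p.2))
  rw [h5]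
  ring

/-! ### The orthogonal complement of `K` -/

theorem torusDeriv_add {F G : T d → ℝ} (hF : ContDiff ℝ 1 (fun y : E d => F (proj y)))
    (hG : ContDiff ℝ 1 (fun y : E d => G (proj y))) (v : T d) (w : E d) :
    torusDeriv (fun v => F v + G v) v w = torusDeriv F v w + torusDeriv G v w := by
  obtain ⟨y, rfl⟩ := proj_surjective v
  simp only [torusDeriv_proj]
  rw [fderiv_fun_add (hF.differentiable one_ne_zero).differentiableAt
    (hG.differentiable one_ne_zero).differentiableAt]
  rfl

theorem torusDeriv_const_mul {F : T d → ℝ} (hF : ContDiff ℝ 1 (fun y : E d => F (proj y)))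
    (c : ℝ) (v : T d) (w : E d) :
    torusDeriv (fun v => c * F v) v w = c * torusDeriv F v w := by
  obtain ⟨y, rfl⟩ := proj_surjective v
  simp only [torusDeriv_proj]
  rw [fderiv_const_mul (hF.differentiable one_ne_zero).differentiableAt]
  rfl

/-- The range of `a · ∇_v` on smooth functions. -/
def derivRange (a : T d → E d) :
    Submodule ℝ (Lp ℝ 2 (volume : Measure (T d))) where
  carrier := {f | ∃ ψ, SmoothTorus ψ ∧ f =ᵐ[volume] fun v => torusDeriv ψ v (a v)}
  zero_mem' := by
    refine ⟨fun _ => 0, smoothTorus_const 0, ?_⟩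
    filter_upwards [Lp.coeFn_zero ℝ 2 (volume : Measure (T d))] with v hv
    rw [hv]
    simp [torusDeriv]
  add_mem' := by
    rintro f g ⟨ψ, hψ, hf⟩ ⟨ψ', hψ', hg⟩
    refine ⟨_, hψ.add hψ', ?_⟩
    filter_upwards [Lp.coeFn_add f g, hf, hg] with v h1 h2 h3
    rw [h1, torusDeriv_add hψ.contDiff_one hψ'.contDiff_one, Pi.add_apply, h2, h3]
  smul_mem' := by
    rintro c f ⟨ψ, hψ, hf⟩
    refine ⟨_, (smoothTorus_const c).mul hψ, ?_⟩
    filter_upwards [Lp.coeFn_smul c f, hf] with v h1 h2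
    rw [h1, torusDeriv_const_mul hψ.contDiff_one, Pi.smul_apply, h2, smul_eq_mul]

/-- `K` is by definition the orthogonal complement of the functions `a · ∇ψ`, so its own orthogonal
complement is their closure. -/
theorem exists_torusDeriv_near {a : T d → E d} (ha : ContDiff ℝ 1 (fun y : E d => a (proj y)))
    {h : T d → ℝ} (hh : MemLp h 2 volume) (horth : ∀ g, InK a ha g → ∫ v, g v * h v = 0)
    {η : ℝ≥0∞} (hη : η ≠ 0) :
    ∃ ψ, SmoothTorus ψ ∧ eLpNorm (fun v => h v - torusDeriv ψ v (a v)) 2 volume ≤ η := by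
  have h1 : hh.toLp h ∈ (derivRange a).topologicalClosure := by
    rw [← Submodule.orthogonal_orthogonal_eq_closure, Submodule.mem_orthogonal]
    intro g hg
    have hgK : InK a ha g := by
      refine inK_iff.2 ⟨Lp.memLp g, fun ψ hψ => ?_⟩
      rw [integral_eq_inner ha hψ]
      exact (Submodule.mem_orthogonal _ _).1 hg _ ⟨ψ, hψ, (memLp_torusDeriv ha hψ).coeFn_toLp⟩
    rw [L2.inner_def, ← horth g hgK]
    apply integral_congr_ae
    filter_upwards [hh.coeFn_toLp] with v hv
    simp [hv, mul_comm]
  obtain ⟨f, ⟨ψ, hψ, hf⟩, hfd⟩ := EMetric.mem_closure_iff.1 h1 η (pos_iff_ne_zero.2 hη)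
  refine ⟨ψ, hψ, le_of_eq_of_le ?_ hfd.le⟩
  rw [Lp.edist_def]
  apply eLpNorm_congr_ae
  filter_upwards [hh.coeFn_toLp, hf] with v h2 h3
  rw [Pi.sub_apply, h2, h3]

/-! ### Limits of oscillating pairings -/

theorem tendsto_zero_of_approx {ι : Type*} {l : Filter ι} {x : ι → ℝ} {K : ℝ≥0∞} (hK : K ≠ ⊤)
    (h : ∀ δ : ℝ≥0∞, δ ≠ 0 → ∃ y : ι → ℝ, Tendsto y l (𝓝 0) ∧
      ∀ᶠ i in l, ‖x i - y i‖ₑ ≤ K * δ) : Tendsto x l (𝓝 0) := by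
  refine tendsto_of_enorm_sub_tendsto ?_
  simp only [sub_zero]
  rw [ENNReal.tendsto_nhds_zero]
  intro η hη
  have hη2 : η / 2 ≠ 0 := (ENNReal.half_pos hη.ne').ne'
  obtain ⟨δ, hδ, hKδ⟩ : ∃ δ : ℝ≥0∞, δ ≠ 0 ∧ K * δ ≤ η / 2 := by
    by_cases hK0 : K = 0
    · exact ⟨1, one_ne_zero, by simp [hK0]⟩
    · refine ⟨η / 2 / K, (ENNReal.div_pos hη2 hK).ne', ?_⟩
      exact ENNReal.mul_div_le
  obtain ⟨y, hy, hxy⟩ := h δ hδ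
  have hy' : Tendsto (fun i => ‖y i‖ₑ) l (𝓝 0) := by simpa using hy.enorm
  filter_upwards [hxy, hy'.eventually_le_const (pos_iff_ne_zero.2 hη2)] with i h1 h2
  calc ‖x i‖ₑ = ‖(x i - y i) + y i‖ₑ := by rw [sub_add_cancel]
    _ ≤ ‖x i - y i‖ₑ + ‖y i‖ₑ := enorm_add_le _ _
    _ ≤ η / 2 + η / 2 := add_le_add (h1.trans hKδ) h2
    _ = η := ENNReal.add_halves η

theorem eLpNorm_fst_mul_snd {X Y : Type*} [MeasureSpace X] [MeasureSpace Y]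
    [SFinite (volume : Measure X)] [SFinite (volume : Measure Y)] {f : X → ℝ} {g : Y → ℝ}
    (hf : AEStronglyMeasurable f volume) (hg : AEStronglyMeasurable g volume) :
    eLpNorm (fun p : X × Y => f p.1 * g p.2) 2 volume =
      eLpNorm f 2 volume * eLpNorm g 2 volume := by
  have h : (eLpNorm (fun p : X × Y => f p.1 * g p.2) 2 volume) ^ 2 =
      (eLpNorm f 2 volume * eLpNorm g 2 volume) ^ 2 := by
    rw [mul_pow, eLpNorm_two_sq, eLpNorm_two_sq, eLpNorm_two_sq]
    simp only [enorm_mul, mul_pow]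
    exact lintegral_prod_mul (hf.enorm.pow_const 2) (hg.enorm.pow_const 2)
  exact (ENNReal.pow_right_strictMono two_ne_zero).injective h

theorem Admissible.oscPairing_sub {R : ℝ} {G : ℝ × E d → T d → ℝ} (hG : Admissible R G)
    {ε : ℝ} (hε : ε ∈ Ioc (0 : ℝ) 1) {h h' : T d → ℝ} (hh : Measurable h) (hh2 : MemLp h 2 volume)
    (hh' : Measurable h') (hh2' : MemLp h' 2 volume) {u : ℝ → E d → ℝ} (hu : MemLinftyL2 u) :
    oscPairing ε u (fun p v => G p v * (h v - h' v)) =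
      oscPairing ε u (fun p v => G p v * h v) - oscPairing ε u (fun p v => G p v * h' v) := by
  simp only [oscPairing]
  rw [← integral_sub (hG.integrable_oscPairing hε hh hh2 hu)
    (hG.integrable_oscPairing hε hh' hh2' hu)]
  congr 1 with p
  ring

theorem Admissible.tendsto_oscPairing {R : ℝ} {G : ℝ × E d → T d → ℝ} (hG : Admissible R G)
    {ε : ℝ} (hε : ε ∈ Ioc (0 : ℝ) 1) {h : ℕ → T d → ℝ} {h' : T d → ℝ} (hh : ∀ n, Measurable (h n))
    (hh2 : ∀ n, MemLp (h n) 2 volume) (hh' : Measurable h') (hh2' : MemLp h' 2 volume)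
    (hlim : Tendsto (fun n => eLpNorm (fun v => h n v - h' v) 2 volume) atTop (𝓝 0))
    {u : ℝ → E d → ℝ} (hu : MemLinftyL2 u) :
    Tendsto (fun n => oscPairing ε u (fun p v => G p v * h n v)) atTop
      (𝓝 (oscPairing ε u (fun p v => G p v * h' v))) := by
  obtain ⟨hum, C, hC⟩ := id hu
  obtain ⟨B, hB⟩ := hG.bounded
  refine tendsto_of_enorm_sub_tendsto (tendsto_zero_of_le_const_mul
    (C := C * (ENNReal.ofReal R * (ENNReal.ofReal B * oscConst d R))) ?_ hlim
    (Eventually.of_forall fun n => ?_))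
  · exact ENNReal.mul_ne_top (by simp) (ENNReal.mul_ne_top (by simp)
      (ENNReal.mul_ne_top (by simp) (oscConst_ne_top R)))
  · rw [← hG.oscPairing_sub hε (hh n) (hh2 n) hh' hh2' hu]
    exact hG.enorm_oscPairing_le (fun p v _ => hB p v) hε ((hh n).sub hh') hum hC

theorem exists_admissible_of_contDiff {χ : ℝ × E d → ℝ} (hχ : ContDiff ℝ ∞ χ)
    (hc : HasCompactSupport χ) :
    ∃ R, Admissible R fun (p : ℝ × E d) (_ : T d) => χ p := by
  obtain ⟨R, hR⟩ := hc.isCompact.isBounded.subset_closedBall 0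
  obtain ⟨B, hB⟩ := hχ.continuous.bounded_above_of_compact_support hc
  refine ⟨R, hχ.continuous.measurable.comp measurable_fst, ⟨B, fun p _ => hB p⟩,
    fun p _ hp => image_eq_zero_of_notMem_tsupport fun hmem => ?_⟩
  have := hR hmem
  rw [mem_closedBall_zero_iff] at this
  linarith

section Limits

variable {a : T d → E d} {ha : ContDiff ℝ 1 (fun y : E d => a (proj y))}
  {U₀ : E d × T d → ℝ} {u : ℝ → ℝ → E d → ℝ} {C : ℝ≥0}

theorem OscSolution.memLinftyL2 (hu : OscSolution a U₀ u C) {ε : ℝ} (hε : ε ∈ Ioc (0 : ℝ) 1) :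
    MemLinftyL2 (u ε) := ⟨hu.measurable ε hε, C, hu.bound ε hε⟩

theorem OscSolution.memLp_data (hu : OscSolution a U₀ u C) {ε : ℝ} (hε : ε ∈ Ioc (0 : ℝ) 1) :
    MemLp (fun x => U₀ (x, osc ε x)) 2 volume :=
  ⟨hu.data_measurable ε hε, (hu.data_bound ε hε).trans_lt (by simp)⟩

theorem OscSolution.enorm_data_le (hu : OscSolution a U₀ u C) {ε : ℝ} (hε : ε ∈ Ioc (0 : ℝ) 1)
    {R B : ℝ} {χ : E d → ℝ} (hχ : Measurable χ) (hB : ∀ x, ‖χ x‖ ≤ B)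
    (h0 : ∀ x, R < ‖x‖ → χ x = 0) {h : T d → ℝ} (hh : Measurable h) :
    ‖∫ x, U₀ (x, osc ε x) * (χ x * h (osc ε x))‖ₑ ≤
      C * (ENNReal.ofReal B * oscConst d R) * eLpNorm h 2 volume := by
  have hm : Measurable fun x : E d => χ x * h (osc ε x) :=
    hχ.mul (hh.comp (continuous_osc ε).measurable)
  refine (enorm_integral_mul_le (hu.data_measurable ε hε) hm.aestronglyMeasurable).trans ?_
  rw [mul_assoc]
  exact mul_le_mul' (hu.data_bound ε hε) (eLpNorm_mul_osc_le hε hB h0 hh)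

/-- The weak formulation is multiplied by `ε`: all its other terms are bounded uniformly in `ε`. -/
theorem OscSolution.tendsto_torusDeriv (hu : OscSolution a U₀ u C)
    (ha : ContDiff ℝ 1 (fun y : E d => a (proj y))) {χ : ℝ × E d → ℝ} (hχ : ContDiff ℝ ∞ χ)
    (hc : HasCompactSupport χ) {ψ : T d → ℝ} (hψ : SmoothTorus ψ) :
    Tendsto (fun ε => oscPairing ε (u ε) (fun p v => χ p * torusDeriv ψ v (a v))) (𝓝[>] 0)
      (𝓝 0) := by
  have hac : Continuous a := continuous_of_lift ha.continuous
  obtain ⟨M, -, hM⟩ := exists_bound_of_continuous hac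
  obtain ⟨R, hR⟩ := admissible_fderiv hac.measurable hM hχ hc
  obtain ⟨B, hB⟩ := hR.bounded
  obtain ⟨R', hR'⟩ := exists_admissible_of_contDiff hχ hc
  obtain ⟨B', hB'⟩ := hR'.bounded
  have hψm := hψ.continuous.measurable
  have hψ2 := memLp_of_continuous hψ.continuous 2
  set K : ℝ≥0∞ := C * (ENNReal.ofReal R * (ENNReal.ofReal B * oscConst d R)) *
    eLpNorm ψ 2 volume + C * (ENNReal.ofReal B' * oscConst d R') * eLpNorm ψ 2 volume
  have hK : K ≠ ⊤ := ENNReal.add_ne_top.2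
    ⟨ENNReal.mul_ne_top (ENNReal.mul_ne_top (by simp) (ENNReal.mul_ne_top (by simp)
      (ENNReal.mul_ne_top (by simp) (oscConst_ne_top R)))) hψ2.2.ne,
    ENNReal.mul_ne_top (ENNReal.mul_ne_top (by simp)
      (ENNReal.mul_ne_top (by simp) (oscConst_ne_top R'))) hψ2.2.ne⟩
  have hid : Tendsto (fun ε : ℝ => ‖ε‖ₑ) (𝓝[>] 0) (𝓝 0) := by
    have : Tendsto (fun ε : ℝ => ‖ε‖ₑ) (𝓝 0) (𝓝 ‖(0 : ℝ)‖ₑ) := continuous_enorm.tendsto 0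
    rw [enorm_zero] at this
    exact this.mono_left nhdsWithin_le_nhds
  refine tendsto_of_enorm_sub_tendsto (tendsto_zero_of_le_const_mul hK hid ?_)
  filter_upwards [Ioc_mem_nhdsGT one_pos] with ε hε
  have h1 := hu.weak_mul ha hε hχ hc hψ
  have h2 : oscPairing ε (u ε) (fun p v => χ p * torusDeriv ψ v (a v)) =
      -(ε * (oscPairing ε (u ε) (fun p v => fderiv ℝ χ p (1, a v) * ψ v) +
        ∫ x, U₀ (x, osc ε x) * (χ (0, x) * ψ (osc ε x)))) := by
    have hε0 : ε ≠ 0 := hε.1.ne'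
    generalize oscPairing ε (u ε) (fun p v => χ p * torusDeriv ψ v (a v)) = Q at h1 ⊢
    generalize oscPairing ε (u ε) (fun p v => fderiv ℝ χ p (1, a v) * ψ v) = A at h1 ⊢
    generalize ∫ x, U₀ (x, osc ε x) * (χ (0, x) * ψ (osc ε x)) = I at h1 ⊢
    have h3 : Q = ε * (ε⁻¹ * Q) := by field_simp
    rw [h3, eq_sub_of_add_eq' h1]
    ring
  rw [sub_zero, h2, enorm_neg, enorm_mul, mul_comm]
  gcongr
  refine (enorm_add_le _ _).trans (add_le_add ?_ ?_)
  · exact hR.enorm_oscPairing_le (fun p v _ => hB p v) hε hψm (hu.measurable ε hε)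
      (hu.bound ε hε)
  · exact hu.enorm_data_le hε (hχ.continuous.measurable.comp measurable_prodMk_left)
      (fun x => hB' (0, x) 0) (fun x hx => hR'.eq_zero (0, x) 0 (hx.trans_le (norm_snd_le (0, x))))
      hψm

/-- In the limit the oscillations of `u_ε` see only `K`. Functions orthogonal to `K` are `L²` limits
of functions `a · ∇ψ`, and the pairing is uniformly continuous in that norm. -/
theorem OscSolution.tendsto_orthogonal (hu : OscSolution a U₀ u C)
    {χ : ℝ × E d → ℝ} (hχ : ContDiff ℝ ∞ χ)
    (hc : HasCompactSupport χ) {h : T d → ℝ} (hm : Measurable h) (hh : MemLp h 2 volume)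
    (horth : ∀ g, InK a ha g → ∫ v, g v * h v = 0) :
    Tendsto (fun ε => oscPairing ε (u ε) (fun p v => χ p * h v)) (𝓝[>] 0) (𝓝 0) := by
  obtain ⟨R, hR⟩ := exists_admissible_of_contDiff hχ hc
  obtain ⟨B, hB⟩ := hR.bounded
  refine tendsto_zero_of_approx
    (K := C * (ENNReal.ofReal R * (ENNReal.ofReal B * oscConst d R)))
    (ENNReal.mul_ne_top (by simp) (ENNReal.mul_ne_top (by simp)
      (ENNReal.mul_ne_top (by simp) (oscConst_ne_top R)))) fun δ hδ => ?_
  obtain ⟨ψ, hψ, hle⟩ := exists_torusDeriv_near ha hh horth hδ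
  have hq := continuous_torusDeriv ha hψ
  refine ⟨_, hu.tendsto_torusDeriv ha hχ hc hψ, ?_⟩
  filter_upwards [Ioc_mem_nhdsGT one_pos] with ε hε
  rw [← hR.oscPairing_sub hε hm hh hq.measurable (memLp_of_continuous hq 2) (hu.memLinftyL2 hε)]
  refine (hR.enorm_oscPairing_le (fun p v _ => hB p v) hε (hm.sub hq.measurable)
    (hu.measurable ε hε) (hu.bound ε hε)).trans ?_
  exact mul_le_mul' le_rfl hle

/-- The profile hypothesis concerns test functions continuous in `v`, whereas invariant functions
are usually discontinuous. The uniform bound on the traces of `U₀` closes the gap by density of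
smooth functions in `L²(𝕋^d)`. -/
theorem OscSolution.tendsto_data (hu : OscSolution a U₀ u C) (hU : MemLp U₀ 2 volume)
    (hp : IsDataProfile U₀) {χ : E d → ℝ} (hχ : Continuous χ) (hc : HasCompactSupport χ)
    {h : T d → ℝ} (hm : Measurable h) (hh : MemLp h 2 volume) :
    Tendsto (fun ε => ∫ x, U₀ (x, osc ε x) * (χ x * h (osc ε x))) (𝓝[>] 0)
      (𝓝 (∫ p, U₀ p * (χ p.1 * h p.2))) := by
  have hχ2 : MemLp χ 2 volume := hχ.memLp_of_hasCompactSupport hc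
  obtain ⟨R, hR⟩ := hc.isCompact.isBounded.subset_closedBall 0
  obtain ⟨B, hB⟩ := hχ.bounded_above_of_compact_support hc
  have h0 : ∀ x, R < ‖x‖ → χ x = 0 := fun x hx =>
    image_eq_zero_of_notMem_tsupport fun hmem => by
      have := hR hmem
      rw [mem_closedBall_zero_iff] at this
      linarith
  have hi : ∀ {h : T d → ℝ}, MemLp h 2 volume →
      Integrable (fun p : E d × T d => U₀ p * (χ p.1 * h p.2)) volume := fun hh =>
    MemLp.integrable_mul hU (MemLp.fst_mul_snd hχ2 hh)
  have hi' : ∀ {h : T d → ℝ}, Measurable h → MemLp h 2 volume → ∀ {ε : ℝ}, ε ∈ Ioc (0 : ℝ) 1 →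
      Integrable (fun x => U₀ (x, osc ε x) * (χ x * h (osc ε x))) volume := by
    intro h hm hh ε hε
    have hθ : MemLp (fun x => χ x * h (osc ε x)) 2 volume := by
      refine ⟨?_, ?_⟩
      · exact (hχ.measurable.mul (hm.comp (continuous_osc ε).measurable)).aestronglyMeasurable
      · exact (eLpNorm_mul_osc_le hε hB h0 hm).trans_lt (ENNReal.mul_lt_top
          (ENNReal.mul_lt_top (by simp) (oscConst_ne_top R).lt_top) hh.2)
    exact MemLp.integrable_mul (hu.memLp_data hε) hθ
  rw [← tendsto_sub_nhds_zero_iff]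
  set K : ℝ≥0∞ := C * (ENNReal.ofReal B * oscConst d R) +
    eLpNorm U₀ 2 volume * eLpNorm χ 2 volume
  refine tendsto_zero_of_approx (K := K) (ENNReal.add_ne_top.2
    ⟨ENNReal.mul_ne_top (by simp) (ENNReal.mul_ne_top (by simp) (oscConst_ne_top R)),
      ENNReal.mul_ne_top hU.2.ne hχ2.2.ne⟩) fun δ hδ => ?_
  obtain ⟨ψ, hψ, hle⟩ := exists_smooth_eLpNorm_sub_le hh hδ
  have hψm := hψ.continuous.measurable
  have hψ2 := memLp_of_continuous hψ.continuous 2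
  refine ⟨fun ε => (∫ x, U₀ (x, osc ε x) * (χ x * ψ (osc ε x))) -
    ∫ p, U₀ p * (χ p.1 * ψ p.2), ?_, ?_⟩
  · rw [tendsto_sub_nhds_zero_iff]
    have hθ : MemLp (fun x => χ x • (⟨ψ, hψ.continuous⟩ : C(T d, ℝ))) 2 volume :=
      (hχ.smul continuous_const).memLp_of_hasCompactSupport hc.smul_right
    have h1 := hp _ hθ
    have h2 : ∫ p, U₀ p * (χ p.1 * ψ p.2) = ∫ x, ∫ v, U₀ (x, v) * (χ x * ψ v) :=
      integral_prod _ (hi hψ2)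
    rw [h2]
    exact h1
  · filter_upwards [Ioc_mem_nhdsGT one_pos] with ε hε
    have h1 : (∫ x, U₀ (x, osc ε x) * (χ x * h (osc ε x))) -
        (∫ x, U₀ (x, osc ε x) * (χ x * ψ (osc ε x))) =
        ∫ x, U₀ (x, osc ε x) * (χ x * (h (osc ε x) - ψ (osc ε x))) := by
      rw [← integral_sub (hi' hm hh hε) (hi' hψm hψ2 hε)]
      congr 1 with x
      ring
    have h2 : (∫ p, U₀ p * (χ p.1 * h p.2)) - (∫ p, U₀ p * (χ p.1 * ψ p.2)) =
        ∫ p, U₀ p * (χ p.1 * (h p.2 - ψ p.2)) := by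
      rw [← integral_sub (hi hh) (hi hψ2)]
      congr 1 with x
      ring
    have h3 : eLpNorm (fun p : E d × T d => χ p.1 * (h p.2 - ψ p.2)) 2 volume ≤
        eLpNorm χ 2 volume * δ := by
      have h4 := eLpNorm_fst_mul_snd hχ2.1 (hh.sub hψ2).1
      exact h4.trans_le (mul_le_mul' le_rfl hle)
    rw [sub_sub_sub_comm, h1, h2, add_mul]
    refine (enorm_sub_le).trans (add_le_add ?_ ?_)
    · refine (hu.enorm_data_le hε hχ.measurable hB h0 (hm.sub hψm)).trans ?_
      exact mul_le_mul' le_rfl hle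
    · refine (enorm_integral_mul_le hU.1
        (MemLp.fst_mul_snd hχ2 (hh.sub hψ2)).1).trans ?_
      rw [mul_assoc]
      exact mul_le_mul' le_rfl h3

end Limits

/-! ### Limits of the transport equation -/

section Transport

variable {a : T d → E d} {ha : ContDiff ℝ 1 (fun y : E d => a (proj y))}
  {hdiv : ∀ v, torusDiv a v = 0} {U₀ : E d × T d → ℝ} {u : ℝ → ℝ → E d → ℝ} {C : ℝ≥0}

theorem memLp_mul_osc {ε : ℝ} (hε : ε ∈ Ioc (0 : ℝ) 1) {χ : E d → ℝ} (hχ : Continuous χ)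
    (hc : HasCompactSupport χ) {h : T d → ℝ} (hm : Measurable h) (hh : MemLp h 2 volume) :
    MemLp (fun x => χ x * h (osc ε x)) 2 volume := by
  obtain ⟨R, hR⟩ := hc.isCompact.isBounded.subset_closedBall 0
  obtain ⟨B, hB⟩ := hχ.bounded_above_of_compact_support hc
  have h0 : ∀ x, R < ‖x‖ → χ x = 0 := fun x hx =>
    image_eq_zero_of_notMem_tsupport fun hmem => by
      have := hR hmem
      rw [mem_closedBall_zero_iff] at this
      linarith
  exact ⟨(hχ.measurable.mul (hm.comp (continuous_osc ε).measurable)).aestronglyMeasurable,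
    (eLpNorm_mul_osc_le hε hB h0 hm).trans_lt (ENNReal.mul_lt_top
      (ENNReal.mul_lt_top (by simp) (oscConst_ne_top R).lt_top) hh.2)⟩

theorem tendsto_integral_mul_osc {ε : ℝ} (hε : ε ∈ Ioc (0 : ℝ) 1) {w : E d → ℝ}
    (hw : MemLp w 2 volume) {χ : E d → ℝ} (hχ : Continuous χ)
    (hc : HasCompactSupport χ) {h : ℕ → T d → ℝ} {h' : T d → ℝ} (hm : ∀ n, Measurable (h n))
    (hm' : Measurable h') (hh' : MemLp h' 2 volume)
    (hlim : Tendsto (fun n => eLpNorm (fun v => h n v - h' v) 2 volume) atTop (𝓝 0)) :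
    Tendsto (fun n => ∫ x, w x * (χ x * h n (osc ε x))) atTop
      (𝓝 (∫ x, w x * (χ x * h' (osc ε x)))) := by
  obtain ⟨R, hR⟩ := hc.isCompact.isBounded.subset_closedBall 0
  obtain ⟨B, hB⟩ := hχ.bounded_above_of_compact_support hc
  have h0 : ∀ x, R < ‖x‖ → χ x = 0 := fun x hx =>
    image_eq_zero_of_notMem_tsupport fun hmem => by
      have := hR hmem
      rw [mem_closedBall_zero_iff] at this
      linarith
  have hF : ∀ᶠ n in atTop, AEStronglyMeasurable (fun x => χ x * h n (osc ε x)) volume :=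
    Eventually.of_forall fun n =>
      (hχ.measurable.mul ((hm n).comp (continuous_osc ε).measurable)).aestronglyMeasurable
  have hlim' : Tendsto (fun n => eLpNorm (fun x => χ x * h n (osc ε x) - χ x * h' (osc ε x)) 2 volume)
      atTop (𝓝 0) := by
    refine tendsto_zero_of_le_const_mul (C := ENNReal.ofReal B * oscConst d R)
      (ENNReal.mul_ne_top (by simp) (oscConst_ne_top R)) hlim (Eventually.of_forall fun n => ?_)
    simp only [← mul_sub]
    exact eLpNorm_mul_osc_le (h := fun v => h n v - h' v) hε hB h0 ((hm n).sub hm')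
  exact tendsto_integral_mul (f := fun x => χ x * h' (osc ε x))
    (F := fun n x => χ x * h n (osc ε x)) hw (memLp_mul_osc hε hχ hc hm' hh') hF hlim'

theorem hasCompactSupport_slice_zero {χ : ℝ × E d → ℝ} (hc : HasCompactSupport χ) :
    HasCompactSupport fun x => χ (0, x) :=
  HasCompactSupport.intro (hc.isCompact.image continuous_snd) fun _ hx =>
    image_eq_zero_of_notMem_tsupport fun h => hx ⟨_, h, rfl⟩

/-- For fixed `ε`, the singular term of `weak_mul` contains `a · ∇ψ_n`, which tends to zero in `L²`
when smooth `ψ_n` approximate `g ∈ K`. The factor `1/ε` is then irrelevant: the limit in `n` is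
taken before that in `ε`. -/
theorem OscSolution.weak_inK (hu : OscSolution a U₀ u C) (hdiv : ∀ v, torusDiv a v = 0)
    {ε : ℝ} (hε : ε ∈ Ioc (0 : ℝ) 1) {φ : ℝ × E d → ℝ} (hφ : ContDiff ℝ ∞ φ)
    (hc : HasCompactSupport φ) {g : T d → ℝ} (hg : InK a ha g) (hgm : Measurable g) :
    oscPairing ε (u ε) (fun p v => fderiv ℝ φ p (1, a v) * g v) =
      -∫ x, U₀ (x, osc ε x) * (φ (0, x) * g (osc ε x)) := by
  obtain ⟨hg2, hgK⟩ := inK_iff.1 hg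
  obtain ⟨ψ, hψ, hlim, hq⟩ := exists_smooth_approx_kernel ha hdiv hg2 hgm hgK
  have hac : Continuous a := continuous_of_lift ha.continuous
  obtain ⟨M, -, hM⟩ := exists_bound_of_continuous hac
  obtain ⟨R, hR⟩ := admissible_fderiv hac.measurable hM hφ hc
  obtain ⟨R', hR'⟩ := exists_admissible_of_contDiff hφ hc
  have hψm := fun n => (hψ n).continuous.measurable
  have hψ2 := fun n => memLp_of_continuous (hψ n).continuous 2
  have hqc := fun n => continuous_torusDeriv ha (hψ n)
  have h1 := hR.tendsto_oscPairing hε hψm hψ2 hgm hg2 hlim (hu.memLinftyL2 hε)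
  have h2 := hR'.tendsto_oscPairing hε (fun n => (hqc n).measurable)
    (fun n => memLp_of_continuous (hqc n) 2) measurable_zero MemLp.zero (by simpa using hq)
    (hu.memLinftyL2 hε)
  have h3 := tendsto_integral_mul_osc (χ := fun x => φ (0, x)) hε (hu.memLp_data hε)
    (hφ.continuous.comp (Continuous.prodMk_right 0)) (hasCompactSupport_slice_zero hc) hψm hgm hg2
    hlim
  have h4 := h1.add (h2.const_mul ε⁻¹)
  simp only [hu.weak_mul ha hε hφ hc (hψ _)] at h4
  rw [tendsto_nhds_unique h3.neg h4]
  simp [oscPairing]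

theorem fderiv_apply_prodMk_eq_sum {φ : ℝ × E d → ℝ} (p : ℝ × E d) (w w' : E d) :
    fderiv ℝ φ p (1, w) = fderiv ℝ φ p (1, w') +
      ∑ i, fderiv ℝ φ p (0, EuclideanSpace.single i 1) * (w i - w' i) := by
  have h : ((1 : ℝ), w) = (1, w') +
      ∑ i, (w i - w' i) • ((0 : ℝ), (EuclideanSpace.single i 1 : E d)) := by
    ext j
    · simp [Prod.fst_sum]
    · simp [Prod.snd_sum, EuclideanSpace.single, Pi.single_apply]
  rw [h, map_add, map_sum]
  simp only [map_smul, smul_eq_mul, mul_comm]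

/-- Test functions `φ(t, x) ψ(v)` with `ψ` invariant: the field may be averaged. -/
theorem OscSolution.tendsto_oscPairing_fderiv (hu : OscSolution a U₀ u C)
    (hU : MemLp U₀ 2 volume) (hp : IsDataProfile U₀)
    {b : T d → E d} (hb : Measurable b) {M : ℝ} (hM : ∀ v, ‖b v‖ ≤ M)
    (hab : ∀ g, InK a ha g → ∀ i, ∫ v, g v * (a v i - b v i) = 0)
    {φ : ℝ × E d → ℝ} (hφ : ContDiff ℝ ∞ φ) (hc : HasCompactSupport φ) {ψ : T d → ℝ}
    (hψ : Measurable[invariantAlgebra a ha hdiv] ψ) (hψb : ∃ B, ∀ v, ‖ψ v‖ ≤ B) :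
    Tendsto (fun ε => oscPairing ε (u ε) (fun p v => fderiv ℝ φ p (1, b v) * ψ v)) (𝓝[>] 0)
      (𝓝 (-∫ p, U₀ p * (φ (0, p.1) * ψ p.2))) := by
  have hψm : Measurable ψ := hψ.mono invariantAlgebra_le le_rfl
  obtain ⟨B, hB⟩ := hψb
  have hψ2 : MemLp ψ 2 volume := MemLp.of_bound hψm.aestronglyMeasurable B
    (Eventually.of_forall hB)
  have hψK : InK a ha ψ := inK_of_measurable hψ hψ2
  have hac : Continuous a := continuous_of_lift ha.continuous
  obtain ⟨N, -, hN⟩ := exists_bound_of_continuous hac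
  have hm : ∀ i, Measurable fun v => ψ v * (a v i - b v i) := fun i => by
    have h1 : Measurable fun v => a v i := by
      have := hac.measurable
      fun_prop
    have h2 : Measurable fun v => b v i := by fun_prop
    exact hψm.mul (h1.sub h2)
  have hm2 : ∀ i, MemLp (fun v => ψ v * (a v i - b v i)) 2 volume := fun i => by
    refine MemLp.of_bound (hm i).aestronglyMeasurable (B * (N + M)) (Eventually.of_forall fun v => ?_)
    rw [norm_mul]
    refine mul_le_mul (hB v) ?_ (norm_nonneg _) ((norm_nonneg _).trans (hB v))
    exact (norm_sub_le _ _).trans (add_le_add ((PiLp.norm_apply_le _ i).trans (hN v))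
      ((PiLp.norm_apply_le _ i).trans (hM v)))
  -- `K` is stable under multiplication by bounded invariant functions, so `ψ` can be absorbed into
  -- `g`, and `a - b` is orthogonal to `K` componentwise.
  have horth : ∀ i g, InK a ha g → ∫ v, g v * (ψ v * (a v i - b v i)) = 0 := fun i g hg => by
    obtain ⟨g', hg', hgg'⟩ := hg.exists_measurable hdiv
    have h1 : InK a ha fun v => g' v * ψ v := by
      refine inK_of_measurable (hdiv := hdiv) (hg'.mul hψ) ?_
      exact (MemLp.of_bound hψm.aestronglyMeasurable B
        (Eventually.of_forall hB)).mul (hg.congr_ae hgg').memLp (p := 2) (q := ⊤)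
    rw [← hab _ h1 i]
    apply integral_congr_ae
    filter_upwards [hgg'] with v hv
    rw [hv]
    ring
  set χ : Fin d → ℝ × E d → ℝ := fun i p => fderiv ℝ φ p (0, EuclideanSpace.single i 1)
  have hχ : ∀ i, ContDiff ℝ ∞ (χ i) := fun i =>
    (hφ.fderiv_right (m := ∞) (by simp)).clm_apply contDiff_const
  have hχc : ∀ i, HasCompactSupport (χ i) := fun i => hc.fderiv_apply ℝ _
  have h1 : ∀ i, Tendsto (fun ε => oscPairing ε (u ε)
      (fun p v => χ i p * (ψ v * (a v i - b v i)))) (𝓝[>] 0) (𝓝 0) := fun i =>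
    hu.tendsto_orthogonal (hχ i) (hχc i) (hm i) (hm2 i) (horth i)
  have h2 := hu.tendsto_data (χ := fun x => φ (0, x)) hU hp (hφ.continuous.comp (Continuous.prodMk_right 0))
    (hasCompactSupport_slice_zero hc) hψm hψ2
  have h3 := h2.neg.sub (tendsto_finsetSum Finset.univ fun i _ => h1 i)
  simp only [Finset.sum_const_zero, sub_zero] at h3
  refine h3.congr' ?_
  filter_upwards [Ioc_mem_nhdsGT one_pos] with ε hε
  rw [← hu.weak_inK hdiv hε hφ hc hψK hψm]
  obtain ⟨R, hR⟩ := admissible_fderiv hac.measurable hN hφ hc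
  obtain ⟨R', hR'⟩ := admissible_fderiv hb hM hφ hc
  choose S hS using fun i => exists_admissible_of_contDiff (hχ i) (hχc i)
  have hui := hu.memLinftyL2 hε
  -- The field is split as `a = b + (a - b)`. Each component of the second part gives a test
  -- function orthogonal to `K`, whose pairing vanishes in the limit.
  have h4 : oscPairing ε (u ε) (fun p v => fderiv ℝ φ p (1, a v) * ψ v) =
      oscPairing ε (u ε) (fun p v => fderiv ℝ φ p (1, b v) * ψ v) +
        ∑ i, oscPairing ε (u ε) (fun p v => χ i p * (ψ v * (a v i - b v i))) := by
    simp only [oscPairing]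
    rw [← integral_finsetSum _ fun i _ => (hS i).integrable_oscPairing hε (hm i) (hm2 i) hui,
      ← integral_add (hR'.integrable_oscPairing hε hψm hψ2 hui)
        (integrable_finsetSum _ fun i _ => (hS i).integrable_oscPairing hε (hm i) (hm2 i) hui)]
    congr 1 with p
    rw [fderiv_apply_prodMk_eq_sum p (a (osc ε p.2)) (b (osc ε p.2)), ← Finset.mul_sum, ← mul_add,
      add_mul, Finset.sum_mul]
    congr 3 with i
    ring
  rw [h4, add_sub_cancel_right]

end Transport

/-! ### Convergence on smooth tensor products -/

/-- The error of the two-scale limit `f` on a test function `θ`. -/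
def oscDefect (ε : ℝ) (u : ℝ → E d → ℝ) (f : ℝ → E d × T d → ℝ) (θ : ℝ × E d → T d → ℝ) : ℝ :=
  oscPairing ε u θ - ∫ q, f q.1 q.2 * θ (q.1, q.2.1) q.2.2 ∂(timeMeasure.prod volume)

theorem Admissible.integrable_oscPairing' {R : ℝ} {θ : ℝ × E d → T d → ℝ} (hθ : Admissible R θ)
    {ε : ℝ} (hε : ε ∈ Ioc (0 : ℝ) 1) {u : ℝ → E d → ℝ} (hu : MemLinftyL2 u) :
    Integrable (fun p : ℝ × E d => u p.1 p.2 * θ p (osc ε p.2)) (timeMeasure.prod volume) := by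
  simpa using hθ.integrable_oscPairing hε (h := fun _ => 1) measurable_const (memLp_const 1) hu

theorem Admissible.oscDefect_add {R R' : ℝ} {θ θ' : ℝ × E d → T d → ℝ} (hθ : Admissible R θ)
    (hθ' : Admissible R' θ') {ε : ℝ} (hε : ε ∈ Ioc (0 : ℝ) 1) {u : ℝ → E d → ℝ}
    (hu : MemLinftyL2 u) {f : ℝ → E d × T d → ℝ} (hf : MemLinftyL2 f) :
    oscDefect ε u f (fun p v => θ p v + θ' p v) = oscDefect ε u f θ + oscDefect ε u f θ' := by
  simp only [oscDefect, oscPairing, mul_add]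
  rw [integral_add (hθ.integrable_oscPairing' hε hu) (hθ'.integrable_oscPairing' hε hu),
    integral_add (hθ.integrable_mul hf) (hθ'.integrable_mul hf)]
  ring

section

variable {a : T d → E d} {ha : ContDiff ℝ 1 (fun y : E d => a (proj y))}
  {hdiv : ∀ v, torusDiv a v = 0} {U₀ : E d × T d → ℝ} {u : ℝ → ℝ → E d → ℝ} {C : ℝ≥0}
  {b : T d → E d} {M : ℝ} {F : E d × T d → ℝ}

theorem OscSolution.norm_oscDefect_le (hu : OscSolution a U₀ u C) {f : ℝ → E d × T d → ℝ}
    (hf : MemLinftyL2 f) (R : ℝ) :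
    ∃ K : ℝ, 0 ≤ K ∧ ∀ ε ∈ Ioc (0 : ℝ) 1, ∀ (θ : ℝ × E d → T d → ℝ) (B : ℝ), Admissible R θ →
      0 ≤ B → (∀ p v, 0 ≤ p.1 → ‖θ p v‖ ≤ B) → ‖oscDefect ε (u ε) f θ‖ ≤ K * B := by
  obtain ⟨K, hK, hle⟩ := Admissible.exists_norm_integral_le R hf
  set L : ℝ≥0∞ := C * (ENNReal.ofReal R * oscConst d R)
  have hL : L ≠ ⊤ := ENNReal.mul_ne_top (by simp) (ENNReal.mul_ne_top (by simp) (oscConst_ne_top R))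
  refine ⟨L.toReal + K, by positivity, fun ε hε θ B hθ hB hb => ?_⟩
  rw [add_mul]
  refine (norm_sub_le _ _).trans (add_le_add ?_ (hle θ B hθ hB hb))
  have h1 := hθ.enorm_oscPairing_le hb hε (h := fun _ => 1) measurable_const (hu.measurable ε hε)
    (hu.bound ε hε)
  have h2 : eLpNorm (fun _ : T d => (1 : ℝ)) 2 volume = 1 := by
    rw [eLpNorm_const _ (by simp) (NeZero.ne _)]
    simp
  simp only [mul_one] at h1
  rw [h2, mul_one] at h1
  have h3 : C * (ENNReal.ofReal R * (ENNReal.ofReal B * oscConst d R)) = L * ENNReal.ofReal B := by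
    simp only [L]
    ring
  rw [h3] at h1
  have h4 := ENNReal.toReal_mono (ENNReal.mul_ne_top hL (by simp)) h1
  rwa [toReal_enorm, ENNReal.toReal_mul, ENNReal.toReal_ofReal hB] at h4

/-- Convergence on `χ(t, x) ψ(v)` for invariant `ψ`. -/
theorem OscSolution.tendsto_oscDefect_invariant (hu : OscSolution a U₀ u C)
    (hU : MemLp U₀ 2 volume) (hp : IsDataProfile U₀)
    (hb : Measurable[invariantAlgebra a ha hdiv] b) (hM : ∀ v, ‖b v‖ ≤ M)
    (hab : ∀ g, InK a ha g → ∀ i, ∫ v, g v * (a v i - b v i) = 0)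
    (hF : Measurable[invariantProd a ha hdiv] F) (hF2 : MemLp F 2 volume)
    (hFU : ∀ θ : E d × T d → ℝ, Measurable[invariantProd a ha hdiv] θ → MemLp θ 2 volume →
      ∫ p, F p * θ p = ∫ p, U₀ p * θ p)
    {χ : ℝ × E d → ℝ} (hχ : ContDiff ℝ ∞ χ) (hc : HasCompactSupport χ) {ψ : T d → ℝ}
    (hψ : Measurable[invariantAlgebra a ha hdiv] ψ) (hψb : ∃ B, ∀ v, ‖ψ v‖ ≤ B) :
    Tendsto (fun ε => oscDefect ε (u ε) (shear b F) (fun p v => χ p * ψ v)) (𝓝[>] 0) (𝓝 0) := by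
  have hbm : Measurable b := hb.mono invariantAlgebra_le le_rfl
  have hFm : Measurable F := hF.mono invariantProd_le le_rfl
  have hs : MemLinftyL2 (shear b F) := memLinftyL2_shear hbm hFm hF2
  -- Replacing `a` by `b` is justified only for invariant `ψ`, so the argument runs over the
  -- invariant `σ`-algebra. It can, because the level sets of `b` are themselves invariant.
  refine tendsto_zero_of_transport (invariantAlgebra a ha hdiv) invariantAlgebra_le hb hM
    (fun ε => oscDefect ε (u ε) (shear b F)) ?_ ?_ ?_ hχ hc hψ hψb
  · intro R θ θ' hθ hθ'
    filter_upwards [Ioc_mem_nhdsGT one_pos] with ε hε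
    exact hθ.oscDefect_add hθ' hε (hu.memLinftyL2 hε) hs
  · intro R
    obtain ⟨K, hK, hle⟩ := hu.norm_oscDefect_le hs R
    refine ⟨K, hK, ?_⟩
    filter_upwards [Ioc_mem_nhdsGT one_pos] with ε hε
    exact hle ε hε
  · intro φ hφ hφc ψ hψ hψb
    have hψm : Measurable ψ := hψ.mono invariantAlgebra_le le_rfl
    obtain ⟨B, hB⟩ := id hψb
    have hψ2 : MemLp ψ 2 volume := MemLp.of_bound hψm.aestronglyMeasurable B
      (Eventually.of_forall hB)
    have h1 := hu.tendsto_oscPairing_fderiv hU hp hbm hM hab hφ hφc hψ hψb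
    obtain ⟨R, hR⟩ := admissible_fderiv_mul hbm hM hφ hφc hψm hψb
    obtain ⟨R', hR'⟩ := exists_admissible_of_contDiff hφ hφc
    have hfd : ∀ (p : ℝ × E d) v w, fderiv ℝ (fun p => φ p * ψ v) p w = fderiv ℝ φ p w * ψ v := by
      intro p v w
      rw [fderiv_mul_const (hφ.differentiable (by simp)).differentiableAt]
      simp [mul_comm]
    have h2 := integral_shear_transport hbm hM hFm hF2 (φ := fun p v => φ p * ψ v) (R := max R R')
      (fun v => (hφ.of_le (by simp)).mul contDiff_const)
      (fun p v hp => by rw [hR'.eq_zero p v ((le_max_right _ _).trans_lt hp), zero_mul])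
      ⟨by simpa only [hfd] using hR.measurable, by simpa only [hfd] using hR.bounded, fun p v hp => by
        rw [hfd]; exact hR.eq_zero p v ((le_max_left _ _).trans_lt hp)⟩
    simp only [hfd] at h2
    have hφ0 : Continuous fun x : E d => φ (0, x) := hφ.continuous.comp (Continuous.prodMk_right 0)
    -- The pairing with `u_ε` tends to a term with `U₀`, while the shear yields one with `F`. They
    -- agree because the test function is measurable for the conditioning `σ`-algebra.
    have h3 := hFU (fun p => φ (0, p.1) * ψ p.2) (measurable_fst_mul_snd hφ0.measurable hψ)
      (MemLp.fst_mul_snd (hφ0.memLp_of_hasCompactSupport (hasCompactSupport_slice_zero hφc)) hψ2)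
    rw [h3] at h2
    have h4 := h1.sub_const (-∫ p, U₀ p * (φ (0, p.1) * ψ p.2))
    rw [sub_self, ← h2] at h4
    exact h4

/-- Convergence on `χ(t, x) ψ(v)` for continuous `ψ`. -/
theorem OscSolution.tendsto_oscDefect_mul (hu : OscSolution a U₀ u C)
    (hU : MemLp U₀ 2 volume) (hp : IsDataProfile U₀)
    (hb : Measurable[invariantAlgebra a ha hdiv] b) (hM : ∀ v, ‖b v‖ ≤ M)
    (hab : ∀ g, InK a ha g → ∀ i, ∫ v, g v * (a v i - b v i) = 0)
    (hF : Measurable[invariantProd a ha hdiv] F) (hF2 : MemLp F 2 volume)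
    (hFU : ∀ θ : E d × T d → ℝ, Measurable[invariantProd a ha hdiv] θ → MemLp θ 2 volume →
      ∫ p, F p * θ p = ∫ p, U₀ p * θ p)
    {χ : ℝ × E d → ℝ} (hχ : ContDiff ℝ ∞ χ) (hc : HasCompactSupport χ) (ψ : C(T d, ℝ)) :
    Tendsto (fun ε => oscDefect ε (u ε) (shear b F) (fun p v => χ p * ψ v)) (𝓝[>] 0) (𝓝 0) := by
  have hbm : Measurable b := hb.mono invariantAlgebra_le le_rfl
  have hFm : Measurable F := hF.mono invariantProd_le le_rfl
  have hs : MemLinftyL2 (shear b F) := memLinftyL2_shear hbm hFm hF2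
  have hψm := ψ.continuous.measurable
  -- `ψ` splits into its projection `c`, treated as an invariant test function, and `ψ - c`,
  -- orthogonal to `K`.
  obtain ⟨c, hcm, hcb, -, horth⟩ := exists_measurable_proj ha hdiv hψm (norm_eval_le ψ)
  have hcm' : Measurable c := hcm.mono invariantAlgebra_le le_rfl
  have hm : Measurable fun v => ψ v - c v := hψm.sub hcm'
  have hle : ∀ v, ‖ψ v - c v‖ ≤ ‖ψ‖ + ‖ψ‖ := fun v =>
    (norm_sub_le _ _).trans (add_le_add (norm_eval_le ψ v) (hcb v))
  have hm2 : MemLp (fun v => ψ v - c v) 2 volume := MemLp.of_bound hm.aestronglyMeasurable _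
    (Eventually.of_forall hle)
  obtain ⟨R, hR⟩ := exists_admissible_of_contDiff hχ hc
  have hadm : ∀ {h : T d → ℝ}, Measurable h → ∀ {B : ℝ}, (∀ v, ‖h v‖ ≤ B) →
      Admissible R (fun p v => χ p * h v) := by
    intro h hh B hB
    obtain ⟨N, hN⟩ := hR.bounded
    refine ⟨hR.measurable.mul (hh.comp measurable_snd), ⟨N * B, fun p v => ?_⟩, fun p v hp => ?_⟩
    · rw [norm_mul]
      exact mul_le_mul (hN p v) (hB v) (norm_nonneg _) ((norm_nonneg _).trans (hN p v))
    · rw [hR.eq_zero p v hp, zero_mul]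
  have h1 := hu.tendsto_oscDefect_invariant hU hp hb hM hab hF hF2 hFU hχ hc hcm ⟨_, hcb⟩
  have h2 := hu.tendsto_orthogonal hχ hc hm hm2 horth
  -- On the part orthogonal to `K` the limit contributes nothing, since almost every slice of the
  -- shear lies in `K`.
  have h3 : ∫ q, shear b F q.1 q.2 * (χ (q.1, q.2.1) * (ψ q.2.2 - c q.2.2))
      ∂(timeMeasure.prod volume) = 0 := by
    have hi := (hadm hm hle).integrable_mul hs
    obtain ⟨hi', heq⟩ := integral_prod_assoc_eq
      (h := fun t p => shear b F t p * (χ (t, p.1) * (ψ p.2 - c p.2))) hi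
    rw [← heq, integral_prod _ hi']
    apply integral_eq_zero_of_ae
    filter_upwards [inK_shear hb hF hF2] with p hp
    have h4 := horth _ hp
    calc ∫ v, shear b F p.1 (p.2, v) * (χ (p.1, p.2) * (ψ v - c v))
        = ∫ v, χ p * (shear b F p.1 (p.2, v) * (ψ v - c v)) := by
          congr 1 with v
          ring
      _ = 0 := by rw [integral_const_mul, h4, mul_zero]
  have h5 := h1.add h2
  rw [add_zero] at h5
  refine h5.congr' ?_
  filter_upwards [Ioc_mem_nhdsGT one_pos] with ε hε
  have h6 := (hadm hcm' hcb).oscDefect_add (hadm hm hle) hε (hu.memLinftyL2 hε) hs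
  have h7 : oscDefect ε (u ε) (shear b F) (fun p v => χ p * (ψ v - c v)) =
      oscPairing ε (u ε) (fun p v => χ p * (ψ v - c v)) := by
    rw [oscDefect, h3, sub_zero]
  rw [← h7, ← h6]
  congr 1 with p v
  ring

end

/-! ### Extension to all test functions in `L¹([0, ∞), L²(ℝ^d, C(𝕋^d)))` -/

theorem aestronglyMeasurable_osc {θ : ℝ → E d → C(T d, ℝ)}
    (hθ : AEStronglyMeasurable (Function.uncurry θ) (timeMeasure.prod volume)) (ε : ℝ) :
    AEStronglyMeasurable (Function.uncurry fun t x => θ t x (osc ε x))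
      (timeMeasure.prod volume) :=
  aestronglyMeasurable_eval hθ ((continuous_osc ε).comp continuous_snd).aestronglyMeasurable

theorem aestronglyMeasurable_torus {θ : ℝ → E d → C(T d, ℝ)}
    (hθ : AEStronglyMeasurable (Function.uncurry θ) (timeMeasure.prod volume)) :
    AEStronglyMeasurable (Function.uncurry fun t (p : E d × T d) => θ t p.1 p.2)
      (timeMeasure.prod volume) := by
  have h1 : MeasurePreserving (Prod.fst : E d × T d → E d) volume volume := measurePreserving_fst
  have h2 := (MeasurePreserving.id timeMeasure).prod h1
  exact aestronglyMeasurable_eval (hθ.comp_quasiMeasurePreserving h2.quasiMeasurePreserving)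
    (continuous_snd.comp continuous_snd).aestronglyMeasurable

theorem lintegral_eLpNorm_osc_le_mixed (θ : ℝ → E d → C(T d, ℝ)) (ε : ℝ) :
    ∫⁻ t, eLpNorm (fun x => θ t x (osc ε x)) 2 volume ∂timeMeasure ≤
      ∫⁻ t, eLpNorm (θ t) 2 volume ∂timeMeasure :=
  lintegral_mono fun _ => eLpNorm_mono fun _ => norm_eval_le _ _

theorem lintegral_eLpNorm_torus_le_mixed {θ : ℝ → E d → C(T d, ℝ)}
    (hθ : AEStronglyMeasurable (Function.uncurry θ) (timeMeasure.prod volume)) :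
    ∫⁻ t, eLpNorm (fun p : E d × T d => θ t p.1 p.2) 2 volume ∂timeMeasure ≤
      ∫⁻ t, eLpNorm (θ t) 2 volume ∂timeMeasure := by
  refine lintegral_mono_ae ?_
  filter_upwards [hθ.prodMk_left] with t ht
  have h1 : MeasurePreserving (Prod.fst : E d × T d → E d) volume volume := measurePreserving_fst
  have h2 : eLpNorm (fun p : E d × T d => θ t p.1) 2 volume = eLpNorm (θ t) 2 volume :=
    eLpNorm_comp_measurePreserving ht h1
  rw [← h2]
  exact eLpNorm_mono fun _ => norm_eval_le _ _

theorem MemL1L2.integrable_osc {θ : ℝ → E d → C(T d, ℝ)} (hθ : MemL1L2 θ) {u : ℝ → E d → ℝ}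
    (hu : MemLinftyL2 u) (ε : ℝ) :
    Integrable (fun p : ℝ × E d => u p.1 p.2 * θ p.1 p.2 (osc ε p.2))
      (timeMeasure.prod volume) :=
  integrable_pairing hu (aestronglyMeasurable_osc hθ.1 ε)
    ((lintegral_eLpNorm_osc_le_mixed θ ε).trans_lt hθ.2)

theorem MemL1L2.integrable_torus {θ : ℝ → E d → C(T d, ℝ)} (hθ : MemL1L2 θ)
    {f : ℝ → E d × T d → ℝ} (hf : MemLinftyL2 f) :
    Integrable (fun q : ℝ × (E d × T d) => f q.1 q.2 * θ q.1 q.2.1 q.2.2)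
      (timeMeasure.prod volume) :=
  integrable_pairing hf (aestronglyMeasurable_torus hθ.1)
    ((lintegral_eLpNorm_torus_le_mixed hθ.1).trans_lt hθ.2)

/-- The error of the two-scale limit `f` on `θ ∈ L¹([0, ∞), L²(ℝ^d, C(𝕋^d)))`. -/
def mixedDefect (ε : ℝ) (u : ℝ → E d → ℝ) (f : ℝ → E d × T d → ℝ) (θ : ℝ → E d → C(T d, ℝ)) : ℝ :=
  oscDefect ε u f fun p v => θ p.1 p.2 v

theorem MemL1L2.mixedDefect_add {θ θ' : ℝ → E d → C(T d, ℝ)} (hθ : MemL1L2 θ) (hθ' : MemL1L2 θ')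
    {u : ℝ → E d → ℝ} (hu : MemLinftyL2 u) {f : ℝ → E d × T d → ℝ} (hf : MemLinftyL2 f) (ε : ℝ) :
    mixedDefect ε u f (fun t x => θ t x + θ' t x) =
      mixedDefect ε u f θ + mixedDefect ε u f θ' := by
  simp only [mixedDefect, oscDefect, oscPairing, ContinuousMap.add_apply, mul_add]
  rw [integral_add (hθ.integrable_osc hu ε) (hθ'.integrable_osc hu ε),
    integral_add (hθ.integrable_torus hf) (hθ'.integrable_torus hf)]
  ring

theorem MemL1L2.mixedDefect_sub {θ θ' : ℝ → E d → C(T d, ℝ)} (hθ : MemL1L2 θ) (hθ' : MemL1L2 θ')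
    {u : ℝ → E d → ℝ} (hu : MemLinftyL2 u) {f : ℝ → E d × T d → ℝ} (hf : MemLinftyL2 f) (ε : ℝ) :
    mixedDefect ε u f (fun t x => θ t x - θ' t x) =
      mixedDefect ε u f θ - mixedDefect ε u f θ' := by
  simp only [mixedDefect, oscDefect, oscPairing, ContinuousMap.sub_apply, mul_sub]
  rw [integral_sub (hθ.integrable_osc hu ε) (hθ'.integrable_osc hu ε),
    integral_sub (hθ.integrable_torus hf) (hθ'.integrable_torus hf)]
  ring

theorem enorm_mixedDefect_le {θ : ℝ → E d → C(T d, ℝ)}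
    (hθ : AEStronglyMeasurable (Function.uncurry θ) (timeMeasure.prod volume))
    {u : ℝ → E d → ℝ} {f : ℝ → E d × T d → ℝ} {C C' : ℝ≥0}
    (hu : AEStronglyMeasurable (Function.uncurry u) (timeMeasure.prod volume))
    (hC : ∀ᵐ t ∂timeMeasure, eLpNorm (u t) 2 volume ≤ C)
    (hf : AEStronglyMeasurable (Function.uncurry f) (timeMeasure.prod volume))
    (hC' : ∀ᵐ t ∂timeMeasure, eLpNorm (f t) 2 volume ≤ C') (ε : ℝ) :
    ‖mixedDefect ε u f θ‖ₑ ≤ (C + C') * ∫⁻ t, eLpNorm (θ t) 2 volume ∂timeMeasure := by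
  rw [add_mul]
  refine enorm_sub_le.trans (add_le_add ?_ ?_)
  · exact (enorm_integral_pairing_le hu (aestronglyMeasurable_osc hθ ε) hC).trans
      (mul_le_mul' le_rfl (lintegral_eLpNorm_osc_le_mixed θ ε))
  · exact (enorm_integral_pairing_le hf (aestronglyMeasurable_torus hθ) hC').trans
      (mul_le_mul' le_rfl (lintegral_eLpNorm_torus_le_mixed hθ))

theorem aemeasurable_eLpNorm_slice {G : Type*} [NormedAddCommGroup G] {g : ℝ × E d → G}
    (hg : AEStronglyMeasurable g (timeMeasure.prod volume)) :
    AEMeasurable (fun t => eLpNorm (fun x => g (t, x)) 2 volume) timeMeasure := by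
  have h1 : ∀ t, eLpNorm (fun x => g (t, x)) 2 volume =
      (∫⁻ x, ‖g (t, x)‖ₑ ^ (2 : ℝ)) ^ (1 / 2 : ℝ) := fun t => by
    rw [eLpNorm_eq_lintegral_rpow_enorm_toReal (by simp) (by simp)]
    simp
  simp only [h1]
  exact ((hg.enorm.pow_const 2).lintegral_prod_right').pow_const _

theorem lintegral_eLpNorm_slice_sq {G : Type*} [NormedAddCommGroup G] {g : ℝ × E d → G}
    (hg : AEStronglyMeasurable g (timeMeasure.prod volume)) :
    ∫⁻ t, eLpNorm (fun x => g (t, x)) 2 volume ^ 2 ∂timeMeasure =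
      eLpNorm g 2 (timeMeasure.prod volume) ^ 2 := by
  simp only [eLpNorm_two_sq]
  exact (lintegral_prod _ (hg.enorm.pow_const 2)).symm

/-- By Cauchy–Schwarz in time, multiplication by `κ ∈ L²` maps `L²` in `(t, x)` into `L¹` in time
with values in `L²`. Density can thus be proved in a plain `L²` space and then transferred. -/
theorem lintegral_eLpNorm_smul_le {G : Type*} [NormedAddCommGroup G] [NormedSpace ℝ G] {κ : ℝ → ℝ}
    (hκ : AEStronglyMeasurable κ timeMeasure) {g : ℝ × E d → G}
    (hg : AEStronglyMeasurable g (timeMeasure.prod volume)) :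
    ∫⁻ t, eLpNorm (fun x => κ t • g (t, x)) 2 volume ∂timeMeasure ≤
      eLpNorm κ 2 timeMeasure * eLpNorm g 2 (timeMeasure.prod volume) := by
  have h1 : ∀ t, eLpNorm (fun x => κ t • g (t, x)) 2 volume =
      ‖κ t‖ₑ * eLpNorm (fun x => g (t, x)) 2 volume := fun t =>
    eLpNorm_const_smul (κ t) (fun x => g (t, x)) 2 volume
  simp only [h1]
  refine (ENNReal.lintegral_mul_le_Lp_mul_Lq timeMeasure Real.HolderConjugate.two_two hκ.enorm
    (aemeasurable_eLpNorm_slice hg)).trans (le_of_eq ?_)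
  congr 1
  · rw [eLpNorm_eq_lintegral_rpow_enorm_toReal (by simp) (by simp)]
    simp
  · simp only [ENNReal.rpow_ofNat]
    rw [lintegral_eLpNorm_slice_sq hg, ← ENNReal.rpow_natCast, ← ENNReal.rpow_mul]
    simp

theorem lintegral_eLpNorm_smul_sub_le {G : Type*} [NormedAddCommGroup G] [NormedSpace ℝ G]
    {κ : ℝ → ℝ} (hκ : AEStronglyMeasurable κ timeMeasure) {g g' : ℝ × E d → G}
    (hg : AEStronglyMeasurable g (timeMeasure.prod volume))
    (hg' : AEStronglyMeasurable g' (timeMeasure.prod volume)) :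
    ∫⁻ t, eLpNorm (fun x => κ t • g (t, x) - κ t • g' (t, x)) 2 volume ∂timeMeasure ≤
      eLpNorm κ 2 timeMeasure * eLpNorm (fun p => g p - g' p) 2 (timeMeasure.prod volume) := by
  simp only [← smul_sub]
  exact lintegral_eLpNorm_smul_le (g := fun p => g p - g' p) hκ (hg.sub hg')

theorem memL1L2_smul {G : Type*} [NormedAddCommGroup G] [NormedSpace ℝ G] {κ : ℝ → ℝ}
    (hκ : MemLp κ 2 timeMeasure) {g : ℝ × E d → G} (hg : MemLp g 2 (timeMeasure.prod volume)) :
    MemL1L2 fun t x => κ t • g (t, x) :=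
  ⟨hκ.1.comp_fst.smul hg.1, (lintegral_eLpNorm_smul_le hκ.1 hg.1).trans_lt
    (ENNReal.mul_lt_top hκ.2 hg.2)⟩

instance : IsLocallyFiniteMeasure timeMeasure := by unfold timeMeasure; infer_instance

theorem exists_contDiff_near_indicator {G : Type*} [NormedAddCommGroup G] [NormedSpace ℝ G]
    (c : G) {s : Set (ℝ × E d)} (hs : MeasurableSet s)
    (hs' : (timeMeasure.prod (volume : Measure (E d))) s < ⊤) {η : ℝ≥0∞} (hη : η ≠ 0) :
    ∃ χ : ℝ × E d → ℝ, ContDiff ℝ ∞ χ ∧ HasCompactSupport χ ∧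
      eLpNorm ((fun p => χ p • c) - s.indicator fun _ => c) 2 (timeMeasure.prod volume) ≤ η := by
  have h1 : MemLp (s.indicator fun _ => (1 : ℝ)) 2 (timeMeasure.prod (volume : Measure (E d))) :=
    memLp_indicator_const 2 hs 1 (Or.inr hs'.ne)
  obtain ⟨δ, hδ, hle⟩ : ∃ δ : ℝ, 0 < δ ∧ ENNReal.ofReal δ * ‖c‖ₑ ≤ η := by
    obtain ⟨r, hr, hrη⟩ := ENNReal.lt_iff_exists_nnreal_btwn.1 (pos_iff_ne_zero.2 hη)
    have hr0 : 0 < r := by simpa using hr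
    -- The added `1` covers the case `c = 0`.
    refine ⟨r / (‖c‖ + 1), by positivity, le_trans ?_ hrη.le⟩
    rw [← ofReal_norm, ← ENNReal.ofReal_mul (by positivity), ← ENNReal.ofReal_coe_nnreal]
    apply ENNReal.ofReal_le_ofReal
    rw [div_mul_eq_mul_div, div_le_iff₀ (by positivity)]
    nlinarith [r.2, norm_nonneg c]
  obtain ⟨χ, hc, hχ, hχ'⟩ := h1.exist_eLpNorm_sub_le (by simp) (by norm_num) hδ
  refine ⟨χ, hχ, hc, le_trans ?_ ((mul_le_mul' hχ' le_rfl).trans hle)⟩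
  have h2 : ∀ p, ‖((fun p => χ p • c) - s.indicator fun _ => c) p‖ =
      ‖(‖c‖ • (s.indicator (fun _ => (1 : ℝ)) - χ)) p‖ := by
    intro p
    have : ((fun p => χ p • c) - s.indicator fun _ => c) p =
        (χ p - s.indicator (fun _ => (1 : ℝ)) p) • c := by
      by_cases hp : p ∈ s <;> simp [hp, sub_smul]
    rw [this, norm_smul, Pi.smul_apply, Pi.sub_apply, norm_smul, norm_norm, mul_comm, norm_sub_rev]
  rw [eLpNorm_congr_norm_ae (ae_of_all _ h2), eLpNorm_const_smul, enorm_norm, mul_comm]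

/-! ### Density -/

/-- Simple functions are dense in `L²`, and each indicator can be replaced by a smooth scalar
function times the same vector. Hence a property that is additive and holds for these products is
reached by approximation. -/
theorem exists_near_of_smooth_smul {G : Type*} [NormedAddCommGroup G] [NormedSpace ℝ G]
    {P : (ℝ × E d → G) → Prop}
    (hP : ∀ (χ : ℝ × E d → ℝ) (c : G), ContDiff ℝ ∞ χ → HasCompactSupport χ → P fun p => χ p • c)
    (hadd : ∀ g g', MemLp g 2 (timeMeasure.prod volume) → MemLp g' 2 (timeMeasure.prod volume) →
      P g → P g' → P fun p => g p + g' p)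
    {g : ℝ × E d → G} (hg : MemLp g 2 (timeMeasure.prod volume)) {δ : ℝ≥0∞} (hδ : δ ≠ 0) :
    ∃ g', MemLp g' 2 (timeMeasure.prod volume) ∧ P g' ∧
      eLpNorm (fun p => g p - g' p) 2 (timeMeasure.prod volume) ≤ δ := by
  obtain ⟨g', hle, hg', hPg'⟩ := hg.induction_dense (by simp)
    (fun g => MemLp g 2 (timeMeasure.prod volume) ∧ P g)
    (fun c s hs hs' η hη => by
      obtain ⟨χ, hχ, hc, hle⟩ := exists_contDiff_near_indicator c hs hs' hη
      exact ⟨_, hle, (hχ.continuous.smul continuous_const).memLp_of_hasCompactSupport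
        hc.smul_right, hP χ c hχ hc⟩)
    (fun g₁ g₂ h₁ h₂ => ⟨h₁.1.add h₂.1, hadd _ _ h₁.1 h₂.1 h₁.2 h₂.2⟩)
    (fun g h => h.1.1) hδ
  exact ⟨g', hg', hPg', hle⟩

theorem exists_near_of_smooth_smul_continuousMap {P : (ℝ × E d → C(T d, ℝ)) → Prop}
    (hP : ∀ (χ : ℝ × E d → ℝ) (c : C(T d, ℝ)), ContDiff ℝ ∞ χ → HasCompactSupport χ →
      P fun p => χ p • c)
    (hadd : ∀ g g', MemLp g 2 (timeMeasure.prod volume) → MemLp g' 2 (timeMeasure.prod volume) →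
      P g → P g' → P fun p => g p + g' p)
    {g : ℝ × E d → C(T d, ℝ)} (hg : MemLp g 2 (timeMeasure.prod volume)) {δ : ℝ≥0∞} (hδ : δ ≠ 0) :
    ∃ g', MemLp g' 2 (timeMeasure.prod volume) ∧ P g' ∧
      eLpNorm (fun p => g p - g' p) 2 (timeMeasure.prod volume) ≤ δ :=
  exists_near_of_smooth_smul hP hadd hg hδ

section Density

variable {a : T d → E d} {U₀ : E d × T d → ℝ} {u : ℝ → ℝ → E d → ℝ} {C : ℝ≥0}
  {f : ℝ → E d × T d → ℝ}

/-- The defects are bounded, uniformly in small `ε`, by a multiple of the mixed norm of the test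
function. -/
theorem OscSolution.tendsto_mixedDefect_of_approx (hu : OscSolution a U₀ u C)
    (hf : MemLinftyL2 f) {θ : ℝ → E d → C(T d, ℝ)} (hθ : MemL1L2 θ) {K : ℝ≥0∞} (hK : K ≠ ⊤)
    (h : ∀ δ : ℝ≥0∞, δ ≠ 0 → ∃ θ' : ℝ → E d → C(T d, ℝ), MemL1L2 θ' ∧
      Tendsto (fun ε => mixedDefect ε (u ε) f θ') (𝓝[>] 0) (𝓝 0) ∧
      ∫⁻ t, eLpNorm (fun x => θ t x - θ' t x) 2 volume ∂timeMeasure ≤ K * δ) :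
    Tendsto (fun ε => mixedDefect ε (u ε) f θ) (𝓝[>] 0) (𝓝 0) := by
  obtain ⟨hfm, C', hC'⟩ := id hf
  refine tendsto_zero_of_approx (K := (C + C') * K) (ENNReal.mul_ne_top (by simp) hK)
    fun δ hδ => ?_
  obtain ⟨θ', hθ', hlim, hle⟩ := h δ hδ
  refine ⟨_, hlim, ?_⟩
  filter_upwards [Ioc_mem_nhdsGT one_pos] with ε hε
  rw [← hθ.mixedDefect_sub hθ' (hu.memLinftyL2 hε) hf ε, mul_assoc]
  refine (enorm_mixedDefect_le (hθ.1.sub hθ'.1) (hu.measurable ε hε) (hu.bound ε hε) hfm hC'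
    ε).trans ?_
  exact mul_le_mul' le_rfl hle

theorem tendsto_mixedDefect_mul
    (hlim : ∀ (χ : ℝ × E d → ℝ) (ψ : C(T d, ℝ)), ContDiff ℝ ∞ χ → HasCompactSupport χ →
      Tendsto (fun ε => oscDefect ε (u ε) f (fun p v => χ p * ψ v)) (𝓝[>] 0) (𝓝 0))
    {κ : ℝ → ℝ} (hκ : ContDiff ℝ ∞ κ) {χ : ℝ × E d → ℝ} (hχ : ContDiff ℝ ∞ χ)
    (hc : HasCompactSupport χ) {c : C(T d, ℝ)} {θ : ℝ → E d → C(T d, ℝ)}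
    (hθ : ∀ t x v, θ t x v = κ t * χ (t, x) * c v) :
    Tendsto (fun ε => mixedDefect ε (u ε) f θ) (𝓝[>] 0) (𝓝 0) := by
  have h1 := hlim (fun p => κ p.1 * χ p) c ((hκ.comp contDiff_fst).mul hχ) hc.mul_left
  have h2 : ∀ ε, mixedDefect ε (u ε) f θ =
      oscDefect ε (u ε) f (fun p v => κ p.1 * χ p * c v) := fun ε => by
    rw [mixedDefect]
    congr 1 with p v
    exact hθ _ _ _
  simp only [h2]
  exact h1

/-- Convergence on the test function `κ(t) g(t, x)`. -/
def VanishingDefect (u : ℝ → ℝ → E d → ℝ) (f : ℝ → E d × T d → ℝ) (κ : ℝ → ℝ)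
    (g : ℝ × E d → C(T d, ℝ)) : Prop :=
  Tendsto (fun ε => mixedDefect ε (u ε) f (fun t x => κ t • g (t, x))) (𝓝[>] 0) (𝓝 0)

theorem OscSolution.vanishingDefect_add (hu : OscSolution a U₀ u C) (hf : MemLinftyL2 f)
    {κ : ℝ → ℝ} (hκ2 : MemLp κ 2 timeMeasure) {g₁ g₂ : ℝ × E d → C(T d, ℝ)}
    (h₁ : MemLp g₁ 2 (timeMeasure.prod volume)) (h₂ : MemLp g₂ 2 (timeMeasure.prod volume))
    (k₁ : VanishingDefect u f κ g₁) (k₂ : VanishingDefect u f κ g₂) :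
    VanishingDefect u f κ fun p => g₁ p + g₂ p := by
  have h3 := k₁.add k₂
  rw [add_zero] at h3
  refine h3.congr' ?_
  filter_upwards [Ioc_mem_nhdsGT one_pos] with ε hε
  have h4 := (memL1L2_smul hκ2 h₁).mixedDefect_add (memL1L2_smul hκ2 h₂) (hu.memLinftyL2 hε) hf ε
  rw [← h4]
  simp only [smul_add]

theorem vanishingDefect_smul
    (hlim : ∀ (χ : ℝ × E d → ℝ) (ψ : C(T d, ℝ)), ContDiff ℝ ∞ χ → HasCompactSupport χ →
      Tendsto (fun ε => oscDefect ε (u ε) f (fun p v => χ p * ψ v)) (𝓝[>] 0) (𝓝 0))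
    {κ : ℝ → ℝ} (hκ : ContDiff ℝ ∞ κ) (χ : ℝ × E d → ℝ) (c : C(T d, ℝ)) (hχ : ContDiff ℝ ∞ χ)
    (hc : HasCompactSupport χ) : VanishingDefect u f κ fun p => χ p • c :=
  tendsto_mixedDefect_mul hlim hκ hχ hc (c := c) fun t x v => by
    simp only [ContinuousMap.smul_apply, smul_eq_mul, mul_assoc]

theorem OscSolution.vanishingDefect (hu : OscSolution a U₀ u C) (hf : MemLinftyL2 f)
    (hlim : ∀ (χ : ℝ × E d → ℝ) (ψ : C(T d, ℝ)), ContDiff ℝ ∞ χ → HasCompactSupport χ →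
      Tendsto (fun ε => oscDefect ε (u ε) f (fun p v => χ p * ψ v)) (𝓝[>] 0) (𝓝 0))
    {κ : ℝ → ℝ} (hκ : ContDiff ℝ ∞ κ) (hκ2 : MemLp κ 2 timeMeasure)
    {g : ℝ × E d → C(T d, ℝ)} (hg : MemLp g 2 (timeMeasure.prod volume)) :
    VanishingDefect u f κ g := by
  refine hu.tendsto_mixedDefect_of_approx hf (memL1L2_smul hκ2 hg) hκ2.2.ne fun δ hδ => ?_
  obtain ⟨g', hg', hlim', hle⟩ := exists_near_of_smooth_smul_continuousMap (P := VanishingDefect u f κ)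
    (vanishingDefect_smul hlim hκ) (fun _ _ => hu.vanishingDefect_add hf hκ2) hg hδ
  exact ⟨_, memL1L2_smul hκ2 hg', hlim',
    (lintegral_eLpNorm_smul_sub_le hκ2.1 hg.1 hg'.1).trans (mul_le_mul' le_rfl hle)⟩

/-- A smooth function of time equal to `1` before `n` and vanishing after `n + 1`. -/
def timeCutoff (n : ℕ) (t : ℝ) : ℝ := 1 - Real.smoothTransition (t - n)

theorem contDiff_timeCutoff (n : ℕ) : ContDiff ℝ ∞ (timeCutoff n) :=
  contDiff_const.sub (Real.smoothTransition.contDiff.comp (contDiff_id.sub contDiff_const))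

theorem timeCutoff_eq_one {n : ℕ} {t : ℝ} (h : t ≤ n) : timeCutoff n t = 1 := by
  rw [timeCutoff, Real.smoothTransition.zero_of_nonpos (by linarith), sub_zero]

theorem memLp_timeCutoff (n : ℕ) : MemLp (timeCutoff n) 2 timeMeasure := by
  have h1 : MemLp ((Iic (n + 1 : ℝ)).indicator fun _ => (1 : ℝ)) 2 timeMeasure := by
    refine memLp_indicator_const 2 measurableSet_Iic 1 (Or.inr ?_)
    rw [timeMeasure, Measure.restrict_apply measurableSet_Iic, inter_comm, Ici_inter_Iic]
    simp
  refine h1.of_le (contDiff_timeCutoff n).continuous.aestronglyMeasurable (ae_of_all _ fun t => ?_)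
  by_cases ht : t ≤ n + 1
  · rw [indicator_of_mem (show t ∈ Iic (n + 1 : ℝ) from ht), norm_one, Real.norm_eq_abs, timeCutoff,
      abs_le]
    constructor <;> linarith [Real.smoothTransition.nonneg (t - n),
      Real.smoothTransition.le_one (t - n)]
  · rw [timeCutoff, Real.smoothTransition.one_of_one_le (by linarith)]
    simp

/-- Keeping only the times `t ≤ n` at which the spatial norm is at most `n` gives a function square
integrable in `(t, x)`; what is discarded tends to zero by dominated convergence. The smooth time
cutoff equals one on the times kept, so it does not affect the product. -/
theorem MemL1L2.exists_truncation {G : Type*} [NormedAddCommGroup G] [NormedSpace ℝ G]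
    {θ : ℝ → E d → G} (hθ : MemL1L2 θ) {δ : ℝ≥0∞}
    (hδ : δ ≠ 0) :
    ∃ (n : ℕ) (g : ℝ × E d → G), MemLp g 2 (timeMeasure.prod volume) ∧
      ∫⁻ t, eLpNorm (fun x => θ t x - timeCutoff n t • g (t, x)) 2 volume ∂timeMeasure ≤ δ := by
  have hm : AEMeasurable (fun t => eLpNorm (θ t) 2 volume) timeMeasure :=
    aemeasurable_eLpNorm_slice (g := Function.uncurry θ) hθ.1
  obtain ⟨m, hmm, hme⟩ := hm
  have hmi : ∫⁻ t, m t ∂timeMeasure < ⊤ := by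
    rw [← lintegral_congr_ae hme]
    exact hθ.2
  set A : ℕ → Set ℝ := fun n => {t | t ≤ n ∧ m t ≤ n}
  have hA : ∀ n, MeasurableSet (A n) := fun n =>
    measurableSet_Iic.inter (measurableSet_le hmm measurable_const)
  have hlim : Tendsto (fun n => ∫⁻ t, (A n)ᶜ.indicator m t ∂timeMeasure) atTop (𝓝 0) := by
    have h0 : ∫⁻ t : ℝ, (0 : ℝ≥0∞) ∂timeMeasure = 0 := by simp
    rw [← h0]
    refine tendsto_lintegral_of_dominated_convergence m (fun n => hmm.indicator (hA n).compl)
      (fun n => ae_of_all _ fun t => indicator_le_self _ _ t) hmi.ne ?_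
    filter_upwards [ae_lt_top hmm hmi.ne] with t ht
    refine tendsto_const_nhds.congr' ?_
    obtain ⟨N, hN⟩ := exists_nat_ge (max t (m t).toReal)
    filter_upwards [eventually_ge_atTop N] with n hn
    have hn' : (N : ℝ) ≤ n := by exact_mod_cast hn
    rw [indicator_of_notMem]
    rw [notMem_compl_iff]
    refine ⟨(le_max_left _ _).trans (hN.trans hn'), ?_⟩
    rw [← ENNReal.ofReal_toReal ht.ne, ← ENNReal.ofReal_natCast]
    exact ENNReal.ofReal_le_ofReal ((le_max_right _ _).trans (hN.trans hn'))
  obtain ⟨n, hn⟩ := ((tendsto_order.1 hlim).2 δ (pos_iff_ne_zero.2 hδ)).exists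
  set g : ℝ × E d → G := fun p => (A n).indicator (fun _ => (1 : ℝ)) p.1 • θ p.1 p.2
  have hgm : AEStronglyMeasurable g (timeMeasure.prod volume) :=
    AEStronglyMeasurable.smul (f := fun p : ℝ × E d => (A n).indicator (fun _ => (1 : ℝ)) p.1)
      ((measurable_const.indicator (hA n)).comp measurable_fst).aestronglyMeasurable hθ.1
  have hgn : ∀ t, eLpNorm (fun x => g (t, x)) 2 volume =
      (A n).indicator (fun t => eLpNorm (θ t) 2 volume) t := fun t => by
    by_cases ht : t ∈ A n <;> simp [g, ht]
  refine ⟨n, g, ⟨hgm, ?_⟩, ?_⟩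
  · refine (ENNReal.pow_lt_top_iff.1 ?_).resolve_right two_ne_zero
    rw [← lintegral_eLpNorm_slice_sq hgm]
    -- Where the norm is at most `n`, its square is at most `n` times itself, which is integrable in
    -- time.
    refine lt_of_le_of_lt (b := ∫⁻ t, n * m t ∂timeMeasure) (lintegral_mono_ae ?_) ?_
    · filter_upwards [hme] with t ht
      rw [hgn]
      by_cases h : t ∈ A n
      · rw [indicator_of_mem h, ht, sq]
        exact mul_le_mul' h.2 le_rfl
      · rw [indicator_of_notMem h]
        simp
    · rw [lintegral_const_mul _ hmm]
      exact ENNReal.mul_lt_top (by simp) hmi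
  · refine le_trans (lintegral_mono_ae ?_) hn.le
    filter_upwards [hme] with t ht
    by_cases h : t ∈ A n
    · simp [g, h, timeCutoff_eq_one h.1]
    · simp only [g, indicator_of_notMem h, zero_smul, smul_zero, sub_zero]
      rw [indicator_of_mem (show t ∈ (A n)ᶜ from h), ← ht]

theorem OscSolution.doubleScaleConverges (hu : OscSolution a U₀ u C) (hf : MemLinftyL2 f)
    (hlim : ∀ (χ : ℝ × E d → ℝ) (ψ : C(T d, ℝ)), ContDiff ℝ ∞ χ → HasCompactSupport χ →
      Tendsto (fun ε => oscDefect ε (u ε) f (fun p v => χ p * ψ v)) (𝓝[>] 0) (𝓝 0)) :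
    DoubleScaleConverges u f := by
  intro θ hθ
  have h1 : Tendsto (fun ε => mixedDefect ε (u ε) f θ) (𝓝[>] 0) (𝓝 0) := by
    refine hu.tendsto_mixedDefect_of_approx hf hθ ENNReal.one_ne_top fun δ hδ => ?_
    obtain ⟨n, g, hg, hle⟩ := hθ.exists_truncation hδ
    exact ⟨_, memL1L2_smul (memLp_timeCutoff n) hg,
      hu.vanishingDefect hf hlim (contDiff_timeCutoff n) (memLp_timeCutoff n) hg,
      by rwa [one_mul]⟩
  have h2 : ∫ t in Ici (0 : ℝ), ∫ x, ∫ v, f t (x, v) * θ t x v =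
      ∫ q, f q.1 q.2 * θ q.1 q.2.1 q.2.2 ∂(timeMeasure.prod volume) :=
    integral_time_prod_torus (h := fun t p => f t p * θ t p.1 p.2) (hθ.integrable_torus hf)
  rw [h2, ← tendsto_sub_nhds_zero_iff]
  refine h1.congr' ?_
  filter_upwards [Ioc_mem_nhdsGT one_pos] with ε hε
  have h3 : doubleScaleKinetic ε (u ε) θ =
      ∫ p : ℝ × E d, u ε p.1 p.2 * θ p.1 p.2 (osc ε p.2) ∂(timeMeasure.prod volume) :=
    integral_time_prod (hθ.integrable_osc (hu.memLinftyL2 hε) ε)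
  rw [h3]
  rfl

/-- Test functions constant in `v` do not see the fast variable, and their norm in `C(𝕋^d)` is the
absolute value. -/
theorem DoubleScaleConverges.weakStarConverges (h : DoubleScaleConverges u f) :
    WeakStarConverges u fun t x => ∫ v, f t (x, v) := by
  intro χ hχ
  have hc : Continuous (ContinuousMap.const (T d) : ℝ → C(T d, ℝ)) :=
    ContinuousMap.continuous_const'
  have h1 : MemL1L2 fun t x => ContinuousMap.const (T d) (χ t x) := by
    refine ⟨hc.comp_aestronglyMeasurable hχ.1, lt_of_eq_of_lt ?_ hχ.2⟩
    refine lintegral_congr fun t => eLpNorm_congr_norm_ae (ae_of_all _ fun x => ?_)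
    exact le_antisymm ((ContinuousMap.norm_le _ (norm_nonneg _)).2 fun _ => le_rfl)
      (norm_eval_le (ContinuousMap.const (T d) (χ t x)) 0)
  have h2 := h _ h1
  simp only [doubleScaleKinetic, ContinuousMap.const_apply, integral_mul_const] at h2
  exact h2

end Density

end Homog

end

/-! ### The homogenization theorem -/

theorem mainTheorem1 {d : ℕ} (a : Homog.T d → Homog.E d)
    (ha : ContDiff ℝ 1 (fun y : Homog.E d => a (Homog.proj y)))
    (hdiv : ∀ v, Homog.torusDiv a v = 0) :
    -- every profile in `L²(ℝ^d, C(𝕋^d))` satisfies the three hypotheses on the data made below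
    (∀ V : Homog.E d → C(Homog.T d, ℝ), MemLp V 2 volume →
      MemLp (fun p : Homog.E d × Homog.T d => V p.1 p.2) 2 volume ∧
        Homog.BoundedData (fun p : Homog.E d × Homog.T d => V p.1 p.2) ∧
        Homog.IsDataProfile (fun p : Homog.E d × Homog.T d => V p.1 p.2)) ∧
    ∀ U₀ : Homog.E d × Homog.T d → ℝ, MemLp U₀ 2 volume → Homog.BoundedData U₀ →
      Homog.IsDataProfile U₀ →
      ∃ f : ℝ → Homog.E d × Homog.T d → ℝ,
        -- `f` lies in `L^∞([0, ∞), L²(ℝ^d × 𝕋^d))` and solves the kinetic problem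
        Homog.IsKineticSolution (Homog.projField a ha)
          (fun x => Homog.projFun a ha (fun v => U₀ (x, v))) f ∧
        -- `f(t, x, ·) ∈ K` for a.e. `(t, x)`
        (∀ᵐ p ∂(Homog.timeMeasure.prod (volume : Measure (Homog.E d))),
          Homog.InK a ha (fun v => f p.1 (p.2, v))) ∧
        -- `f` is the unique solution of the kinetic problem
        (∀ g : ℝ → Homog.E d × Homog.T d → ℝ,
          Homog.IsKineticSolution (Homog.projField a ha)
            (fun x => Homog.projFun a ha (fun v => U₀ (x, v))) g →
          Function.uncurry g =ᵐ[Homog.timeMeasure.prod volume] Function.uncurry f) ∧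
        -- the whole families `f_ε` and `u_ε` converge, to `f` and to `∫ f dv`
        ∀ u : ℝ → ℝ → Homog.E d → ℝ,
          (∀ ε ∈ Ioc (0 : ℝ) 1,
            Homog.IsTransportSolution (fun x => a (Homog.osc ε x))
              (fun x => U₀ (x, Homog.osc ε x)) (u ε)) →
          Homog.DoubleScaleConverges u f ∧
            Homog.WeakStarConverges u (fun t x => ∫ v, f t (x, v)) := by
  refine ⟨fun V hV => ⟨Homog.memLp_uncurry_of_memLp hV, Homog.boundedData_of_memLp hV,
    Homog.isDataProfile_of_memLp hV⟩, fun U₀ hU hbd hp => ?_⟩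
  obtain ⟨b, hb, ⟨M, hM⟩, hbb, hab⟩ := Homog.exists_field a ha hdiv
  obtain ⟨F, hF, hF2, hPF, hFU⟩ := Homog.exists_profile a ha hdiv hU
  have hbm : Measurable b := hb.mono Homog.invariantAlgebra_le le_rfl
  have hFm : Measurable F := hF.mono Homog.invariantProd_le le_rfl
  have hsol := Homog.isKineticSolution_shear hbm hM hbb hFm hF2 hPF
  refine ⟨Homog.shear b F, hsol, Homog.inK_shear hb hF hF2,
    fun g hg => hsol.ae_eq hbm hM hbb hg, fun u hu => ?_⟩
  obtain ⟨C, hC⟩ := Homog.exists_oscSolution ha hdiv hbd hu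
  have hconv : Homog.DoubleScaleConverges u (Homog.shear b F) :=
    hC.doubleScaleConverges hsol.1 fun χ ψ hχ hc =>
      hC.tendsto_oscDefect_mul hU hp hb hM hab hF hF2 hFU hχ hc ψ
  exact ⟨hconv, hconv.weakStarConverges⟩
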